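/- Graphs are simple and undirected; a graph map sends each edge to an edge or to a vertex. Let $I^n$ be the discrete $n$-cube graph (vertex set $\{0,1\}^n$, two vertices adjacent iff they differ in exactly one coordinate). A singular $n$-cube of a graph $G$ is a graph map $\sigma\colon I^n\to G$; its faces $f_i^{-}\sigma$, $f_i^{+}\sigma$ are obtained by fixing the $i$-th coordinate to be $0$, respectively $1$, and $\sigma$ is degenerate if $f_i^-\sigma=f_i^+\sigma$ for some $i$. Let $C_*(G)$ be the free abelian groups on the singular cubes modulo the subgroups generated by the degenerate ones, with $\partial\sigma=\sum_{i=1}^n(-1)^i(f_i^-\sigma-f_i^+\sigma)$, and let $H_n(G)=H_n(C_*(G))$. The degree of $\sigma$ is the largest dimension of a face (of any dimension) of $I^n$ on which $\sigma$ is injective; $C^k_*(G)\subseteq C_*(G)$ is the subcomplex generated by the cubes of degree at most $k$ (with $C^{-1}_*(G)=0$), $C^{[k]}_*(G)=C^k_*(G)/C^{k-1}_*(G)$ and $H^{[k]}_n(G)=H_n(C^{[k]}_*(G))$. The cubical dimension of $G$ is the largest $d$ such that $G$ has an injective singular $d$-cube. $CW^\Box(G)$ is the CW complex whose $n$-cells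 are solid $n$-cubes corresponding to the subgraphs of $G$ isomorphic to $I^n$, glued along their faces. An $n$-cube in $G$ is a subgraph isomorphic to $I^n$. The graph $G$ is $n$-monophobic if every $n$-cube $Q$ in $G$ is an induced subgraph and every singular $(n+1)$-cube of $G$ that has an $n$-dimensional face with image $Q$ has at least one further $n$-dimensional face with image $Q$ (the $2(n+1)$ faces being counted separately even when they coincide as maps). It is $n$-quasimonophobic if the same holds with the second condition required only of noninjective singular $(n+1)$-cubes. For $n\ge 3$ let $G^{\mathrm{sph}}_n$ be the graph obtained from a $2n$-cycle with vertices $0,\dots,2n-1$ by adjoining two vertices $u$ and $v$, where $u$ is adjacent to all odd vertices and $v$ to all even vertices. Then for every $n\ge 4$: 1. $CW^\Box(G^{\mathrm{sph}}_n)$ is homeomorphic to $S^2$. 2. $G^{\mathrm{sph}}_n$ is triangle-free, has cubical dimension $2$, is $2$-monophobic, and is $m$-quasimonophobic for every $m\ge 0$. 3. $H_2(G^{\mathrm{sph}}_n)\cong\mathbb{Z}$. 4. $H^{[3]}_3(G^{\mathrm{sph}}_n)=0$ and $H^{[3]}_4(G^{\mathrm{sph}}_n)=0$. 5. $H_3(G^{\mathrm{sph}}_n)\cong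 H^{[2]}_3(G^{\mathrm{sph}}_n)$ canonically: the map $H_3(C^2_*(G^{\mathrm{sph}}_n))\to H_3(G^{\mathrm{sph}}_n)$ induced by inclusion is an isomorphism, and there is an isomorphism $H_3(G^{\mathrm{sph}}_n)\to H_3^{[2]}(G^{\mathrm{sph}}_n)$ whose composite with it is induced by the projection $C^2_*(G^{\mathrm{sph}}_n)\to C^{[2]}_*(G^{\mathrm{sph}}_n)$. Moreover $G^{\mathrm{sph}}_3\cong I^3$, and this graph is contractible: there is a finite sequence of graph maps $h_0,\dots,h_m$ from $G^{\mathrm{sph}}_3$ to itself, starting with the identity and ending with a constant map, such that $h_k(x)$ and $h_{k+1}(x)$ are equal or adjacent for all $x$ and all $k<m$. -/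

import Mathlib

open CategoryTheory

universe u v

namespace DiscreteCubical

/-! ### Graph maps -/

/-- A graph map sends every edge to an edge or to a vertex. -/
@[ext]
structure GraphMap {V : Type u} {W : Type v} (G : SimpleGraph V) (H : SimpleGraph W) where
  toFun : V → W
  map_adj' : ∀ ⦃x y : V⦄, G.Adj x y → toFun x = toFun y ∨ H.Adj (toFun x) (toFun y)

namespace GraphMap

variable {V : Type u} {W : Type v} {G : SimpleGraph V} {H : SimpleGraph W}

instance : FunLike (GraphMap G H) V W where
  coe := toFun
  coe_injective _ _ h := GraphMap.ext h

theorem map_adj (f : GraphMap G H) {x y : V} (h : G.Adj x y) : f x = f y ∨ H.Adj (f x) (f y) :=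
  f.map_adj' h

/-- The identity graph map. -/
def id (G : SimpleGraph V) : GraphMap G G where
  toFun x := x
  map_adj' _ _ h := Or.inr h

/-- The constant graph map. -/
def const (G : SimpleGraph V) (H : SimpleGraph W) (w : W) : GraphMap G H where
  toFun _ := w
  map_adj' _ _ _ := Or.inl rfl

/-- The image of a graph map: its vertices are the images of the vertices, its edges are the
edges of the target that are images of edges. -/
def image (f : GraphMap G H) : H.Subgraph where
  verts := Set.range f
  Adj a b := H.Adj a b ∧ ∃ x y, G.Adj x y ∧ f x = a ∧ f y = b
  adj_sub h := h.1
  edge_vert := by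
    rintro a b ⟨-, x, y, -, rfl, -⟩
    exact ⟨x, rfl⟩
  symm := ⟨by
    rintro a b ⟨h, x, y, hxy, hx, hy⟩
    exact ⟨h.symm, y, x, hxy.symm, hy, hx⟩⟩

end GraphMap

/-- A graph is (discretely) contractible if its identity map is homotopic to a constant map,
where a homotopy is a finite sequence of graph maps, consecutive ones being equal or adjacent at
every vertex (a graph map from the Cartesian product of `G` with a path). -/
def IsContractible {V : Type u} (G : SimpleGraph V) : Prop :=
  ∃ (v : V) (m : ℕ) (h : ℕ → GraphMap G G),
    h 0 = GraphMap.id G ∧ h m = GraphMap.const G G v ∧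
      ∀ k < m, ∀ x, h k x = h (k + 1) x ∨ G.Adj (h k x) (h (k + 1) x)

/-! ### Cubes -/

/-- The discrete `n`-cube: vertices `{0,1}ⁿ` (with `false = 0`, `true = 1`), two of them being
adjacent when they differ in exactly one coordinate. -/
def cubeGraph (n : ℕ) : SimpleGraph (Fin n → Bool) where
  Adj x y := ∃! i, x i ≠ y i
  symm := ⟨fun x y h => by simpa only [ne_comm] using h⟩
  loopless := ⟨fun x h => by
    obtain ⟨i, hi, -⟩ := h
    exact hi rfl⟩

theorem cubeGraph_adj {n : ℕ} {x y : Fin n → Bool} :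
    (cubeGraph n).Adj x y ↔ ∃! i, x i ≠ y i := Iff.rfl

/-- Singular `n`-cubes of `G`. -/
abbrev SingCube {V : Type u} (G : SimpleGraph V) (n : ℕ) : Type u := GraphMap (cubeGraph n) G

namespace SingCube

variable {V : Type u} {G : SimpleGraph V} {n : ℕ}

/-- The front (`ε = false`) and back (`ε = true`) `i`-face of a singular cube. -/
def face (σ : SingCube G (n + 1)) (i : Fin (n + 1)) (ε : Bool) : SingCube G n where
  toFun x := σ (i.insertNth ε x)
  map_adj' x y h := by
    apply σ.map_adj
    obtain ⟨j, hj, hu⟩ := h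
    refine ⟨i.succAbove j, by simpa using hj, ?_⟩
    intro k hk
    induction k using i.succAboveCases with
    | x => simp at hk
    | p k => rw [hu k (by simpa using hk)]

theorem face_apply (σ : SingCube G (n + 1)) (i : Fin (n + 1)) (ε : Bool) (x : Fin n → Bool) :
    σ.face i ε x = σ (i.insertNth ε x) := rfl

/-- Precomposition of a singular cube with a permutation of the coordinates. -/
def perm (σ : SingCube G n) (π : Equiv.Perm (Fin n)) : SingCube G n where
  toFun x := σ (x ∘ π)
  map_adj' x y h := by
    apply σ.map_adj
    obtain ⟨j, hj, hu⟩ := h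
    refine ⟨π.symm j, by simpa using hj, ?_⟩
    intro k hk
    rw [← hu (π k) hk, Equiv.symm_apply_apply]

/-- Precomposition of a singular cube with the reflection of the `i`-th coordinate. -/
def flip (σ : SingCube G n) (i : Fin n) : SingCube G n where
  toFun x := σ (Function.update x i (!x i))
  map_adj' x y h := by
    apply σ.map_adj
    have e : ∀ k, Function.update x i (!x i) k ≠ Function.update y i (!y i) k ↔ x k ≠ y k := by
      intro k
      by_cases hk : k = i
      · subst hk
        simp
      · simp [hk]
    simpa only [cubeGraph_adj, e] using h

/-- A singular cube is degenerate if its front and back `i`-faces agree for some `i`. -/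
def IsDegenerate (σ : SingCube G n) : Prop :=
  ∃ i : Fin n, ∀ x, σ (Function.update x i false) = σ (Function.update x i true)

/-- The face of the discrete cube through the vertex `b` in the directions `S`; its dimension is
the cardinality of `S`. -/
def subface (S : Finset (Fin n)) (b : Fin n → Bool) : Set (Fin n → Bool) :=
  {x | ∀ i, i ∉ S → x i = b i}

/-- The degree of a singular cube: the maximal dimension of a face (of any dimension) on which it
is injective. -/
noncomputable def degree (σ : SingCube G n) : ℕ :=
  sSup {k | ∃ (S : Finset (Fin n)) (b : Fin n → Bool), S.card = k ∧ Set.InjOn σ (subface S b)}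

theorem degree_le_iff (σ : SingCube G n) (k : ℕ) :
    σ.degree ≤ k ↔ ∀ S b, Set.InjOn σ (subface S b) → S.card ≤ k := by
  have hb : BddAbove {k | ∃ (S : Finset (Fin n)) (b : Fin n → Bool),
      S.card = k ∧ Set.InjOn σ (subface S b)} := by
    refine ⟨n, ?_⟩
    rintro _ ⟨S, b, rfl, -⟩
    simpa using S.card_le_univ
  constructor
  · intro h S b hS
    exact (le_csSup hb ⟨S, b, rfl, hS⟩).trans h
  · intro h
    refine csSup_le' ?_
    rintro _ ⟨S, b, rfl, hS⟩
    exact h S b hS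

theorem degree_face_le (σ : SingCube G (n + 1)) (i : Fin (n + 1)) (ε : Bool) :
    (σ.face i ε).degree ≤ σ.degree := by
  rw [degree_le_iff]
  intro S b hS
  have h := (degree_le_iff σ σ.degree).1 le_rfl (S.map i.succAboveEmb) (i.insertNth ε b)
  rw [Finset.card_map] at h
  apply h
  have key : ∀ x ∈ subface (S.map i.succAboveEmb) (i.insertNth ε b : Fin (n + 1) → Bool),
      i.removeNth x ∈ subface S b ∧ i.insertNth ε (i.removeNth x) = x := by
    intro x hx
    have hi : x i = ε := by
      have := hx i (by simp)
      simpa using this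
    refine ⟨fun j hj => ?_, ?_⟩
    · have := hx (i.succAbove j) (by simpa using hj)
      simpa [Fin.removeNth] using this
    · rw [← hi]
      exact Fin.insertNth_self_removeNth i x
  intro x hx y hy hxy
  obtain ⟨hx1, hx2⟩ := key x hx
  obtain ⟨hy1, hy2⟩ := key y hy
  have := hS hx1 hy1 (by rw [face_apply, face_apply, hx2, hy2, hxy])
  rw [← hx2, ← hy2, this]

theorem face_face (σ : SingCube G (n + 2)) (j : Fin (n + 2)) (i : Fin (n + 1)) (δ ε : Bool) :
    (σ.face j δ).face i ε = (σ.face (j.succAbove i) ε).face (i.predAbove j) δ := by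
  refine DFunLike.ext _ _ fun x => ?_
  simp only [face_apply]
  congr 1
  funext k
  induction k using j.succAboveCases with
  | x =>
    rw [Fin.insertNth_apply_same]
    conv_rhs => arg 4; rw [← Fin.succAbove_succAbove_predAbove j i]
    rw [Fin.insertNth_apply_succAbove, Fin.insertNth_apply_same]
  | p k =>
    rw [Fin.insertNth_apply_succAbove]
    induction k using i.succAboveCases with
    | x => rw [Fin.insertNth_apply_same, Fin.insertNth_apply_same]
    | p k =>
      rw [Fin.insertNth_apply_succAbove]
      conv_rhs => arg 4; rw [← Fin.succAbove_succAbove_succAbove_predAbove]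
      rw [Fin.insertNth_apply_succAbove, Fin.insertNth_apply_succAbove]

end SingCube

/-! ### Chains -/

section Chains

variable {V : Type u} (G : SimpleGraph V)

/-- The free abelian group on the singular `n`-cubes. -/
abbrev CubeChains (n : ℕ) : Type u := SingCube G n →₀ ℤ

/-- The boundary `∂σ = ∑ᵢ (-1)ⁱ (fᵢ⁻σ - fᵢ⁺σ)`, with `i` running through `1, …, n + 1`. -/
noncomputable def cubeBoundary (n : ℕ) : CubeChains G (n + 1) →ₗ[ℤ] CubeChains G n :=
  Finsupp.linearCombination ℤ fun σ : SingCube G (n + 1) =>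
    ∑ i : Fin (n + 1), (-1 : ℤ) ^ (i.val + 1) •
      (Finsupp.single (σ.face i false) (1 : ℤ) - Finsupp.single (σ.face i true) (1 : ℤ))

/-- The subgroup generated by the degenerate cubes. -/
noncomputable def degenerateChains (n : ℕ) : Submodule ℤ (CubeChains G n) :=
  Submodule.span ℤ ((fun σ => Finsupp.single σ (1 : ℤ)) '' {σ : SingCube G n | σ.IsDegenerate})

/-- Normalized singular cubical chains. -/
abbrev NormChains (n : ℕ) : Type u := CubeChains G n ⧸ degenerateChains G n

/-- The class of a singular cube in the normalized chains. -/
noncomputable def cubeClass {n : ℕ} (σ : SingCube G n) : NormChains G n :=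
  (degenerateChains G n).mkQ (Finsupp.single σ 1)

variable {G} in
theorem cubeBoundary_single {n : ℕ} (σ : SingCube G (n + 1)) :
    cubeBoundary G n (Finsupp.single σ 1) = ∑ i : Fin (n + 1), (-1 : ℤ) ^ (i.val + 1) •
      (Finsupp.single (σ.face i false) (1 : ℤ) - Finsupp.single (σ.face i true) (1 : ℤ)) := by
  simp [cubeBoundary]

variable {G} in
theorem cubeBoundary_single' {n : ℕ} (σ : SingCube G (n + 1)) :
    cubeBoundary G n (Finsupp.single σ 1) = ∑ p : Fin (n + 1) × Bool,
      ((-1 : ℤ) ^ p.1.val * (if p.2 then 1 else -1)) • Finsupp.single (σ.face p.1 p.2) (1 : ℤ) := by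
  rw [cubeBoundary_single, Fintype.sum_prod_type]
  refine Finset.sum_congr rfl fun i _ => ?_
  rw [Fintype.sum_bool]
  simp only [if_true, Bool.false_eq_true, if_false, pow_succ, mul_one, mul_neg, neg_smul]
  rw [smul_sub]
  abel

theorem cubeBoundary_comp (n : ℕ) : cubeBoundary G n ∘ₗ cubeBoundary G (n + 1) = 0 := by
  refine Finsupp.lhom_ext' fun σ => LinearMap.ext_ring ?_
  simp only [LinearMap.comp_apply, Finsupp.lsingle_apply, LinearMap.zero_apply]
  rw [cubeBoundary_single', map_sum]
  simp only [map_smul, cubeBoundary_single', Finset.smul_sum, smul_smul]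
  rw [← Fintype.sum_prod_type']
  refine Finset.sum_involution
    (fun q _ => ((q.1.1.succAbove q.2.1, q.2.2), (q.2.1.predAbove q.1.1, q.1.2))) ?_ ?_ ?_ ?_
  · rintro ⟨⟨j, δ⟩, ⟨i, ε⟩⟩ -
    simp only
    rw [SingCube.face_face σ j i δ ε, ← add_smul]
    have h := Fin.neg_one_pow_succAbove_add_predAbove (R := ℤ) j i
    rw [pow_add, pow_add] at h
    convert zero_smul ℤ _
    linear_combination ((if δ then 1 else -1) * (if ε then 1 else -1) : ℤ) * h
  · rintro ⟨⟨j, δ⟩, ⟨i, ε⟩⟩ - - h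
    simp only [Prod.mk.injEq] at h
    exact Fin.succAbove_ne j i h.1.1
  · intros
    exact Finset.mem_univ _
  · rintro ⟨⟨j, δ⟩, ⟨i, ε⟩⟩ -
    simp only [Fin.succAbove_succAbove_predAbove, Fin.predAbove_predAbove_succAbove]

theorem cubeBoundary_degenerate (n : ℕ) :
    degenerateChains G (n + 1) ≤ (degenerateChains G n).comap (cubeBoundary G n) := by
  refine Submodule.span_le.2 ?_
  rintro _ ⟨σ, ⟨i, hi⟩, rfl⟩
  simp only [SetLike.mem_coe, Submodule.mem_comap]
  rw [cubeBoundary_single]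
  refine Submodule.sum_mem _ fun j _ => Submodule.smul_mem _ _ ?_
  by_cases hj : j = i
  · subst hj
    have : σ.face j false = σ.face j true := by
      refine DFunLike.ext _ _ fun x => ?_
      simpa [SingCube.face_apply] using hi (j.insertNth false x)
    rw [this, sub_self]
    exact Submodule.zero_mem _
  · obtain ⟨k, rfl⟩ := Fin.exists_succAbove_eq (Ne.symm hj)
    have key : ∀ ε, (σ.face j ε).IsDegenerate := fun ε => by
      refine ⟨k, fun x => ?_⟩
      simpa [SingCube.face_apply, Fin.insertNth_update] using hi (j.insertNth ε x)
    exact Submodule.sub_mem _ (Submodule.subset_span ⟨_, key _, rfl⟩)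
      (Submodule.subset_span ⟨_, key _, rfl⟩)

/-- The boundary on normalized chains. -/
noncomputable def normBoundary (n : ℕ) : NormChains G (n + 1) →ₗ[ℤ] NormChains G n :=
  Submodule.mapQ _ _ (cubeBoundary G n) (cubeBoundary_degenerate G n)

variable {G} in
theorem normBoundary_cubeClass {n : ℕ} (σ : SingCube G (n + 1)) :
    normBoundary G n (cubeClass G σ) = ∑ i : Fin (n + 1), (-1 : ℤ) ^ (i.val + 1) •
      (cubeClass G (σ.face i false) - cubeClass G (σ.face i true)) := by
  simp only [normBoundary, cubeClass, Submodule.mkQ_apply, Submodule.mapQ_apply,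
    cubeBoundary_single]
  simp only [← Submodule.mkQ_apply, map_sum, map_smul, map_sub]

theorem normBoundary_comp (n : ℕ) : normBoundary G n ∘ₗ normBoundary G (n + 1) = 0 := by
  refine Submodule.linearMap_qext _ ?_
  ext1 σ
  refine LinearMap.ext_ring ?_
  have h := LinearMap.congr_fun (cubeBoundary_comp G n) (Finsupp.single σ 1)
  simp only [LinearMap.comp_apply, LinearMap.zero_apply] at h
  simp [normBoundary, h]

/-- The discrete cubical chain complex. -/
noncomputable def cubicalComplex : ChainComplex (ModuleCat.{u} ℤ) ℕ :=
  ChainComplex.of (fun n => ModuleCat.of ℤ (NormChains G n))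
    (fun n => ModuleCat.ofHom (normBoundary G n))
    (fun n => by
      rw [← ModuleCat.ofHom_comp, normBoundary_comp]
      rfl)

theorem cubicalComplex_d (n : ℕ) :
    (cubicalComplex G).d (n + 1) n = ModuleCat.ofHom (normBoundary G n) :=
  ChainComplex.of_d (fun n => ModuleCat.of ℤ (NormChains G n))
    (fun n => ModuleCat.ofHom (normBoundary G n)) n

/-- The discrete cubical homology `Hₙ(G)`. -/
noncomputable abbrev cubicalHomology (n : ℕ) : ModuleCat.{u} ℤ := (cubicalComplex G).homology n

/-! ### The degree filtration -/

/-- The subgroup of the normalized `n`-chains generated by the singular cubes of degree less than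
`j`. In the usual notation this is `Cₙ^{j-1}(G)`, so that `Cₙ^k(G)` is `degreeLT G (k + 1) n` and
`C^{-1} = 0`. -/
noncomputable def degreeLT (j n : ℕ) : Submodule ℤ (NormChains G n) :=
  Submodule.span ℤ (cubeClass G '' {σ : SingCube G n | σ.degree < j})

theorem degreeLT_mono {j k : ℕ} (h : j ≤ k) (n : ℕ) : degreeLT G j n ≤ degreeLT G k n :=
  Submodule.span_mono (Set.image_mono fun _ hσ => lt_of_lt_of_le hσ h)

theorem normBoundary_degreeLT (j n : ℕ) :
    ∀ x ∈ degreeLT G j (n + 1), normBoundary G n x ∈ degreeLT G j n := by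
  change degreeLT G j (n + 1) ≤ (degreeLT G j n).comap (normBoundary G n)
  refine Submodule.span_le.2 ?_
  rintro _ ⟨σ, hσ, rfl⟩
  simp only [SetLike.mem_coe, Submodule.mem_comap]
  rw [normBoundary_cubeClass]
  have key : ∀ i ε, cubeClass G (σ.face i ε) ∈ degreeLT G j n := fun i ε =>
    Submodule.subset_span ⟨_, lt_of_le_of_lt (σ.degree_face_le i ε) hσ, rfl⟩
  exact Submodule.sum_mem _ fun i _ =>
    Submodule.smul_mem _ _ (Submodule.sub_mem _ (key i _) (key i _))

/-- The boundary on a step of the degree filtration. -/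
noncomputable def filtBoundary (j n : ℕ) : degreeLT G j (n + 1) →ₗ[ℤ] degreeLT G j n :=
  (normBoundary G n).restrict (normBoundary_degreeLT G j n)

theorem filtBoundary_comp (j n : ℕ) : filtBoundary G j n ∘ₗ filtBoundary G j (n + 1) = 0 := by
  refine LinearMap.ext fun x => Subtype.ext ?_
  exact LinearMap.congr_fun (normBoundary_comp G n) x.1

/-- The subcomplex `C^k_*(G)` of chains of degree at most `k`. -/
noncomputable def filtComplex (k : ℕ) : ChainComplex (ModuleCat.{u} ℤ) ℕ :=
  ChainComplex.of (fun n => ModuleCat.of ℤ (degreeLT G (k + 1) n))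
    (fun n => ModuleCat.ofHom (filtBoundary G (k + 1) n))
    (fun n => by
      rw [← ModuleCat.ofHom_comp, filtBoundary_comp]
      rfl)

theorem filtComplex_d (k n : ℕ) :
    (filtComplex G k).d (n + 1) n = ModuleCat.ofHom (filtBoundary G (k + 1) n) :=
  ChainComplex.of_d (fun n => ModuleCat.of ℤ (degreeLT G (k + 1) n))
    (fun n => ModuleCat.ofHom (filtBoundary G (k + 1) n)) n

/-- The inclusion of `C^k_*(G)` into `C_*(G)`. -/
noncomputable def filtInclusion (k : ℕ) : filtComplex G k ⟶ cubicalComplex G :=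
  ChainComplex.ofHom (fun n => ModuleCat.ofHom (degreeLT G (k + 1) n).subtype)
    (fun n => by
      rw [cubicalComplex_d, filtComplex_d]
      rfl)

/-- The associated graded groups `C^{[k]}_n(G) = C^k_n(G) / C^{k-1}_n(G)`. -/
abbrev GradedChains (k n : ℕ) : Type u :=
  degreeLT G (k + 1) n ⧸ (degreeLT G k n).submoduleOf (degreeLT G (k + 1) n)

/-- The boundary on the associated graded groups. -/
noncomputable def gradedBoundary (k n : ℕ) : GradedChains G k (n + 1) →ₗ[ℤ] GradedChains G k n :=
  Submodule.mapQ _ _ (filtBoundary G (k + 1) n)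
    (fun x hx => normBoundary_degreeLT G k n x.1 hx)

theorem gradedBoundary_comp (k n : ℕ) :
    gradedBoundary G k n ∘ₗ gradedBoundary G k (n + 1) = 0 := by
  refine Submodule.linearMap_qext _ (LinearMap.ext fun x => ?_)
  have h := LinearMap.congr_fun (filtBoundary_comp G (k + 1) n) x
  exact congrArg (Submodule.mkQ _) h

/-- The complex `C^{[k]}_*(G)`. -/
noncomputable def gradedComplex (k : ℕ) : ChainComplex (ModuleCat.{u} ℤ) ℕ :=
  ChainComplex.of (fun n => ModuleCat.of ℤ (GradedChains G k n))
    (fun n => ModuleCat.ofHom (gradedBoundary G k n))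
    (fun n => by
      rw [← ModuleCat.ofHom_comp, gradedBoundary_comp]
      rfl)

theorem gradedComplex_d (k n : ℕ) :
    (gradedComplex G k).d (n + 1) n = ModuleCat.ofHom (gradedBoundary G k n) :=
  ChainComplex.of_d (fun n => ModuleCat.of ℤ (GradedChains G k n))
    (fun n => ModuleCat.ofHom (gradedBoundary G k n)) n

/-- The projection of `C^k_*(G)` onto `C^{[k]}_*(G)`. -/
noncomputable def gradedProjection (k : ℕ) : filtComplex G k ⟶ gradedComplex G k :=
  ChainComplex.ofHom
    (fun n => ModuleCat.ofHom ((degreeLT G k n).submoduleOf (degreeLT G (k + 1) n)).mkQ)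
    (fun n => by
      rw [gradedComplex_d, filtComplex_d]
      rfl)

/-- The homology `H^{[k]}_n(G)` of the associated graded complex. -/
noncomputable abbrev gradedHomology (k n : ℕ) : ModuleCat.{u} ℤ := (gradedComplex G k).homology n

end Chains

/-! ### Cubical dimension and quasimonophobicity -/

section Monophobic

variable {V : Type u} (G : SimpleGraph V)

/-- `d` is the maximal dimension of an injective singular cube of `G`. -/
def HasCubicalDimension (d : ℕ) : Prop :=
  IsGreatest {n | ∃ σ : SingCube G n, Function.Injective σ} d

variable {G}

/-- A subgraph is an `n`-cube if it is isomorphic to the discrete `n`-cube. -/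
def IsCube (n : ℕ) (Q : G.Subgraph) : Prop := Nonempty (Q.coe ≃g cubeGraph n)

/-- The `(i, ε)`-face of `σ` is supported by `Q`. -/
def FaceSupported {n : ℕ} (σ : SingCube G (n + 1)) (p : Fin (n + 1) × Bool) (Q : G.Subgraph) :
    Prop :=
  (σ.face p.1 p.2).image = Q

variable (G)

/-- Every `n`-cube `Q` in `G` is rigid (an induced subgraph), and every singular `(n+1)`-cube with
a face supported by `Q` has at least one further face supported by `Q`. -/
def IsMonophobic (n : ℕ) : Prop :=
  ∀ Q : G.Subgraph, IsCube n Q → Q.IsInduced ∧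
    ∀ (σ : SingCube G (n + 1)) (p : Fin (n + 1) × Bool), FaceSupported σ p Q →
      ∃ q, q ≠ p ∧ FaceSupported σ q Q

/-- As `IsMonophobic`, but only noninjective singular `(n+1)`-cubes are tested. -/
def IsQuasimonophobic (n : ℕ) : Prop :=
  ∀ Q : G.Subgraph, IsCube n Q → Q.IsInduced ∧
    ∀ (σ : SingCube G (n + 1)), ¬ Function.Injective σ →
      ∀ p : Fin (n + 1) × Bool, FaceSupported σ p Q → ∃ q, q ≠ p ∧ FaceSupported σ q Q

end Monophobic

/-! ### The cubical CW complex of a graph -/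

section CW

variable {V : Type u} (G : SimpleGraph V)

/-- Injective singular `n`-cubes, that is, parametrized `n`-cubes in `G`. -/
def InjCube (n : ℕ) : Type u := {σ : SingCube G n // Function.Injective σ}

namespace InjCube

variable {G} {n : ℕ}

/-- The faces of an injective cube. -/
def face (σ : InjCube G (n + 1)) (i : Fin (n + 1)) (ε : Bool) : InjCube G n :=
  ⟨σ.1.face i ε, fun _ _ h => Fin.insertNth_right_injective (α := fun _ => Bool) ε (σ.2 h)⟩

/-- Reparametrization of an injective cube by a permutation of the coordinates. -/
def perm (σ : InjCube G n) (π : Equiv.Perm (Fin n)) : InjCube G n :=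
  ⟨σ.1.perm π, fun _ _ h => π.surjective.injective_comp_right (σ.2 h)⟩

/-- Reparametrization of an injective cube by a reflection. -/
def flip (σ : InjCube G n) (i : Fin n) : InjCube G n :=
  ⟨σ.1.flip i, fun x y h => by
    have h' := σ.2 h
    funext k
    have hk := congrFun h' k
    by_cases e : k = i
    · subst e
      simpa using hk
    · simpa [e] using hk⟩

end InjCube

/-- The disjoint union of the solid cubes `[0,1]ⁿ`, one for every injective singular `n`-cube,
over all `n`. -/
abbrev CubePoints : Type u := Σ n : ℕ, Σ _ : InjCube G n, (Fin n → unitInterval)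

/-- The endpoint of the unit interval given by a bit. -/
def endpoint (ε : Bool) : unitInterval := if ε then 1 else 0

variable {G} in
/-- The gluing: the solid cube of a face is glued to the corresponding face of the solid cube, and
the solid cubes of two parametrizations of the same cube of `G`, which differ by a composition of
permutations and reflections of the coordinates, are identified accordingly. -/
inductive Glue : CubePoints G → CubePoints G → Prop
  | face {n : ℕ} (σ : InjCube G (n + 1)) (i : Fin (n + 1)) (ε : Bool)
      (t : Fin n → unitInterval) :
      Glue ⟨n, σ.face i ε, t⟩ ⟨n + 1, σ, i.insertNth (endpoint ε) t⟩
  | perm {n : ℕ} (σ : InjCube G n) (π : Equiv.Perm (Fin n)) (t : Fin n → unitInterval) :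
      Glue ⟨n, σ.perm π, t⟩ ⟨n, σ, t ∘ π⟩
  | flip {n : ℕ} (σ : InjCube G n) (i : Fin n) (t : Fin n → unitInterval) :
      Glue ⟨n, σ.flip i, t⟩ ⟨n, σ, Function.update t i (unitInterval.symm (t i))⟩

/-- The CW complex `CW^□(G)` whose `n`-cells correspond to the subgraphs of `G` isomorphic to the
discrete `n`-cube, with the quotient topology. -/
def CWBox : Type u := Quot (Glue (G := G))

instance : TopologicalSpace (CWBox G) := inferInstanceAs (TopologicalSpace (Quot _))

end CW

/-! ### Greene spheres -/

/-- The Greene sphere graph: the cycle with vertices `0, …, 2n - 1` (the vertices `Sum.inl i`),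
together with a vertex `u = Sum.inr true` adjacent to all odd vertices and a vertex
`v = Sum.inr false` adjacent to all even vertices. -/
def greeneSphere (n : ℕ) : SimpleGraph (Fin (2 * n) ⊕ Bool) where
  Adj
    | Sum.inl a, Sum.inl b => (SimpleGraph.cycleGraph (2 * n)).Adj a b
    | Sum.inl a, Sum.inr w => if w then Odd a.val else Even a.val
    | Sum.inr w, Sum.inl a => if w then Odd a.val else Even a.val
    | Sum.inr _, Sum.inr _ => False
  symm := ⟨by
    rintro (a | w) (b | w') h
    · exact SimpleGraph.Adj.symm h
    · exact h
    · exact h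
    · exact h⟩
  loopless := ⟨by
    rintro (a | w) h
    · exact (SimpleGraph.cycleGraph (2 * n)).loopless.irrefl a h
    · exact h⟩

end DiscreteCubical

open DiscreteCubical

/-! For `n ≥ 4` the graph is bipartite, two distinct vertices have at most two common neighbours,
and there is no injective 3-cube. Such a cube would have a corner at a cycle vertex `i`, with
neighbours `i + 1`, `i - 1` and a hub; the next vertices are forced to be the other hub and `i ± 2`,
and a vertex adjacent to all three exists only if `2`, `4` or `6` vanishes modulo `2n`
(`greene_no_corner_aux`). For `n = 3` the last case does occur, and the graph is the cube. Hence all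
singular cubes have degree at most two (`greene_degree_le`), so that `C^2 = C` and `C^{[3]} = 0`.

The comparison of `H_3` with `H_3^{[2]}` is the long exact sequence of `C^1 ⊆ C^2`, and it needs
that `C^1` has no homology in dimensions two and three. This holds for every bipartite graph in all
dimensions at least two (`exists_boundary_of_degree_le_one`). A cube of degree at most one lifts to
a forest covering the graph (`exists_lift`), where its image is a finite tree. Pushing the leaves of
that tree to their neighbours makes it smaller, and the prism over this folding is a chain homotopy
up to cubes of smaller image (`leafHomotopy_spec`). It does not depend on the lift, so it descends
to the graph, and induction on the size of the image concludes.

For `H_2`, the signed count of the occurrences of a given square in a chain is a cocycle. This is a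
finite check on the positions of the vertices of a 3-cube relative to the square, and the same check
gives 2-monophobicity (`squareSign_faces`). Up to boundaries and chains of degree at most one, a
2-chain is a combination of the `2n` standard squares, one around each cycle vertex. Each edge of
the cycle lies in just two of them, so the coefficients of a 2-cycle are determined by one of them
(`stdCoeff_succ`). If that one is zero, the cycle is homologous to one of degree at most one and
hence bounds. `fundamentalCycle` has coefficient one.

For the sphere, each standard square is folded along the diagonal from its hub to its middle vertex.
The `4n` triangles form the surface of a bipyramid over a regular `2n`-gon, and radial projection is
a continuous bijection from a compact space onto the sphere. -/

namespace DiscreteCubical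

/-! ### Generalities on graph maps and cubes -/

section General

variable {V : Type u} {W : Type v} {G : SimpleGraph V} {H : SimpleGraph W} {n : ℕ}

/-- Composition of graph maps. -/
def GraphMap.comp {X : Type*} {K : SimpleGraph X} (f : GraphMap H K) (g : GraphMap G H) :
    GraphMap G K where
  toFun x := f (g x)
  map_adj' x y h := by
    rcases g.map_adj h with h | h
    · exact Or.inl (congrArg f h)
    · exact f.map_adj h

theorem GraphMap.comp_apply {X : Type*} {K : SimpleGraph X} (f : GraphMap H K)
    (g : GraphMap G H) (x : V) : f.comp g x = f (g x) := rfl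

theorem cubeGraph_adj_update (x : Fin n → Bool) (i : Fin n) (ε δ : Bool) (h : ε ≠ δ) :
    (cubeGraph n).Adj (Function.update x i ε) (Function.update x i δ) := by
  refine ⟨i, by simpa using h, fun j hj => ?_⟩
  by_contra hji
  simp [hji] at hj

theorem exists_update_of_cubeGraph_adj {x y : Fin n → Bool} (h : (cubeGraph n).Adj x y) :
    ∃ i, y = Function.update x i (!x i) := by
  obtain ⟨i, hi, hu⟩ := h
  refine ⟨i, funext fun j => ?_⟩
  by_cases hj : j = i
  · subst hj
    rw [Function.update_self]
    cases hx : x j <;> cases hy : y j <;> simp_all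
  · rw [Function.update_of_ne hj]
    by_contra hne
    exact hj (hu j (Ne.symm hne))

/-- Switching the coordinates of `x` one at a time to those of `y` gives a path; `s` below is the
set of coordinates already switched. -/
theorem cubeGraph_induction (P : (Fin n → Bool) → Prop)
    (h : ∀ x y, (cubeGraph n).Adj x y → P x → P y) (x y : Fin n → Bool) (hx : P x) : P y := by
  have key : ∀ s : Finset (Fin n), P fun i => if i ∈ s then y i else x i := by
    intro s
    induction s using Finset.induction_on with
    | empty => simpa using hx
    | insert a s ha ih =>
      have e : (fun i => if i ∈ insert a s then y i else x i) =
          Function.update (fun i => if i ∈ s then y i else x i) a (y a) := by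
        funext j
        by_cases hj : j = a
        · subst hj
          simp
        · simp [hj]
      rw [e]
      by_cases hxy : x a = y a
      · convert ih using 1
        refine Function.update_eq_self_iff.2 ?_
        simp [ha, hxy]
      · refine h _ _ ?_ ih
        conv => arg 2; rw [← Function.update_eq_self a (fun i => if i ∈ s then y i else x i)]
        exact cubeGraph_adj_update _ _ _ _ (by simpa [ha] using hxy)
  simpa using key Finset.univ

theorem SingCube.injOn_subface_pair (σ : SingCube G n) {i j : Fin n} (hij : i ≠ j)
    (b : Fin n → Bool) :
    Set.InjOn σ (SingCube.subface {i, j} b) ↔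
      ∀ ε δ ε' δ', σ (Function.update (Function.update b i ε) j δ) =
        σ (Function.update (Function.update b i ε') j δ') → ε = ε' ∧ δ = δ' := by
  constructor
  · intro h ε δ ε' δ' e
    have mem : ∀ ε δ, Function.update (Function.update b i ε) j δ ∈
        SingCube.subface {i, j} b := by
      intro ε δ k hk
      simp only [Finset.mem_insert, Finset.mem_singleton, not_or] at hk
      rw [Function.update_of_ne hk.2, Function.update_of_ne hk.1]
    have e' := h (mem _ _) (mem _ _) e
    have h1 := congrFun e' i
    have h2 := congrFun e' j
    simp [hij] at h1 h2
    exact ⟨h1, h2⟩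
  · intro h x hx y hy e
    have key : ∀ z ∈ SingCube.subface {i, j} b,
        z = Function.update (Function.update b i (z i)) j (z j) := by
      intro z hz
      funext k
      by_cases hj : k = j
      · subst hj; simp
      · by_cases hi : k = i
        · subst hi; simp [hij]
        · rw [Function.update_of_ne hj, Function.update_of_ne hi]
          exact hz k (by simp [hi, hj])
    have e2 := e
    rw [key x hx, key y hy] at e2
    obtain ⟨h1, h2⟩ := h _ _ _ _ e2
    rw [key x hx, key y hy, h1, h2]

/-- The singular cube given by two singular cubes that agree or are adjacent at every vertex. -/
def homotopyCube (σ τ : SingCube G n) (h : ∀ x, σ x = τ x ∨ G.Adj (σ x) (τ x)) :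
    SingCube G (n + 1) where
  toFun x := if x 0 then τ (Fin.tail x) else σ (Fin.tail x)
  map_adj' x y hxy := by
    obtain ⟨i, rfl⟩ := exists_update_of_cubeGraph_adj hxy
    induction i using Fin.cases with
    | zero =>
      simp only [Function.update_self, Fin.tail_update_zero]
      cases hx : x 0
      · simpa using h _
      · simpa [eq_comm, G.adj_comm] using h _
    | succ i =>
      simp only [Fin.tail_update_succ, Function.update_of_ne (Fin.succ_ne_zero i).symm]
      have : (cubeGraph n).Adj (Fin.tail x) (Function.update (Fin.tail x) i (!x i.succ)) := by
        conv => arg 2; rw [← Function.update_eq_self i (Fin.tail x)]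
        exact cubeGraph_adj_update _ _ _ _ (by simp [Fin.tail])
      split
      · exact τ.map_adj this
      · exact σ.map_adj this

theorem homotopyCube_apply (σ τ : SingCube G n) (h) (x) :
    homotopyCube σ τ h x = if x 0 then τ (Fin.tail x) else σ (Fin.tail x) := rfl

theorem homotopyCube_face_zero_false (σ τ : SingCube G n) (h) :
    (homotopyCube σ τ h).face 0 false = σ := by
  refine DFunLike.ext _ _ fun x => ?_
  simp [SingCube.face_apply, homotopyCube_apply]

theorem homotopyCube_face_zero_true (σ τ : SingCube G n) (h) :
    (homotopyCube σ τ h).face 0 true = τ := by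
  refine DFunLike.ext _ _ fun x => ?_
  simp [SingCube.face_apply, homotopyCube_apply]

theorem tail_insertNth_succ (i : Fin (n + 1)) (ε : Bool) (x : Fin (n + 1) → Bool) :
    Fin.tail (i.succ.insertNth ε x : Fin (n + 2) → Bool) = i.insertNth ε (Fin.tail x) := by
  funext k
  induction k using i.succAboveCases with
  | x => simp [Fin.tail]
  | p k =>
    rw [Fin.insertNth_apply_succAbove]
    simp only [Fin.tail]
    rw [← Fin.succ_succAbove_succ, Fin.insertNth_apply_succAbove]

theorem insertNth_succ_zero (i : Fin (n + 1)) (ε : Bool) (x : Fin (n + 1) → Bool) :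
    (i.succ.insertNth ε x : Fin (n + 2) → Bool) 0 = x 0 := by
  conv_lhs => rw [← Fin.succ_succAbove_zero i]
  rw [Fin.insertNth_apply_succAbove]

theorem homotopyCube_face_succ (σ τ : SingCube G (n + 1)) (h) (i : Fin (n + 1)) (ε : Bool) :
    (homotopyCube σ τ h).face i.succ ε =
      homotopyCube (σ.face i ε) (τ.face i ε) fun x => h (i.insertNth ε x) := by
  refine DFunLike.ext _ _ fun x => ?_
  simp only [SingCube.face_apply, homotopyCube_apply, insertNth_succ_zero, tail_insertNth_succ]
  rfl

theorem cubeClass_eq_zero {σ : SingCube G n} (h : σ.IsDegenerate) : cubeClass G σ = 0 :=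
  (Submodule.Quotient.mk_eq_zero _).2 (Submodule.subset_span ⟨σ, h, rfl⟩)

theorem isDegenerate_of_const {σ : SingCube G (n + 1)} (h : ∀ x y, σ x = σ y) :
    σ.IsDegenerate :=
  ⟨0, fun _ => h _ _⟩

/-- The prism formula. The faces in direction `0` are the two ends; the others are prisms over
faces, and shifting the direction by one turns the sign around. -/
theorem normBoundary_homotopyCube (σ τ : SingCube G (n + 1)) (h) :
    normBoundary G (n + 1) (cubeClass G (homotopyCube σ τ h)) =
      cubeClass G τ - cubeClass G σ - ∑ i : Fin (n + 1), (-1 : ℤ) ^ (i.val + 1) •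
        (cubeClass G (homotopyCube (σ.face i false) (τ.face i false)
            fun x => h (i.insertNth false x)) -
          cubeClass G (homotopyCube (σ.face i true) (τ.face i true)
            fun x => h (i.insertNth true x))) := by
  rw [normBoundary_cubeClass, Fin.sum_univ_succ, homotopyCube_face_zero_false,
    homotopyCube_face_zero_true]
  simp only [homotopyCube_face_succ, Fin.val_succ, Fin.val_zero]
  rw [sub_eq_add_neg _ (Finset.sum _ _), ← Finset.sum_neg_distrib]
  congr 1
  · simp
  · refine Finset.sum_congr rfl fun i _ => ?_
    rw [pow_succ _ (i.val + 1)]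
    simp

/-- The linear map on normalized chains given by a function on cubes that vanishes on the
degenerate ones. -/
noncomputable def chainLift {M : Type*} [AddCommGroup M] (f : SingCube G n → M)
    (hf : ∀ σ, σ.IsDegenerate → f σ = 0) : NormChains G n →ₗ[ℤ] M :=
  (degenerateChains G n).liftQ (Finsupp.linearCombination ℤ f) <|
    show Submodule.span ℤ _ ≤ _ from Submodule.span_le.2 <| by
      rintro _ ⟨σ, hσ, rfl⟩
      simp [hf σ hσ]

theorem chainLift_cubeClass {M : Type*} [AddCommGroup M] (f : SingCube G n → M) (hf)
    (σ : SingCube G n) : chainLift f hf (cubeClass G σ) = f σ := by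
  change Finsupp.linearCombination ℤ f (Finsupp.single σ 1) = f σ
  rw [Finsupp.linearCombination_single, one_smul]

theorem cubeClass_span (n : ℕ) : Submodule.span ℤ (Set.range (cubeClass G (n := n))) = ⊤ := by
  have : Set.range (cubeClass G (n := n)) =
      (degenerateChains G n).mkQ '' Set.range fun σ => Finsupp.single σ (1 : ℤ) := by
    rw [← Set.range_comp]
    rfl
  have h2 : Submodule.span ℤ (Set.range fun σ : SingCube G n => Finsupp.single σ (1 : ℤ)) = ⊤ :=
    (Finsupp.basisSingleOne (R := ℤ) (ι := SingCube G n)).span_eq ▸ rfl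
  rw [this, Submodule.span_image, h2, Submodule.map_top, Submodule.range_mkQ]

end General

/-! ### The tree cover of a bipartite graph -/

section Cover

variable {V : Type u} {G : SimpleGraph V} (C : G.Coloring Bool) {n : ℕ}

open Classical in
/-- The letter of the free group that records the passage from `a` to `b`. -/
noncomputable def edgeLetter (a b : V) : FreeGroup (V × V) :=
  if C a = C b then 1 else if C b then .of (a, b) else (.of (b, a))⁻¹

variable {C} in
theorem edgeLetter_of_eq {a b : V} (h : C a = C b) : edgeLetter C a b = 1 := if_pos h

theorem edgeLetter_inv (a b : V) : (edgeLetter C a b)⁻¹ = edgeLetter C b a := by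
  unfold edgeLetter
  cases ha : C a <;> cases hb : C b <;> simp

theorem edgeLetter_mul_symm (a b : V) : edgeLetter C a b * edgeLetter C b a = 1 := by
  rw [← edgeLetter_inv C a b, mul_inv_cancel]

/-- The universal cover of `G`, as the graph on pairs of a word and a vertex. -/
def coverGraph : SimpleGraph (FreeGroup (V × V) × V) where
  -- Words grow on the left, so right translations are deck transformations. A walk without
  -- backtracking multiplies the word by a reduced word, so the components are trees.
  Adj s t := G.Adj s.2 t.2 ∧ t.1 = edgeLetter C t.2 s.2 * s.1
  symm := ⟨fun s t h => ⟨h.1.symm, by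
    rw [h.2, ← mul_assoc, edgeLetter_mul_symm, one_mul]⟩⟩
  loopless := ⟨fun s h => G.loopless.irrefl _ h.1⟩

theorem coverGraph_adj {s t : FreeGroup (V × V) × V} :
    (coverGraph C).Adj s t ↔ G.Adj s.2 t.2 ∧ t.1 = edgeLetter C t.2 s.2 * s.1 := Iff.rfl

theorem eq_or_coverGraph_adj {s t : FreeGroup (V × V) × V} :
    (s = t ∨ (coverGraph C).Adj s t) ↔
      (s.2 = t.2 ∨ G.Adj s.2 t.2) ∧ t.1 = edgeLetter C t.2 s.2 * s.1 := by
  constructor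
  · rintro (rfl | h)
    · exact ⟨Or.inl rfl, by rw [edgeLetter_of_eq rfl, one_mul]⟩
    · exact ⟨Or.inr h.1, h.2⟩
  · rintro ⟨h | h, e⟩
    · rw [edgeLetter_of_eq (by rw [h]), one_mul] at e
      exact Or.inl (Prod.ext e.symm h)
    · exact Or.inr ⟨h, e⟩

/-- The colouring of the cover. -/
def coverColoring : (coverGraph C).Coloring Bool :=
  SimpleGraph.Coloring.mk (fun t => C t.2) fun h => C.valid h.1

/-- The covering map. -/
def coverMap : GraphMap (coverGraph C) G where
  toFun := Prod.snd
  map_adj' _ _ h := Or.inr h.1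

theorem coverMap_apply (t) : coverMap C t = t.2 := rfl

/-- A letter multiplied from the left lengthens a reduced word unless it cancels the first letter.
-/
theorem head?_toWord_of_norm_mul_le {α : Type*} [DecidableEq α] (p : α × Bool) (g : FreeGroup α)
    (h : (FreeGroup.mk [p] * g).norm ≤ g.norm) : g.toWord.head? = some (p.1, !p.2) := by
  have e : (FreeGroup.mk [p] * g).toWord = FreeGroup.reduce (p :: g.toWord) := by
    conv_lhs => rw [← FreeGroup.mk_toWord (x := g), FreeGroup.mul_mk, FreeGroup.toWord_mk]
    rfl
  unfold FreeGroup.norm at h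
  rw [e, FreeGroup.reduce.cons, FreeGroup.reduce_toWord] at h
  cases hg : g.toWord with
  | nil => simp [hg] at h
  | cons a l =>
    simp only [hg] at h
    by_cases hc : p.1 = a.1 ∧ p.2 = !a.2
    · simp only [List.head?_cons, Option.some.injEq]
      exact Prod.ext hc.1.symm (by rw [hc.2, Bool.not_not])
    · simp [hc] at h

theorem edgeLetter_eq_mk {a b : V} (h : C a ≠ C b) :
    edgeLetter C a b = FreeGroup.mk [if C b then ((a, b), true) else ((b, a), false)] := by
  unfold edgeLetter
  rw [if_neg h]
  split
  · rfl
  · rfl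

/-- A finite set of vertices of the cover has a vertex with at most one neighbour in it. -/
theorem exists_leaf_coverGraph (S : Set (FreeGroup (V × V) × V)) (hS : S.Finite)
    (hne : S.Nonempty) :
    ∃ t ∈ S, ∀ s ∈ S, ∀ s' ∈ S, (coverGraph C).Adj t s → (coverGraph C).Adj t s' → s = s' := by
  classical
  -- At a vertex with longest word, the step to any neighbour in `S` cancels the first letter of the
  -- word, and this letter names the neighbour.
  obtain ⟨t, ht, hmax⟩ := Set.exists_max_image S (fun t => t.1.norm) hS hne
  have key : ∀ s ∈ S, (coverGraph C).Adj t s → t.1.toWord.head? =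
      some (if C t.2 then ((s.2, t.2), false) else ((t.2, s.2), true)) := by
    intro s hs h
    have hn := hmax s hs
    simp only [h.2] at hn
    rw [edgeLetter_eq_mk C (C.valid h.1).symm] at hn
    rw [head?_toWord_of_norm_mul_le _ _ hn]
    split <;> rfl
  refine ⟨t, ht, fun s hs s' hs' h h' => ?_⟩
  have e := (key s hs h).symm.trans (key s' hs' h')
  have e2 : s.2 = s'.2 := by
    cases hc : C t.2 <;> simpa [hc] using e
  exact Prod.ext (by rw [h.2, h'.2, e2]) e2

/-- Right translation on the cover. -/
def coverShift (g : FreeGroup (V × V)) (t : FreeGroup (V × V) × V) : FreeGroup (V × V) × V :=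
  (t.1 * g, t.2)

theorem coverShift_injective (g : FreeGroup (V × V)) :
    Function.Injective (coverShift (V := V) g) := by
  rintro ⟨a, v⟩ ⟨b, w⟩ h
  simpa [coverShift] using h

theorem coverGraph_adj_shift (g : FreeGroup (V × V)) (s t) :
    (coverGraph C).Adj (coverShift g s) (coverShift g t) ↔ (coverGraph C).Adj s t := by
  simp only [coverGraph_adj, coverShift]
  rw [← mul_assoc, mul_left_inj]

/-- Without triangles, a closed walk of length four that is not a genuine square has `b = d` or `a =
c`, or two opposite sides are stationary. In each case the letters along the two halves agree. -/
theorem edgeLetter_square {a b c d : V} (hab : a = b ∨ G.Adj a b) (hbc : b = c ∨ G.Adj b c)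
    (had : a = d ∨ G.Adj a d) (hdc : d = c ∨ G.Adj d c)
    (h : ¬ (a ≠ b ∧ a ≠ c ∧ a ≠ d ∧ b ≠ c ∧ b ≠ d ∧ c ≠ d)) :
    edgeLetter C c b * edgeLetter C b a = edgeLetter C c d * edgeLetter C d a := by
  have e1 : ∀ x, edgeLetter C x x = 1 := fun x => edgeLetter_of_eq rfl
  have e2 := edgeLetter_mul_symm C
  have tri : ∀ {x y z : V}, G.Adj x y → G.Adj y z → G.Adj x z → False := by
    intro x y z h1 h2 h3
    have h1 := C.valid h1
    have h2 := C.valid h2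
    have h3 := C.valid h3
    revert h1 h2 h3
    cases C x <;> cases C y <;> cases C z <;> simp
  by_cases hbd : b = d
  · rw [hbd]
  by_cases hac : a = c
  · rw [hac, e2, e2]
  rcases hab with rfl | hab
  · rcases hbc with rfl | hbc
    · exact absurd rfl hac
    rcases had with rfl | had
    · rfl
    rcases hdc with rfl | hdc
    · simp [e1]
    · exact (tri had hdc hbc).elim
  · rcases hbc with rfl | hbc
    · rcases had with rfl | had
      · simp [e1]
      rcases hdc with rfl | hdc
      · simp [e1]
      · exact (tri had hdc hab).elim
    · rcases had with rfl | had
      · rcases hdc with rfl | hdc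
        · exact absurd rfl hac
        · exact (tri hab hbc hdc).elim
      · rcases hdc with rfl | hdc
        · exact (tri hab hbc had).elim
        · exact (h ⟨hab.ne, hac, had.ne, hbc.ne, hbd, hdc.ne'⟩).elim

/-- A singular cube of degree at most one lifts to the cover. -/
theorem exists_lift (σ : SingCube G n) (h : σ.degree ≤ 1) :
    ∃ γ : SingCube (coverGraph C) n, (coverMap C).comp γ = σ := by
  induction n with
  | zero =>
    refine ⟨⟨fun x => (1, σ x), ?_⟩, rfl⟩
    rintro x y ⟨i, -⟩
    exact i.elim0
  | succ n ih =>
    obtain ⟨γ, hγ⟩ := ih (σ.face 0 false) ((σ.degree_face_le 0 false).trans h)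
    have hγ' : ∀ x, (γ x).2 = σ (Fin.cons false x) := fun x => by
      have := DFunLike.congr_fun hγ x
      simpa [GraphMap.comp_apply, coverMap_apply, SingCube.face_apply] using this
    -- The lift of the face `x 0 = false` is transported along direction `0`. Compatibility with
    -- another direction is a condition on one square, which `edgeLetter_square` settles because
    -- degree at most one excludes injective squares.
    let μ : (Fin (n + 1) → Bool) → FreeGroup (V × V) := fun x =>
      edgeLetter C (σ x) (σ (Fin.cons false (Fin.tail x))) * (γ (Fin.tail x)).1
    have hμ : ∀ (x : Fin (n + 1) → Bool) (i : Fin (n + 1)), x i = false →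
        μ (Function.update x i true) = edgeLetter C (σ (Function.update x i true)) (σ x) * μ x := by
      intro x i hi
      induction i using Fin.cases with
      | zero =>
        have hx : x = Fin.cons false (Fin.tail x) := by
          rw [← hi, Fin.cons_self_tail]
        simp only [μ, Fin.tail_update_zero]
        rw [← hx, edgeLetter_of_eq (a := σ x) rfl, one_mul]
      | succ i =>
        set y := Function.update x i.succ true with hy
        have hty : Fin.tail y = Function.update (Fin.tail x) i true := Fin.tail_update_succ ..
        have hadj : (cubeGraph n).Adj (Fin.tail x) (Fin.tail y) := by
          rw [hty]
          conv => arg 2; rw [← Function.update_eq_self i (Fin.tail x)]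
          exact cubeGraph_adj_update _ _ _ _ (by simp [Fin.tail, hi])
        have hg := ((eq_or_coverGraph_adj C).1 (γ.map_adj hadj)).2
        rw [hγ', hγ'] at hg
        have hy0 : y 0 = x 0 := Function.update_of_ne (Fin.succ_ne_zero i).symm ..
        simp only [μ]
        cases hx0 : x 0
        · have hx : x = Fin.cons false (Fin.tail x) := by rw [← hx0, Fin.cons_self_tail]
          have hyc : y = Fin.cons false (Fin.tail y) := by rw [← hx0, ← hy0, Fin.cons_self_tail]
          rw [← hx, ← hyc] at hg ⊢
          rw [hg, edgeLetter_of_eq (a := σ x) rfl, edgeLetter_of_eq (a := σ y) rfl, one_mul,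
            one_mul]
        · rw [hg, ← mul_assoc, ← mul_assoc]
          congr 1
          have hx : x = Fin.cons true (Fin.tail x) := by rw [← hx0, Fin.cons_self_tail]
          have hyc : y = Fin.cons true (Fin.tail y) := by rw [← hx0, ← hy0, Fin.cons_self_tail]
          have a1 : ∀ z : Fin n → Bool, (cubeGraph (n + 1)).Adj (Fin.cons false z)
              (Fin.cons true z) := fun z => by
            have := cubeGraph_adj_update (Fin.cons false z : Fin (n + 1) → Bool) 0 false true
              (by simp)
            simpa using this
          have a2 : ∀ ε : Bool, (cubeGraph (n + 1)).Adj (Fin.cons ε (Fin.tail x))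
              (Fin.cons ε (Fin.tail y)) := fun ε => by
            have := cubeGraph_adj_update (Fin.cons ε (Fin.tail x) : Fin (n + 1) → Bool) i.succ
              false true (by simp)
            rw [← Fin.cons_update, ← Fin.cons_update] at this
            rw [hty]
            convert this using 2
            rw [eq_comm]
            exact Function.update_eq_self_iff.2 (by simp [Fin.tail, hi])
          have b1 := σ.map_adj (a1 (Fin.tail x))
          have b2 := σ.map_adj (a1 (Fin.tail y))
          have b3 := σ.map_adj (a2 false)
          have b4 := σ.map_adj (a2 true)
          rw [← hx] at b1 b4
          rw [← hyc] at b2 b4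
          refine edgeLetter_square C b3 b2 b1 b4 fun hd => ?_
          have hlt := (σ.degree_le_iff 1).1 h {0, i.succ} x ?_
          · rw [Finset.card_pair (Fin.succ_ne_zero i).symm] at hlt
            omega
          rw [SingCube.injOn_subface_pair σ (Fin.succ_ne_zero i).symm]
          have c : ∀ ε δ, Function.update (Function.update x 0 ε) i.succ δ =
              Fin.cons ε (Function.update (Fin.tail x) i δ) := by
            intro ε δ
            conv_lhs => rw [hx]
            rw [Fin.update_cons_zero, Fin.cons_update]
          have c0 : Function.update (Fin.tail x) i false = Fin.tail x :=
            Function.update_eq_self_iff.2 (by simp [Fin.tail, hi])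
          simp only [c]
          obtain ⟨d1, d2, d3, d4, d5, d6⟩ := hd
          intro ε δ ε' δ' e
          cases ε <;> cases δ <;> cases ε' <;> cases δ' <;>
            first
            | exact ⟨rfl, rfl⟩
            | exfalso
              simp only [c0, ← hty, ← hx, ← hyc] at e
              first
              | exact d1 e | exact d2 e | exact d3 e | exact d4 e | exact d5 e | exact d6 e
              | exact d1 e.symm | exact d2 e.symm | exact d3 e.symm
              | exact d4 e.symm | exact d5 e.symm | exact d6 e.symm
    refine ⟨⟨fun x => (μ x, σ x), ?_⟩, rfl⟩
    have key : ∀ (x : Fin (n + 1) → Bool) (i : Fin (n + 1)), x i = false →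
        ((μ x, σ x) = (μ (Function.update x i true), σ (Function.update x i true)) ∨
          (coverGraph C).Adj (μ x, σ x)
            (μ (Function.update x i true), σ (Function.update x i true))) := by
      intro x i hi
      rw [eq_or_coverGraph_adj]
      refine ⟨?_, hμ x i hi⟩
      apply σ.map_adj
      conv => arg 2; rw [← Function.update_eq_self i x]
      exact cubeGraph_adj_update _ _ _ _ (by simp [hi])
    intro x y hxy
    obtain ⟨i, rfl⟩ := exists_update_of_cubeGraph_adj hxy
    cases hi : x i
    · exact key x i hi
    · have := key (Function.update x i false) i (by simp)
      rw [Function.update_idem, show Function.update x i true = x from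
        Function.update_eq_self_iff.2 hi.symm] at this
      simpa [eq_comm, (coverGraph C).adj_comm] using this

/-- Two lifts of a cube differ by a translation. -/
theorem exists_coverShift (γ γ' : SingCube (coverGraph C) n)
    (h : (coverMap C).comp γ = (coverMap C).comp γ') :
    ∃ g, ∀ x, γ' x = coverShift g (γ x) := by
  have h2 : ∀ x, (γ x).2 = (γ' x).2 := fun x => DFunLike.congr_fun h x
  let o : Fin n → Bool := fun _ => false
  refine ⟨(γ o).1⁻¹ * (γ' o).1, fun x => ?_⟩
  refine Prod.ext ?_ (h2 x).symm
  refine cubeGraph_induction (fun x => (γ' x).1 = (γ x).1 * ((γ o).1⁻¹ * (γ' o).1)) ?_ o x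
    (by simp)
  intro x y hxy hx
  have e1 := ((eq_or_coverGraph_adj C).1 (γ.map_adj hxy)).2
  have e2 := ((eq_or_coverGraph_adj C).1 (γ'.map_adj hxy)).2
  rw [e1, e2, hx, h2, h2, mul_assoc]

/-- Singular cubes that lift to the cover have degree at most one. -/
theorem degree_coverMap_comp_le (γ : SingCube (coverGraph C) n) :
    SingCube.degree ((coverMap C).comp γ) ≤ 1 := by
  rw [SingCube.degree_le_iff]
  intro S b hS
  by_contra hlt
  obtain ⟨i, hi, j, hj, hij⟩ := Finset.one_lt_card.1 (not_le.1 hlt)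
  have hS' : Set.InjOn ((coverMap C).comp γ) (SingCube.subface {i, j} b) := by
    have hsub : SingCube.subface {i, j} b ⊆ SingCube.subface S b := fun x hx k hk => hx k ?_
    · exact hS.mono hsub
    simp only [Finset.mem_insert, Finset.mem_singleton, not_or]
    exact ⟨fun e => hk (e ▸ hi), fun e => hk (e ▸ hj)⟩
  rw [SingCube.injOn_subface_pair _ hij] at hS'
  let f : Bool × Bool → FreeGroup (V × V) × V := fun p =>
    γ (Function.update (Function.update b i p.1) j p.2)
  have hf : ∀ p q, (f p).2 = (f q).2 → p = q := fun p q e => by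
    obtain ⟨h1, h2⟩ := hS' _ _ _ _ e
    exact Prod.ext h1 h2
  have adj1 : ∀ ε δ, (coverGraph C).Adj (f (ε, δ)) (f (ε, !δ)) := by
    intro ε δ
    refine (γ.map_adj (cubeGraph_adj_update _ _ _ _ (by simp))).resolve_left fun e => ?_
    have := hf (ε, δ) (ε, !δ) (congrArg Prod.snd e)
    simp at this
  have adj2 : ∀ ε δ, (coverGraph C).Adj (f (ε, δ)) (f (!ε, δ)) := by
    intro ε δ
    simp only [f]
    rw [Function.update_comm hij, Function.update_comm hij]
    refine (γ.map_adj (cubeGraph_adj_update _ _ _ _ (by simp))).resolve_left fun e => ?_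
    have := hf (ε, δ) (!ε, δ) (by
      simp only [f]
      rw [Function.update_comm hij, Function.update_comm hij]
      exact congrArg Prod.snd e)
    simp at this
  -- The lift of an injective square would be a finite set of vertices each of which has two
  -- distinct neighbours in it.
  obtain ⟨_, ⟨⟨ε, δ⟩, rfl⟩, hleaf⟩ := exists_leaf_coverGraph C (Set.range f) (Set.finite_range f)
    ⟨_, (false, false), rfl⟩
  have := hf _ _ (congrArg Prod.snd
    (hleaf _ ⟨_, rfl⟩ _ ⟨_, rfl⟩ (adj1 ε δ) (adj2 ε δ)))
  simp at this

end Cover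

/-! ### Folding the leaves of the image of a cube -/

section Fold

variable {X : Type u} {T : SimpleGraph X} (c : T.Coloring Bool) (S : Set X) {n : ℕ}

/-- The vertices of `S` that are folded: the leaves of `S`, and only the one of colour `true` if
`S` has just two vertices. -/
def Foldable (t : X) : Prop :=
  t ∈ S ∧ (∃! s, s ∈ S ∧ T.Adj t s) ∧ (2 < S.ncard ∨ c t = true)

open Classical in
/-- The map that moves foldable vertices to their unique neighbours. -/
noncomputable def foldMap (t : X) : X := if h : Foldable c S t then h.2.1.choose else t

variable {c S}

theorem foldMap_of_adj {t s : X} (h : Foldable c S t) (hs : s ∈ S) (hts : T.Adj t s) :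
    foldMap c S t = s := by
  rw [foldMap, dif_pos h]
  exact (h.2.1.choose_spec.2 s ⟨hs, hts⟩).symm

theorem foldMap_of_not {t : X} (h : ¬ Foldable c S t) : foldMap c S t = t := dif_neg h

theorem Foldable.foldMap_mem {t : X} (h : Foldable c S t) : foldMap c S t ∈ S := by
  rw [foldMap, dif_pos h]
  exact h.2.1.choose_spec.1.1

theorem Foldable.adj_foldMap {t : X} (h : Foldable c S t) : T.Adj t (foldMap c S t) := by
  rw [foldMap, dif_pos h]
  exact h.2.1.choose_spec.1.2

theorem eq_or_adj_foldMap (t : X) : t = foldMap c S t ∨ T.Adj t (foldMap c S t) := by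
  by_cases h : Foldable c S t
  · exact Or.inr h.adj_foldMap
  · exact Or.inl (foldMap_of_not h).symm

theorem foldMap_mem {t : X} (ht : t ∈ S) : foldMap c S t ∈ S := by
  by_cases h : Foldable c S t
  · exact h.foldMap_mem
  · rwa [foldMap_of_not h]

/-- The image of a cube is connected. -/
theorem range_subset_of_adj_closed (γ : SingCube T n) (A : Set X)
    (hne : ∃ x, γ x ∈ A)
    (hA : ∀ s ∈ A, ∀ t ∈ Set.range γ, T.Adj s t → t ∈ A) : Set.range γ ⊆ A := by
  obtain ⟨x, hx⟩ := hne
  rintro _ ⟨y, rfl⟩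
  refine cubeGraph_induction (fun x => γ x ∈ A) ?_ x y hx
  intro x y hxy h
  rcases γ.map_adj hxy with e | e
  · rwa [← e]
  · exact hA _ h _ ⟨y, rfl⟩ e

/-- Two adjacent leaves exhaust a connected image, and of two vertices only the one of colour `true`
is folded. This is what makes the folding a graph map. -/
theorem not_foldable_of_adj (γ : SingCube T n) {s t : X} (hs : Foldable c (Set.range γ) s)
    (ht : Foldable c (Set.range γ) t) : ¬ T.Adj s t := by
  intro hst
  have hsub : Set.range γ ⊆ {s, t} := by
    obtain ⟨x, hx⟩ := hs.1
    refine range_subset_of_adj_closed γ _ ⟨x, by simp [hx]⟩ ?_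
    rintro a (rfl | rfl) b hb hab
    · exact Or.inr (hs.2.1.unique ⟨hb, hab⟩ ⟨ht.1, hst⟩)
    · exact Or.inl (ht.2.1.unique ⟨hb, hab⟩ ⟨hs.1, hst.symm⟩)
  have hcard : (Set.range γ).ncard ≤ 2 :=
    (Set.ncard_le_ncard hsub (Set.toFinite _)).trans ((Set.ncard_insert_le s {t}).trans (by simp))
  exact c.valid hst ((hs.2.2.resolve_left (by omega)).trans
    (ht.2.2.resolve_left (by omega)).symm)

variable (c)

/-- The cube obtained by folding the leaves of the image. -/
noncomputable def foldCube (γ : SingCube T n) : SingCube T n where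
  toFun x := foldMap c (Set.range γ) (γ x)
  map_adj' x y hxy := by
    rcases γ.map_adj hxy with h | h
    · exact Or.inl (congrArg _ h)
    by_cases hx : Foldable c (Set.range γ) (γ x)
    · have hy : ¬ Foldable c (Set.range γ) (γ y) := fun hy => not_foldable_of_adj γ hx hy h
      rw [foldMap_of_adj hx ⟨y, rfl⟩ h, foldMap_of_not hy]
      exact Or.inl rfl
    · by_cases hy : Foldable c (Set.range γ) (γ y)
      · rw [foldMap_of_adj hy ⟨x, rfl⟩ h.symm, foldMap_of_not hx]
        exact Or.inl rfl
      · rw [foldMap_of_not hx, foldMap_of_not hy]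
        exact Or.inr h

theorem foldCube_apply (γ : SingCube T n) (x) :
    foldCube c γ x = foldMap c (Set.range γ) (γ x) := rfl

theorem eq_or_adj_foldCube (γ : SingCube T n) (x) :
    γ x = foldCube c γ x ∨ T.Adj (γ x) (foldCube c γ x) := eq_or_adj_foldMap _

theorem eq_or_adj_face_foldCube (γ : SingCube T (n + 1)) (i ε x) :
    γ.face i ε x = (foldCube c γ).face i ε x ∨ T.Adj (γ.face i ε x) ((foldCube c γ).face i ε x) :=
  eq_or_adj_foldMap _

/-- The prism between a cube and the cube obtained by folding. -/
noncomputable def foldPrism (γ : SingCube T n) : SingCube T (n + 1) :=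
  homotopyCube γ (foldCube c γ) (eq_or_adj_foldCube c γ)

theorem range_foldPrism_subset (γ : SingCube T n) : Set.range (foldPrism c γ) ⊆ Set.range γ := by
  rintro _ ⟨x, rfl⟩
  rw [foldPrism, homotopyCube_apply]
  split
  · exact foldMap_mem ⟨_, rfl⟩
  · exact ⟨_, rfl⟩

theorem exists_adj_of_one_lt (γ : SingCube T n) (h : 1 < (Set.range γ).ncard) {t : X}
    (ht : t ∈ Set.range γ) : ∃ s ∈ Set.range γ, T.Adj t s := by
  by_contra! hc
  have hsub : Set.range γ ⊆ {t} := by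
    obtain ⟨x, hx⟩ := ht
    refine range_subset_of_adj_closed γ _ ⟨x, by simp [hx]⟩ ?_
    rintro a rfl b hb hab
    exact (hc b hb hab).elim
  have := Set.ncard_le_ncard hsub
  rw [Set.ncard_singleton] at this
  omega

theorem exists_foldable (γ : SingCube T n) (h : 1 < (Set.range γ).ncard)
    (hleaf : ∃ t ∈ Set.range γ, ∀ s ∈ Set.range γ, ∀ s' ∈ Set.range γ,
      T.Adj t s → T.Adj t s' → s = s') : ∃ t, Foldable c (Set.range γ) t := by
  obtain ⟨t, ht, hl⟩ := hleaf
  obtain ⟨s, hs, hts⟩ := exists_adj_of_one_lt γ h ht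
  have htl : ∃! s, s ∈ Set.range γ ∧ T.Adj t s :=
    ⟨s, ⟨hs, hts⟩, fun s' hs' => hl _ hs'.1 _ hs hs'.2 hts⟩
  by_cases h2 : 2 < (Set.range γ).ncard
  · exact ⟨t, ht, htl, Or.inl h2⟩
  by_cases hct : c t = true
  · exact ⟨t, ht, htl, Or.inr hct⟩
  have hS : ({t, s} : Set X) = Set.range γ := by
    refine Set.eq_of_subset_of_ncard_le ?_ ?_ (Set.finite_range γ)
    · rintro a (rfl | rfl)
      · exact ht
      · exact hs
    · rw [Set.ncard_pair hts.ne]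
      omega
  refine ⟨s, hs, ⟨t, ⟨ht, hts.symm⟩, ?_⟩, Or.inr ?_⟩
  · rintro a ⟨ha, hsa⟩
    rw [← hS] at ha
    rcases ha with rfl | rfl
    · rfl
    · exact (hsa.ne rfl).elim
  · have := c.valid hts
    revert this hct
    cases c t <;> cases c s <;> simp

/-- A folded leaf disappears from the image: it moves away itself, and only an adjacent foldable
vertex could be moved onto it. -/
theorem ncard_range_foldCube_lt (γ : SingCube T n) (h : 1 < (Set.range γ).ncard)
    (hleaf : ∃ t ∈ Set.range γ, ∀ s ∈ Set.range γ, ∀ s' ∈ Set.range γ,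
      T.Adj t s → T.Adj t s' → s = s') :
    (Set.range (foldCube c γ)).ncard < (Set.range γ).ncard := by
  obtain ⟨t, ht⟩ := exists_foldable c γ h hleaf
  refine Set.ncard_lt_ncard (Set.ssubset_iff_of_subset ?_ |>.2 ⟨t, ht.1, ?_⟩) (Set.finite_range γ)
  · rintro _ ⟨x, rfl⟩
    exact foldMap_mem ⟨_, rfl⟩
  · rintro ⟨x, hx⟩
    rw [foldCube_apply] at hx
    by_cases hf : Foldable c (Set.range γ) (γ x)
    · have := hf.adj_foldMap
      rw [hx] at this
      exact not_foldable_of_adj γ hf ht this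
    · rw [foldMap_of_not hf] at hx
      exact hf (hx ▸ ht)

/-- For a cube whose image has several points, folding with respect to a bigger set keeps the
image inside. -/
theorem foldMap_mem_of_subset (γ : SingCube T n) (h : 1 < (Set.range γ).ncard) (hS : Set.range γ ⊆ S)
    {t : X} (ht : t ∈ Set.range γ) : foldMap c S t ∈ Set.range γ := by
  by_cases hf : Foldable c S t
  · obtain ⟨s, hs, hts⟩ := exists_adj_of_one_lt γ h ht
    rwa [foldMap_of_adj hf (hS hs) hts]
  · rwa [foldMap_of_not hf]

end Fold

/-! ### Cubes of degree at most one -/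

section DegreeOne

variable {V : Type u} {G : SimpleGraph V} (C : G.Coloring Bool) {n : ℕ}

theorem range_comp_coverShift (g : FreeGroup (V × V)) (γ γ' : SingCube (coverGraph C) n)
    (h : ∀ x, γ' x = coverShift g (γ x)) : Set.range γ' = coverShift g '' Set.range γ := by
  rw [← Set.range_comp]
  exact congrArg Set.range (funext h)

theorem foldMap_coverShift (g : FreeGroup (V × V)) (S : Set (FreeGroup (V × V) × V)) (t) :
    foldMap (coverColoring C) (coverShift g '' S) (coverShift g t) =
      coverShift g (foldMap (coverColoring C) S t) := by
  have hinj := coverShift_injective g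
  have key : Foldable (coverColoring C) (coverShift g '' S) (coverShift g t) ↔
      Foldable (coverColoring C) S t := by
    have e1 : coverShift g t ∈ coverShift g '' S ↔ t ∈ S := hinj.mem_set_image
    have e2 : (coverShift g '' S).ncard = S.ncard := Set.ncard_image_of_injective S hinj
    have e3 : (∃! s, s ∈ coverShift g '' S ∧ (coverGraph C).Adj (coverShift g t) s) ↔
        ∃! s, s ∈ S ∧ (coverGraph C).Adj t s := by
      constructor
      · rintro ⟨_, ⟨⟨s, hs, rfl⟩, hts⟩, hu⟩
        refine ⟨s, ⟨hs, (coverGraph_adj_shift C g t s).1 hts⟩, fun s' hs' => hinj ?_⟩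
        exact hu _ ⟨⟨s', hs'.1, rfl⟩, (coverGraph_adj_shift C g t s').2 hs'.2⟩
      · rintro ⟨s, ⟨hs, hts⟩, hu⟩
        refine ⟨_, ⟨⟨s, hs, rfl⟩, (coverGraph_adj_shift C g t s).2 hts⟩, ?_⟩
        rintro _ ⟨⟨s', hs', rfl⟩, hts'⟩
        rw [hu s' ⟨hs', (coverGraph_adj_shift C g t s').1 hts'⟩]
    rw [Foldable, Foldable, e1, e2, e3]
    rfl
  by_cases hf : Foldable (coverColoring C) S t
  · exact foldMap_of_adj (key.2 hf) ⟨_, hf.foldMap_mem, rfl⟩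
      ((coverGraph_adj_shift C g _ _).2 hf.adj_foldMap)
  · rw [foldMap_of_not hf, foldMap_of_not (fun h => hf (key.1 h))]

/-- The projection of the folding prism does not depend on the lift. -/
theorem coverMap_comp_foldPrism_eq (γ γ' : SingCube (coverGraph C) n)
    (h : (coverMap C).comp γ = (coverMap C).comp γ') :
    (coverMap C).comp (foldPrism (coverColoring C) γ) =
      (coverMap C).comp (foldPrism (coverColoring C) γ') := by
  obtain ⟨g, hg⟩ := exists_coverShift C γ γ' h
  refine DFunLike.ext _ _ fun x => ?_
  simp only [GraphMap.comp_apply, coverMap_apply, foldPrism, homotopyCube_apply, foldCube_apply]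
  rw [range_comp_coverShift C g γ γ' hg, hg, foldMap_coverShift]
  split <;> rfl

/-- Adjacent vertices of the cover have distinct projections, so an edge that is stationary below is
stationary above. This lets `leafHomotopy` pass to normalized chains. -/
theorem IsDegenerate.lift (γ : SingCube (coverGraph C) n)
    (h : SingCube.IsDegenerate ((coverMap C).comp γ)) : γ.IsDegenerate := by
  obtain ⟨i, hi⟩ := h
  refine ⟨i, fun x => ?_⟩
  have h1 := γ.map_adj (cubeGraph_adj_update x i false true (by simp))
  refine h1.resolve_right fun h2 => ?_
  exact h2.1.ne (hi x)

theorem IsDegenerate.foldPrism {X : Type u} {T : SimpleGraph X} (c : T.Coloring Bool)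
    (γ : SingCube T n) (h : γ.IsDegenerate) : (foldPrism c γ).IsDegenerate := by
  obtain ⟨i, hi⟩ := h
  refine ⟨i.succ, fun x => ?_⟩
  simp only [DiscreteCubical.foldPrism, homotopyCube_apply, Fin.tail_update_succ, foldCube_apply,
    Function.update_of_ne (Fin.succ_ne_zero i).symm, hi]

theorem IsDegenerate.comp {X : Type v} {T : SimpleGraph X} (f : GraphMap T G)
    (γ : SingCube T n) (h : γ.IsDegenerate) : SingCube.IsDegenerate (f.comp γ) := by
  obtain ⟨i, hi⟩ := h
  exact ⟨i, fun x => congrArg f (hi x)⟩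

open Classical in
/-- The folding homotopy on the normalized chains; it is zero on the cubes without lift. -/
noncomputable def leafHomotopy (n : ℕ) : NormChains G n →ₗ[ℤ] NormChains G (n + 1) :=
  chainLift (fun σ : SingCube G n =>
      if h : ∃ γ : SingCube (coverGraph C) n, (coverMap C).comp γ = σ then
        cubeClass G ((coverMap C).comp (foldPrism (coverColoring C) h.choose)) else 0)
    (fun σ hσ => by
      split_ifs with h
      · refine cubeClass_eq_zero (IsDegenerate.comp _ _ (IsDegenerate.foldPrism _ _ ?_))
        exact IsDegenerate.lift C _ (h.choose_spec.symm ▸ hσ)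
      · rfl)

theorem leafHomotopy_cubeClass (γ : SingCube (coverGraph C) n) :
    leafHomotopy C n (cubeClass G ((coverMap C).comp γ)) =
      cubeClass G ((coverMap C).comp (foldPrism (coverColoring C) γ)) := by
  have h : ∃ γ' : SingCube (coverGraph C) n, (coverMap C).comp γ' = (coverMap C).comp γ :=
    ⟨γ, rfl⟩
  rw [leafHomotopy, chainLift_cubeClass, dif_pos h,
    coverMap_comp_foldPrism_eq C _ γ h.choose_spec]

/-- The chains on the cubes with a lift whose image has fewer than `N` vertices. -/
noncomputable def liftFilt (N n : ℕ) : Submodule ℤ (NormChains G n) :=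
  Submodule.span ℤ (cubeClass G '' ((fun γ : SingCube (coverGraph C) n => (coverMap C).comp γ) ''
    {γ | (Set.range γ).ncard < N}))

variable {C} in
theorem cubeClass_mem_liftFilt {N : ℕ} (γ : SingCube (coverGraph C) n)
    (h : (Set.range γ).ncard < N) : cubeClass G ((coverMap C).comp γ) ∈ liftFilt C N n :=
  Submodule.subset_span ⟨_, ⟨γ, h, rfl⟩, rfl⟩

variable {C} in
theorem liftFilt_induction {N : ℕ} (p : Submodule ℤ (NormChains G n))
    (h : ∀ γ : SingCube (coverGraph C) n, (Set.range γ).ncard < N →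
      cubeClass G ((coverMap C).comp γ) ∈ p) : liftFilt C N n ≤ p := by
  refine Submodule.span_le.2 ?_
  rintro _ ⟨_, ⟨γ, hγ, rfl⟩, rfl⟩
  exact h γ hγ

theorem degreeLT_two_le (n : ℕ) : degreeLT G 2 n ≤ liftFilt C (2 ^ n + 1) n := by
  refine Submodule.span_le.2 ?_
  rintro _ ⟨σ, hσ, rfl⟩
  obtain ⟨γ, rfl⟩ := exists_lift C σ (Nat.le_of_lt_succ hσ)
  refine cubeClass_mem_liftFilt γ (Nat.lt_succ_of_le ?_)
  rw [← Set.image_univ]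
  refine (Set.ncard_image_le Set.finite_univ).trans ?_
  simp [Set.ncard_univ]

theorem eq_or_adj_comp {X : Type v} {T : SimpleGraph X} (f : GraphMap T G)
    {σ τ : SingCube T n} (h : ∀ x, σ x = τ x ∨ T.Adj (σ x) (τ x)) (x) :
    (f.comp σ : SingCube G n) x = (f.comp τ : SingCube G n) x ∨
      G.Adj ((f.comp σ : SingCube G n) x) ((f.comp τ : SingCube G n) x) :=
  (h x).elim (fun e => Or.inl (congrArg f e)) f.map_adj

theorem comp_homotopyCube {X : Type v} {T : SimpleGraph X} (f : GraphMap T G)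
    (σ τ : SingCube T n) (h) (h') :
    f.comp (homotopyCube σ τ h) = homotopyCube (f.comp σ) (f.comp τ) h' := by
  refine DFunLike.ext _ _ fun x => ?_
  simp only [GraphMap.comp_apply, homotopyCube_apply]
  split <;> rfl

theorem face_comp {X : Type v} {T : SimpleGraph X} (f : GraphMap T G)
    (σ : SingCube T (n + 1)) (i ε) : SingCube.face (f.comp σ) i ε = f.comp (σ.face i ε) := rfl

theorem range_face_subset {X : Type v} {T : SimpleGraph X} (σ : SingCube T (n + 1)) (i ε) :
    Set.range (σ.face i ε) ⊆ Set.range σ := by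
  rintro _ ⟨x, rfl⟩
  exact ⟨_, rfl⟩

/-- The prism over a face differs from the face of the prism by chains of smaller image. -/
theorem foldPrism_face_mem (γ : SingCube (coverGraph C) (n + 2)) (i : Fin (n + 2)) (ε : Bool) :
    cubeClass G ((coverMap C).comp (foldPrism (coverColoring C) (γ.face i ε))) -
      cubeClass G ((coverMap C).comp (homotopyCube (γ.face i ε)
        ((foldCube (coverColoring C) γ).face i ε) (eq_or_adj_face_foldCube _ γ i ε))) ∈
      liftFilt C (Set.range γ).ncard (n + 2) := by
  have hsub := range_face_subset γ i ε
  -- Folding a vertex depends only on the image set of the cube, so the two prisms coincide when the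
  -- face has the full image.
  by_cases hS : Set.range (γ.face i ε) = Set.range γ
  · convert Submodule.zero_mem _
    rw [sub_eq_zero]
    congr 2
    refine DFunLike.ext _ _ fun x => ?_
    simp only [foldPrism, homotopyCube_apply, foldCube_apply, hS]
    rfl
  have hlt : (Set.range (γ.face i ε)).ncard < (Set.range γ).ncard :=
    Set.ncard_lt_ncard (lt_of_le_of_ne hsub hS) (Set.finite_range γ)
  refine Submodule.sub_mem _ ?_ ?_
  · refine cubeClass_mem_liftFilt _ (lt_of_le_of_lt ?_ hlt)
    exact Set.ncard_le_ncard (range_foldPrism_subset _ _) (Set.finite_range _)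
  · by_cases h1 : 1 < (Set.range (γ.face i ε)).ncard
    · refine cubeClass_mem_liftFilt _ (lt_of_le_of_lt ?_ hlt)
      refine Set.ncard_le_ncard ?_ (Set.finite_range _)
      rintro _ ⟨x, rfl⟩
      rw [homotopyCube_apply]
      split
      · exact foldMap_mem_of_subset _ _ h1 hsub ⟨_, rfl⟩
      · exact ⟨_, rfl⟩
    -- Over a constant face the side of the big prism may leave the image of the face, but it does
    -- not depend on direction `1`. This direction exists because the face has positive dimension,
    -- hence the restriction to dimensions at least two.
    · rw [cubeClass_eq_zero]
      · exact Submodule.zero_mem _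
      refine IsDegenerate.comp _ _ ?_
      have hc : ∀ x y, γ.face i ε x = γ.face i ε y := fun x y =>
        (Set.ncard_le_one (Set.finite_range _)).1 (not_lt.1 h1) _ ⟨x, rfl⟩ _ ⟨y, rfl⟩
      refine ⟨1, fun x => ?_⟩
      have h1 : (1 : Fin (n + 2)) ≠ 0 := by simp
      simp only [homotopyCube_apply, Function.update_of_ne h1.symm]
      split
      · exact congrArg (foldMap (coverColoring C) (Set.range γ)) (hc _ _)
      · exact hc _ _

/-- By the prism formula, `∂h + h∂ + 1` sends a cube to its folded cube, plus a signed sum of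
differences between the prisms over its faces and the side faces of its prism. All these terms have
smaller images, by `ncard_range_foldCube_lt` and `foldPrism_face_mem`. -/
theorem leafHomotopy_spec {N : ℕ} (z : NormChains G (n + 2)) (hz : z ∈ liftFilt C (N + 1) (n + 2)) :
    normBoundary G (n + 2) (leafHomotopy C (n + 2) z) +
      leafHomotopy C (n + 1) (normBoundary G (n + 1) z) + z ∈ liftFilt C N (n + 2) := by
  let D : NormChains G (n + 2) →ₗ[ℤ] NormChains G (n + 2) :=
    normBoundary G (n + 2) ∘ₗ leafHomotopy C (n + 2) +
      leafHomotopy C (n + 1) ∘ₗ normBoundary G (n + 1) + LinearMap.id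
  suffices h : liftFilt C (N + 1) (n + 2) ≤ (liftFilt C N (n + 2)).comap D from h hz
  refine liftFilt_induction _ fun γ hγ => ?_
  have mono : liftFilt C (Set.range γ).ncard (n + 2) ≤ liftFilt C N (n + 2) :=
    liftFilt_induction _ fun γ' h' => cubeClass_mem_liftFilt γ' (by omega)
  by_cases h1 : 1 < (Set.range γ).ncard
  swap
  · rw [cubeClass_eq_zero]
    · exact Submodule.zero_mem _
    · refine isDegenerate_of_const fun x y => congrArg (coverMap C) ?_
      exact (Set.ncard_le_one (Set.finite_range _)).1 (not_lt.1 h1) _ ⟨x, rfl⟩ _ ⟨y, rfl⟩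
  apply mono
  simp only [D, LinearMap.add_apply, LinearMap.comp_apply, LinearMap.id_apply]
  rw [leafHomotopy_cubeClass, foldPrism,
    comp_homotopyCube (coverMap C) γ _ _ (eq_or_adj_comp _ (eq_or_adj_foldCube _ γ)),
    normBoundary_homotopyCube, normBoundary_cubeClass, map_sum]
  simp only [map_smul, map_sub, face_comp, leafHomotopy_cubeClass]
  have hfold : cubeClass G ((coverMap C).comp (foldCube (coverColoring C) γ)) ∈
      liftFilt C (Set.range γ).ncard (n + 2) :=
    cubeClass_mem_liftFilt _ (ncard_range_foldCube_lt _ _ h1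
      (exists_leaf_coverGraph C _ (Set.finite_range γ) (Set.range_nonempty γ)))
  have hrest := foldPrism_face_mem C γ
  have hsum := Submodule.add_mem _ hfold (Submodule.sum_mem (t := Finset.univ) _ fun (i : Fin (n + 2)) _ =>
    Submodule.smul_mem _ ((-1 : ℤ) ^ (i.val + 1))
      (Submodule.sub_mem _ (hrest i false) (hrest i true)))
  convert hsum using 1
  have e : ∀ i ε, (coverMap C).comp (homotopyCube (γ.face i ε)
        ((foldCube (coverColoring C) γ).face i ε) (eq_or_adj_face_foldCube _ γ i ε)) =
      homotopyCube ((coverMap C).comp (γ.face i ε))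
        ((coverMap C).comp ((foldCube (coverColoring C) γ).face i ε)) 
        (eq_or_adj_comp _ (eq_or_adj_face_foldCube _ γ i ε)) := fun i ε =>
    comp_homotopyCube _ _ _ _ _
  simp only [e, smul_sub, Finset.sum_sub_distrib]
  abel

/-- In a bipartite graph, cycles of dimension at least two of degree at most one are boundaries of
chains of degree at most one. -/
theorem exists_boundary_of_degree_le_one (C : G.Coloring Bool) (z : NormChains G (n + 2)) (hz : z ∈ degreeLT G 2 (n + 2))
    (hcyc : normBoundary G (n + 1) z = 0) :
    ∃ w ∈ degreeLT G 2 (n + 3), normBoundary G (n + 2) w = z := by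
  have key : ∀ N, ∀ z ∈ liftFilt C N (n + 2), normBoundary G (n + 1) z = 0 →
      ∃ w ∈ degreeLT G 2 (n + 3), normBoundary G (n + 2) w = z := by
    intro N
    induction N with
    | zero =>
      intro z hz _
      have h0 : liftFilt C 0 (n + 2) ≤ ⊥ := liftFilt_induction _ fun γ h => by omega
      exact ⟨0, Submodule.zero_mem _, by rw [map_zero, (Submodule.mem_bot ℤ).1 (h0 hz)]⟩
    | succ N ih =>
      intro z hz hcyc
      -- For a cycle `z`, the chain `∂hz + z` is a cycle supported on smaller images; if it bounds
      -- `w`, then `z` bounds `w - hz`.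
      have h1 := leafHomotopy_spec C z hz
      rw [hcyc, map_zero, add_zero] at h1
      have hbb := LinearMap.congr_fun (normBoundary_comp G (n + 1)) (leafHomotopy C (n + 2) z)
      simp only [LinearMap.comp_apply, LinearMap.zero_apply] at hbb
      obtain ⟨w, hw, hwz⟩ := ih _ h1 (by rw [map_add, hbb, hcyc, add_zero])
      refine ⟨w - leafHomotopy C (n + 2) z, Submodule.sub_mem _ hw ?_, ?_⟩
      · have : liftFilt C (N + 1) (n + 2) ≤
            (degreeLT G 2 (n + 3)).comap (leafHomotopy C (n + 2)) :=
          liftFilt_induction _ fun γ _ => by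
            rw [Submodule.mem_comap, leafHomotopy_cubeClass]
            exact Submodule.subset_span
              ⟨_, Nat.lt_succ_of_le (degree_coverMap_comp_le C _), rfl⟩
        exact this hz
      · rw [map_sub, hwz]
        abel
  exact key _ z (degreeLT_two_le C _ hz) hcyc

end DegreeOne

/-! ### Homology from chains -/

section Homology

variable {V : Type u} {G : SimpleGraph V}

theorem degreeLT_eq_top {d : ℕ} (hd : ∀ n (σ : SingCube G n), σ.degree < d) (n : ℕ) :
    degreeLT G d n = ⊤ := by
  have : {σ : SingCube G n | σ.degree < d} = Set.univ := Set.eq_univ_of_forall (hd n)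
  rw [degreeLT, this, Set.image_univ, cubeClass_span]

theorem gradedHomology_isZero {k : ℕ} (hd : ∀ n (σ : SingCube G n), σ.degree < k) (n : ℕ) :
    Limits.IsZero (gradedHomology G k n) := by
  rw [← HomologicalComplex.exactAt_iff_isZero_homology]
  refine ShortComplex.exact_of_isZero_X₂ _ ?_
  change Limits.IsZero (ModuleCat.of ℤ (GradedChains G k n))
  have : Subsingleton (GradedChains G k n) := by
    rw [Submodule.Quotient.subsingleton_iff, Submodule.submoduleOf, degreeLT_eq_top hd,
      Submodule.comap_top]
  exact ModuleCat.isZero_of_subsingleton _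

theorem isIso_filtInclusion {k : ℕ} (hd : ∀ n (σ : SingCube G n), σ.degree ≤ k) :
    IsIso (filtInclusion G k) := by
  have : ∀ n, IsIso ((filtInclusion G k).f n) := fun n => by
    rw [ConcreteCategory.isIso_iff_bijective]
    change Function.Bijective (degreeLT G (k + 1) n).subtype
    refine ⟨Submodule.subtype_injective _, fun x => ⟨⟨x, ?_⟩, rfl⟩⟩
    rw [degreeLT_eq_top fun n σ => Nat.lt_succ_of_le (hd n σ)]
    trivial
  exact HomologicalComplex.Hom.isIso_of_components _

/-- The inclusion of a step of the degree filtration into the next one. -/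
noncomputable def filtStep (k : ℕ) : filtComplex G k ⟶ filtComplex G (k + 1) :=
  ChainComplex.ofHom
    (fun n => ModuleCat.ofHom (Submodule.inclusion (degreeLT_mono G (Nat.le_succ (k + 1)) n)))
    (fun n => by
      rw [filtComplex_d, filtComplex_d]
      rfl)

theorem filtStep_comp_gradedProjection (k : ℕ) :
    filtStep k ≫ gradedProjection G (k + 1) = 0 := by
  ext n x
  exact (Submodule.Quotient.mk_eq_zero
    ((degreeLT G (k + 1) n).submoduleOf (degreeLT G (k + 1 + 1) n))).2 x.2

/-- The short exact sequence of a step of the degree filtration. -/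
noncomputable def filtShortComplex (G : SimpleGraph V) (k : ℕ) :
    ShortComplex (ChainComplex (ModuleCat.{u} ℤ) ℕ) :=
  ShortComplex.mk (filtStep (G := G) k) (gradedProjection G (k + 1))
    (filtStep_comp_gradedProjection k)

theorem filtShortComplex_shortExact (k : ℕ) : (filtShortComplex G k).ShortExact := by
  refine HomologicalComplex.shortExact_of_degreewise_shortExact _ fun n => ?_
  refine ModuleCat.shortComplex_shortExact _ ?_ ?_ ?_
  · intro x
    refine (Submodule.Quotient.mk_eq_zero
      ((degreeLT G (k + 1) n).submoduleOf (degreeLT G (k + 1 + 1) n))).trans ?_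
    exact ⟨fun hx => ⟨⟨_, hx⟩, rfl⟩, by rintro ⟨y, rfl⟩; exact y.2⟩
  · exact Submodule.inclusion_injective (degreeLT_mono G (Nat.le_succ (k + 1)) n)
  · exact Submodule.mkQ_surjective _

/-- If the cycles of `C^k` in dimension `n + 1` are boundaries, its homology vanishes. -/
theorem filtComplex_homology_isZero {k n : ℕ}
    (h : ∀ z ∈ degreeLT G (k + 1) (n + 1), normBoundary G n z = 0 →
      ∃ w ∈ degreeLT G (k + 1) (n + 2), normBoundary G (n + 1) w = z) :
    Limits.IsZero ((filtComplex G k).homology (n + 1)) := by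
  rw [← HomologicalComplex.exactAt_iff_isZero_homology,
    HomologicalComplex.exactAt_iff' _ (n + 2) (n + 1) n (by simp) (by simp),
    ShortComplex.moduleCat_exact_iff]
  intro z hz
  change (filtComplex G k).d (n + 1) n z = 0 at hz
  rw [filtComplex_d] at hz
  obtain ⟨w, hw, hwz⟩ := h z.1 z.2 (congrArg Subtype.val hz)
  refine ⟨⟨w, hw⟩, ?_⟩
  change (filtComplex G k).d (n + 2) (n + 1) _ = z
  rw [filtComplex_d]
  exact Subtype.ext hwz

/-- The homology of `C^1` vanishes in dimensions `n + 3` and `n + 2`, the two neighbours of this map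
in the long exact sequence of `C^1 ⊆ C^2`. The shift by three keeps both dimensions at least two. -/
theorem isIso_homologyMap_gradedProjection (C : G.Coloring Bool) (n : ℕ) :
    IsIso (HomologicalComplex.homologyMap (gradedProjection G 2) (n + 3)) := by
  have hS := filtShortComplex_shortExact (G := G) 1
  have h3 : Limits.IsZero ((filtComplex G 1).homology (n + 3)) :=
    filtComplex_homology_isZero fun z hz hc => exists_boundary_of_degree_le_one C z hz hc
  have h2 : Limits.IsZero ((filtComplex G 1).homology (n + 2)) :=
    filtComplex_homology_isZero fun z hz hc => exists_boundary_of_degree_le_one C z hz hc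
  have hm : Mono (HomologicalComplex.homologyMap (filtShortComplex G 1).g (n + 3)) :=
    (hS.homology_exact₂ (n + 3)).mono_g (h3.eq_of_src _ _)
  have he : Epi (HomologicalComplex.homologyMap (filtShortComplex G 1).g (n + 3)) :=
    (hS.homology_exact₃ (n + 3) (n + 2) (by simp)).epi_f (h2.eq_of_tgt _ _)
  exact isIso_of_mono_of_epi (HomologicalComplex.homologyMap (filtShortComplex G 1).g (n + 3))

/-- A functional that vanishes on boundaries and, on cycles, is surjective with only boundaries
in its kernel identifies the homology with `R`. -/
theorem homology_equiv_ring {R : Type v} [CommRing R] (S : ShortComplex (ModuleCat.{u} R)) (φ : S.X₂ →ₗ[R] R)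
    (hφ : ∀ w, φ (S.f.hom w) = 0) (hsurj : ∃ z, S.g.hom z = 0 ∧ φ z = 1)
    (hinj : ∀ z, S.g.hom z = 0 → φ z = 0 → ∃ w, S.f.hom w = z) :
    Nonempty (S.homology ≃ₗ[R] R) := by
  let ψ : LinearMap.ker S.g.hom →ₗ[R] R := φ ∘ₗ (LinearMap.ker S.g.hom).subtype
  have hker : LinearMap.range S.moduleCatToCycles = LinearMap.ker ψ := by
    ext ⟨z, hz⟩
    constructor
    · rintro ⟨w, hw⟩
      have hw' : S.f.hom w = z := congrArg Subtype.val hw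
      change φ z = 0
      rw [← hw', hφ]
    · intro h
      obtain ⟨w, hw⟩ := hinj z hz h
      exact ⟨w, Subtype.ext hw⟩
  have hs : Function.Surjective ψ := by
    obtain ⟨z, hz, hz1⟩ := hsurj
    refine LinearMap.range_eq_top.1 (eq_top_iff.2 fun a _ => ?_)
    refine ⟨a • ⟨z, hz⟩, ?_⟩
    rw [map_smul]
    change a • φ z = a
    rw [hz1, smul_eq_mul, mul_one]
  exact ⟨S.moduleCatHomologyIso.toLinearEquiv.trans
    ((Submodule.quotEquivOfEq _ _ hker).trans (ψ.quotKerEquivOfSurjective hs))⟩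

theorem cubicalHomology_equiv_int {n : ℕ} (φ : NormChains G (n + 1) →ₗ[ℤ] ℤ)
    (hφ : ∀ w, φ (normBoundary G (n + 1) w) = 0)
    (hsurj : ∃ z, normBoundary G n z = 0 ∧ φ z = 1)
    (hinj : ∀ z, normBoundary G n z = 0 → φ z = 0 → ∃ w, normBoundary G (n + 1) w = z) :
    Nonempty (cubicalHomology G (n + 1) ≃ₗ[ℤ] ℤ) := by
  let S := (cubicalComplex G).sc' (n + 2) (n + 1) n
  have hg : S.g.hom = normBoundary G n := congrArg ModuleCat.Hom.hom (cubicalComplex_d G n)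
  have hf : S.f.hom = normBoundary G (n + 1) :=
    congrArg ModuleCat.Hom.hom (cubicalComplex_d G (n + 1))
  obtain ⟨e⟩ := homology_equiv_ring S φ (fun w => (congrArg φ (LinearMap.congr_fun hf w)).trans (hφ w))
    (hsurj.imp fun z hz => ⟨(LinearMap.congr_fun hg z).trans hz.1, hz.2⟩)
    (fun z hz h => (hinj z ((LinearMap.congr_fun hg z).symm.trans hz) h).imp fun w hw =>
      (LinearMap.congr_fun hf w).trans hw)
  let e' := ((cubicalComplex G).homologyIsoSc' (n + 2) (n + 1) n (by simp)
    (by simp)).toLinearEquiv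
  exact ⟨(e'.toAddEquiv.trans e.toAddEquiv).toIntLinearEquiv⟩

end Homology

/-! ### Cubes over a square, by letters -/

section Letters

/-- Two letters that occur at adjacent vertices: the letters `0, 1, 2, 3` are the vertices of a
square in cyclic order, `4` stands for the vertices outside of it. -/
def letterAdj (l m : Fin 5) : Bool :=
  l == 4 || m == 4 || (l.val + 2) % 4 != m.val

/-- A vertex outside of a square is adjacent to at most one vertex of the square. -/
def letterStar (x l m k : Fin 5) : Bool :=
  x != 4 || ((l == 4 || m == 4 || l == m) && (l == 4 || k == 4 || l == k) &&
    (m == 4 || k == 4 || m == k))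

/-- The orientation of a closed walk of length four around the square. -/
def letterSign (p q r s : Fin 5) : ℤ :=
  if p = 4 then 0
  else if q.val = (p.val + 1) % 4 ∧ r.val = (p.val + 2) % 4 ∧ s.val = (p.val + 3) % 4 then 1
  else if q.val = (p.val + 3) % 4 ∧ r.val = (p.val + 2) % 4 ∧ s.val = (p.val + 1) % 4 then -1
  else 0

/-- The possible letters of a singular 3-cube. -/
def letterCube (x : Bool → Bool → Bool → Fin 5) : Prop :=
  (∀ i j, letterAdj (x false i j) (x true i j)) ∧ (∀ i j, letterAdj (x i false j) (x i true j)) ∧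
    (∀ i j, letterAdj (x i j false) (x i j true)) ∧
    ∀ i j k, letterStar (x i j k) (x (!i) j k) (x i (!j) k) (x i j (!k))

/-- One face of a cube avoids the square and the opposite one goes around it. -/
def letterOpposite (x y z t x' y' z' t' : Fin 5) : Bool :=
  x == 4 && y == 4 && z == 4 && t == 4 && letterSign x' y' z' t' != 0

/-- The alternating sum of the orientations of the faces vanishes and there is not exactly one
face around the square, unless a face around the square is opposite to a face avoiding it. -/
def letterCheck (x y z t x' y' z' t' : Fin 5) : Bool :=
  letterOpposite x y z t x' y' z' t' || letterOpposite x' y' z' t' x y z t ||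
  letterOpposite x y y' x' t z z' t' || letterOpposite t z z' t' x y y' x' ||
  letterOpposite x t t' x' y z z' y' || letterOpposite y z z' y' x t t' x' ||
  (letterSign x t t' x' - letterSign y z z' y'
      - (letterSign x y y' x' - letterSign t z z' t')
      + (letterSign x y z t - letterSign x' y' z' t') == 0 &&
    (letterSign x t t' x').natAbs + (letterSign y z z' y').natAbs + (letterSign x y y' x').natAbs +
      (letterSign t z z' t').natAbs + (letterSign x y z t).natAbs +
      (letterSign x' y' z' t').natAbs != 1)

-- The hypotheses are interleaved with the quantifiers so that the decision procedure discards a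
-- partial assignment as soon as it violates a constraint, instead of running through all `5 ^ 8`
-- labellings.
set_option maxRecDepth 100000 in
set_option maxHeartbeats 4000000 in
theorem letterCheck_of_constraints : ∀ x y : Fin 5, letterAdj x y → ∀ z, letterAdj y z →
    ∀ t, (letterAdj t z && letterAdj x t) → ∀ x', (letterAdj x x' && letterStar x y t x') →
    ∀ y', (letterAdj x' y' && letterAdj y y' && letterStar y x z y') →
    ∀ z', (letterAdj y' z' && letterAdj z z' && letterStar z t y z' && letterStar y' x' z' y) →
    ∀ t', (letterAdj t' z' && letterAdj t t' && letterAdj x' t' && letterStar t z x t' &&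
      letterStar x' y' t' x && letterStar z' t' y' z && letterStar t' z' x' t) →
    letterCheck x y z t x' y' z' t' := by
  decide

theorem letterCheck_of_letterCube {x : Bool → Bool → Bool → Fin 5} (h : letterCube x) :
    letterCheck (x false false false) (x true false false) (x true true false)
      (x false true false) (x false false true) (x true false true) (x true true true)
      (x false true true) := by
  obtain ⟨h1, h2, h3, h4⟩ := h
  refine letterCheck_of_constraints _ _ (h1 _ _) _ (h2 _ _) _ ?_ _ ?_ _ ?_ _ ?_ _ ?_ <;>
    simp only [Bool.and_eq_true]
  · exact ⟨h1 _ _, h2 _ _⟩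
  · exact ⟨h3 _ _, h4 false false false⟩
  · exact ⟨⟨h1 _ _, h3 _ _⟩, h4 true false false⟩
  · exact ⟨⟨⟨h2 _ _, h3 _ _⟩, h4 true true false⟩, h4 true false true⟩
  · exact ⟨⟨⟨⟨⟨⟨h1 _ _, h3 _ _⟩, h2 _ _⟩, h4 false true false⟩, h4 false false true⟩,
      h4 true true true⟩, h4 false true true⟩

theorem letterSign_ne_zero : ∀ p q r s : Fin 5, letterSign p q r s ≠ 0 →
    p ≠ 4 ∧ q ≠ 4 ∧ r ≠ 4 ∧ s ≠ 4 ∧ p ≠ q ∧ p ≠ r ∧ p ≠ s ∧ q ≠ r ∧ q ≠ s ∧ r ≠ s := by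
  decide

theorem letterSign_ne_zero_of_injective : ∀ p q r s : Fin 5,
    p ≠ 4 ∧ q ≠ 4 ∧ r ≠ 4 ∧ s ≠ 4 ∧ p ≠ q ∧ p ≠ r ∧ p ≠ s ∧ q ≠ r ∧ q ≠ s ∧ r ≠ s →
    letterAdj p q → letterAdj q r → letterAdj r s → letterAdj s p → letterSign p q r s ≠ 0 := by
  decide

theorem letterSign_degenerate : ∀ p q : Fin 5,
    letterSign p p q q = 0 ∧ letterSign p q q p = 0 := by
  decide

theorem exists_letter_eq : ∀ p q r s l : Fin 5, letterSign p q r s ≠ 0 → l ≠ 4 →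
    p = l ∨ q = l ∨ r = l ∨ s = l := by
  decide

end Letters

/-! ### The Greene sphere graph -/

section Greene

open scoped Fin.CommRing

variable {n : ℕ} [hn : Fact (4 ≤ n)]

instance neZero_of_four_le : NeZero n := ⟨fun h => by have := hn.out; omega⟩

/-- The parity of a vertex of the cycle. -/
def par (i : Fin (2 * n)) : Bool := decide (Odd i.val)

theorem natCast_fin_ne_zero {k : ℕ} (h0 : 0 < k) (h8 : k < 8) : (k : Fin (2 * n)) ≠ 0 := by
  intro h
  have h1 := congrArg Fin.val h
  have h4 := hn.out
  rw [Fin.val_natCast, Nat.mod_eq_of_lt (by omega)] at h1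
  simp at h1
  omega

/-- The nonvanishing of `6` is the one that fails for `n = 3`. -/
theorem fin_ne (n : ℕ) [Fact (4 ≤ n)] : (1 : Fin (2 * n)) ≠ 0 ∧ (2 : Fin (2 * n)) ≠ 0 ∧
    (3 : Fin (2 * n)) ≠ 0 ∧ (4 : Fin (2 * n)) ≠ 0 ∧ (5 : Fin (2 * n)) ≠ 0 ∧
    (6 : Fin (2 * n)) ≠ 0 := by
  have h := fun k => natCast_fin_ne_zero (n := n) (k := k)
  exact ⟨by exact_mod_cast h 1 (by simp) (by simp), by simpa using h 2 (by simp) (by simp),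
    by simpa using h 3 (by simp) (by simp), by simpa using h 4 (by simp) (by simp),
    by simpa using h 5 (by simp) (by simp), by simpa using h 6 (by simp) (by simp)⟩

theorem par_add_one (i : Fin (2 * n)) : par (i + 1) = !par i := by
  have h4 := hn.out
  have hi := i.isLt
  have h1 : ((1 : Fin (2 * n)) : ℕ) = 1 := by
    rw [Fin.val_one', Nat.mod_eq_of_lt (by omega)]
  simp only [par, Fin.val_add, h1]
  by_cases h : i.val + 1 < 2 * n
  · rw [Nat.mod_eq_of_lt h]
    simp [Nat.odd_add_one, -Nat.not_odd_iff_even]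
  · have e : i.val + 1 = 2 * n := by omega
    rw [e, Nat.mod_self]
    have : Odd i.val := ⟨n - 1, by omega⟩
    simp [this]

theorem par_sub_one (i : Fin (2 * n)) : par (i - 1) = !par i := by
  have := par_add_one (i - 1)
  rw [sub_add_cancel] at this
  rw [this, Bool.not_not]

theorem greene_adj_inl (i j : Fin (2 * n)) :
    (greeneSphere n).Adj (Sum.inl i) (Sum.inl j) ↔ j = i + 1 ∨ j = i - 1 := by
  have h4 := hn.out
  change (SimpleGraph.cycleGraph (2 * n)).Adj i j ↔ _
  rw [SimpleGraph.cycleGraph_adj']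
  have h1 : ((1 : Fin (2 * n)) : ℕ) = 1 := by
    rw [Fin.val_one', Nat.mod_eq_of_lt (by omega)]
  have key : ∀ a b : Fin (2 * n), (a - b).val = 1 ↔ a = b + 1 := fun a b => by
    exact ((iff_of_eq (congrArg ((a - b).val = ·) h1.symm)).trans Fin.val_inj).trans
      (by rw [sub_eq_iff_eq_add, add_comm])
  rw [key, key, or_comm, eq_sub_iff_add_eq, eq_comm (a := i)]

end Greene

section

variable {n : ℕ}

theorem greene_adj_inl_inr (i : Fin (2 * n)) (w : Bool) :
    (greeneSphere n).Adj (Sum.inl i) (Sum.inr w) ↔ par i = w := by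
  change (if w then Odd i.val else Even i.val) ↔ _
  cases w <;> simp [par]

theorem greene_adj_inr_inl (i : Fin (2 * n)) (w : Bool) :
    (greeneSphere n).Adj (Sum.inr w) (Sum.inl i) ↔ par i = w := by
  rw [SimpleGraph.adj_comm, greene_adj_inl_inr]

theorem greene_not_adj_inr (w w' : Bool) :
    ¬ (greeneSphere n).Adj (Sum.inr w) (Sum.inr w') := fun h => h

end

section Greene

open scoped Fin.CommRing

variable {n : ℕ} [hn : Fact (4 ≤ n)]

/-- The bipartition of the Greene sphere graph. -/
def greeneColoring (n : ℕ) [Fact (4 ≤ n)] : (greeneSphere n).Coloring Bool :=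
  SimpleGraph.Coloring.mk (fun v => Sum.elim par (fun w => !w) v) (by
    rintro (i | w) (j | w') h
    · rcases (greene_adj_inl i j).1 h with rfl | rfl
      · simp [par_add_one]
      · simp [par_sub_one]
    · have := (greene_adj_inl_inr i w').1 h
      simp [this]
    · have := (greene_adj_inr_inl j w).1 h
      simp [this]
    · exact h.elim)

/-- No two distinct vertices have three common neighbours. -/
theorem greene_common_neighbors {p q x y z : Fin (2 * n) ⊕ Bool} (hpq : p ≠ q)
    (hpx : (greeneSphere n).Adj p x) (hqx : (greeneSphere n).Adj q x)
    (hpy : (greeneSphere n).Adj p y) (hqy : (greeneSphere n).Adj q y)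
    (hpz : (greeneSphere n).Adj p z) (hqz : (greeneSphere n).Adj q z)
    (hxy : x ≠ y) (hxz : x ≠ z) (hyz : y ≠ z) : False := by
  -- Cycle vertices at distance two share the vertex between them and a hub; a cycle vertex and the
  -- hub not adjacent to it share its two cycle neighbours. All other pairs share at most one
  -- vertex.
  obtain ⟨h1, h2, h3, h4, h5, h6⟩ := fin_ne n
  rcases p with i | w <;> rcases q with j | w' <;> rcases x with x | x <;> rcases y with y | y <;>
    rcases z with z | z <;>
    simp only [greene_adj_inl, greene_adj_inl_inr, greene_adj_inr_inl, greene_not_adj_inr,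
      Sum.inl.injEq, Sum.inr.injEq, ne_eq] at * <;> grind

theorem greene_adj_inl_iff (i : Fin (2 * n)) (x : Fin (2 * n) ⊕ Bool) :
    (greeneSphere n).Adj (Sum.inl i) x ↔
      x = Sum.inl (i + 1) ∨ x = Sum.inl (i - 1) ∨ x = Sum.inr (par i) := by
  rcases x with x | x
  · simp [greene_adj_inl]
  · simp [greene_adj_inl_inr, eq_comm]

theorem greene_adj_inr_iff (w : Bool) (x : Fin (2 * n) ⊕ Bool) :
    (greeneSphere n).Adj (Sum.inr w) x ↔ ∃ i, x = Sum.inl i ∧ par i = w := by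
  rcases x with x | x
  · simp [greene_adj_inr_inl]
  · simp [greene_not_adj_inr]

theorem greene_opposite_center {i : Fin (2 * n)} {x : Fin (2 * n) ⊕ Bool}
    (h1 : (greeneSphere n).Adj (Sum.inl (i + 1)) x) (h2 : (greeneSphere n).Adj (Sum.inl (i - 1)) x)
    (h : x ≠ Sum.inl i) : x = Sum.inr (!par i) := by
  obtain ⟨e1, e2, e3, e4, e5, e6⟩ := fin_ne n
  rw [greene_adj_inl_iff, par_add_one, add_sub_cancel_right] at h1
  rw [greene_adj_inl_iff, sub_add_cancel] at h2
  rcases h1 with h1 | h1 | h1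
  · rcases h2 with h2 | h2 | h2
    · exact absurd h2 h
    · exact (e4 (by linear_combination Sum.inl_injective (h1.symm.trans h2))).elim
    · exact absurd (h1.symm.trans h2) Sum.inl_ne_inr
  · exact absurd h1 h
  · exact h1

theorem greene_opposite_right {i : Fin (2 * n)} {x : Fin (2 * n) ⊕ Bool}
    (h1 : (greeneSphere n).Adj (Sum.inl (i + 1)) x) (h2 : (greeneSphere n).Adj (Sum.inr (par i)) x)
    (h : x ≠ Sum.inl i) : x = Sum.inl (i + 2) := by
  rw [greene_adj_inl_iff, par_add_one] at h1
  rw [greene_adj_inr_iff] at h2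
  grind

theorem greene_opposite_left {i : Fin (2 * n)} {x : Fin (2 * n) ⊕ Bool}
    (h1 : (greeneSphere n).Adj (Sum.inl (i - 1)) x) (h2 : (greeneSphere n).Adj (Sum.inr (par i)) x)
    (h : x ≠ Sum.inl i) : x = Sum.inl (i - 2) := by
  rw [greene_adj_inl_iff, par_sub_one] at h1
  rw [greene_adj_inr_iff] at h2
  grind

/-- The second common neighbours of `i + 1`, `i - 1` and the hub are forced to be the other hub, `i
+ 2` and `i - 2`. The last vertex `t` is then a cycle vertex next to both `i + 2` and `i - 2`, so
`2`, `4` or `6` is zero modulo `2n`. -/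
theorem greene_no_corner_aux {xy xz yz t : Fin (2 * n) ⊕ Bool} (i : Fin (2 * n))
    {x y z : Fin (2 * n) ⊕ Bool}
    (hx : x = Sum.inl (i + 1)) (hy : y = Sum.inl (i - 1)) (hz : z = Sum.inr (par i))
    (h1 : (greeneSphere n).Adj x xy) (h2 : (greeneSphere n).Adj y xy) (h1p : xy ≠ Sum.inl i)
    (h3 : (greeneSphere n).Adj x xz) (h4 : (greeneSphere n).Adj z xz) (h3p : xz ≠ Sum.inl i)
    (h5 : (greeneSphere n).Adj y yz) (h6 : (greeneSphere n).Adj z yz) (h5p : yz ≠ Sum.inl i)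
    (h7 : (greeneSphere n).Adj xy t) (h8 : (greeneSphere n).Adj xz t)
    (h9 : (greeneSphere n).Adj yz t) : False := by
  subst hx hy hz
  obtain ⟨e1, e2, e3, e4, e5, e6⟩ := fin_ne n
  obtain rfl := greene_opposite_center h1 h2 h1p
  obtain rfl := greene_opposite_right h3 h4 h3p
  obtain rfl := greene_opposite_left h5 h6 h5p
  rw [greene_adj_inr_iff] at h7
  obtain ⟨k, rfl, -⟩ := h7
  rw [greene_adj_inl] at h8 h9
  rcases h8 with h8 | h8 <;> rcases h9 with h9 | h9
  · exact e4 (by linear_combination h9 - h8)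
  · exact e6 (by linear_combination h9 - h8)
  · exact e2 (by linear_combination h9 - h8)
  · exact e4 (by linear_combination h9 - h8)

/-- There is no corner of an injective three-dimensional cube at a vertex of the cycle. -/
theorem greene_no_corner {x y z xy xz yz t : Fin (2 * n) ⊕ Bool} (i : Fin (2 * n))
    (hx : (greeneSphere n).Adj (Sum.inl i) x) (hy : (greeneSphere n).Adj (Sum.inl i) y)
    (hz : (greeneSphere n).Adj (Sum.inl i) z)
    (hxy : x ≠ y) (hxz : x ≠ z) (hyz : y ≠ z)
    (h1 : (greeneSphere n).Adj x xy) (h2 : (greeneSphere n).Adj y xy) (h1p : xy ≠ Sum.inl i)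
    (h3 : (greeneSphere n).Adj x xz) (h4 : (greeneSphere n).Adj z xz) (h3p : xz ≠ Sum.inl i)
    (h5 : (greeneSphere n).Adj y yz) (h6 : (greeneSphere n).Adj z yz) (h5p : yz ≠ Sum.inl i)
    (h7 : (greeneSphere n).Adj xy t) (h8 : (greeneSphere n).Adj xz t)
    (h9 : (greeneSphere n).Adj yz t) : False := by
  rw [greene_adj_inl_iff] at hx hy hz
  rcases hx with hx | hx | hx <;> rcases hy with hy | hy | hy <;>
    rcases hz with hz | hz | hz <;>
    first
    | exact hxy (hx.trans hy.symm)
    | exact hxz (hx.trans hz.symm)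
    | exact hyz (hy.trans hz.symm)
    | exact greene_no_corner_aux i hx hy hz h1 h2 h1p h3 h4 h3p h5 h6 h5p h7 h8 h9
    | exact greene_no_corner_aux i hy hx hz h2 h1 h1p h5 h6 h5p h3 h4 h3p h7 h9 h8
    | exact greene_no_corner_aux i hx hz hy h3 h4 h3p h1 h2 h1p h6 h5 h5p h8 h7 h9
    | exact greene_no_corner_aux i hz hx hy h4 h3 h3p h6 h5 h5p h1 h2 h1p h8 h9 h7
    | exact greene_no_corner_aux i hy hz hx h5 h6 h5p h2 h1 h1p h4 h3 h3p h9 h7 h8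
    | exact greene_no_corner_aux i hz hy hx h6 h5 h5p h4 h3 h3p h2 h1 h1p h9 h8 h7

/-- The vertex of the cube of dimension three with given coordinates. -/
def vec3 (i j k : Bool) : Fin 3 → Bool := ![i, j, k]

theorem vec3_adj (i j k : Bool) : (cubeGraph 3).Adj (vec3 i j k) (vec3 (!i) j k) ∧
    (cubeGraph 3).Adj (vec3 i j k) (vec3 i (!j) k) ∧
    (cubeGraph 3).Adj (vec3 i j k) (vec3 i j (!k)) := by
  refine ⟨⟨0, ?_, ?_⟩, ⟨1, ?_, ?_⟩, ⟨2, ?_, ?_⟩⟩ <;> revert i j k <;> decide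

theorem vec3_injective {i j k i' j' k' : Bool} (h : vec3 i j k = vec3 i' j' k') :
    i = i' ∧ j = j' ∧ k = k' :=
  ⟨congrFun h 0, congrFun h 1, congrFun h 2⟩

theorem greene_not_injective_three (σ : SingCube (greeneSphere n) 3) :
    ¬ Function.Injective σ := by
  intro h
  have hne : ∀ {i j k i' j' k'}, (i, j, k) ≠ (i', j', k') →
      σ (vec3 i j k) ≠ σ (vec3 i' j' k') := by
    intro i j k i' j' k' hd e
    obtain ⟨rfl, rfl, rfl⟩ := vec3_injective (h e)
    exact hd rfl
  have adj : ∀ x y, (cubeGraph 3).Adj x y → (greeneSphere n).Adj (σ x) (σ y) := fun x y hxy =>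
    (σ.map_adj hxy).resolve_left fun e => hxy.ne (h e)
  have a1 := fun i j k => adj _ _ (vec3_adj i j k).1
  have a2 := fun i j k => adj _ _ (vec3_adj i j k).2.1
  have a3 := fun i j k => adj _ _ (vec3_adj i j k).2.2
  have main : ∀ a b c : Bool, ∀ i, σ (vec3 a b c) = Sum.inl i → False := by
    intro a b c i hi
    refine greene_no_corner i (hi ▸ a1 a b c) (hi ▸ a2 a b c) (hi ▸ a3 a b c)
      (hne (by simp)) (hne (by simp)) (hne (by simp))
      (a2 (!a) b c) (a1 a (!b) c) (hi ▸ hne (by simp))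
      (a3 (!a) b c) (a1 a b (!c)) (hi ▸ hne (by simp))
      (a3 a (!b) c) (a2 a b (!c)) (hi ▸ hne (by simp))
      (a3 (!a) (!b) c) (a2 (!a) b (!c)) (a1 a (!b) (!c))
  -- Hubs have only cycle vertices as neighbours, so some corner of the cube lies on the cycle.
  cases h0 : σ (vec3 false false false) with
  | inl i => exact main _ _ _ i h0
  | inr w =>
    have := a1 false false false
    rw [h0, greene_adj_inr_iff] at this
    obtain ⟨i, hi, -⟩ := this
    exact main _ _ _ i hi

/-- Injective cubes have dimension at most two. -/
theorem greene_le_two_of_injective {m : ℕ} (σ : SingCube (greeneSphere n) m)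
    (h : Function.Injective σ) : m ≤ 2 := by
  by_contra hm
  have key : ∀ k : ℕ, InjCube (greeneSphere n) (3 + k) → False := by
    intro k
    induction k with
    | zero => exact fun σ => greene_not_injective_three σ.1 σ.2
    | succ k ih => exact fun σ => ih (σ.face 0 false)
  obtain ⟨k, rfl⟩ := Nat.exists_eq_add_of_le (show 3 ≤ m by omega)
  exact key k ⟨σ, h⟩

end Greene

/-- A face on which a cube is injective, as an injective cube. -/
theorem exists_injective_of_injOn_subface {V : Type u} {G : SimpleGraph V} {m : ℕ}
    (σ : SingCube G m) (S : Finset (Fin m)) (b : Fin m → Bool)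
    (h : Set.InjOn σ (SingCube.subface S b)) :
    ∃ τ : SingCube G S.card, Function.Injective τ := by
  let e := S.equivFin
  let ι : (Fin S.card → Bool) → (Fin m → Bool) := fun x i =>
    if hi : i ∈ S then x (e ⟨i, hi⟩) else b i
  have hι : ∀ x j, ι x (e.symm j) = x j := fun x j => by
    simp [ι]
  refine ⟨⟨fun x => σ (ι x), ?_⟩, ?_⟩
  · intro x y hxy
    apply σ.map_adj
    obtain ⟨i, hi, hu⟩ := hxy
    refine ⟨e.symm i, by simpa only [hι] using hi, fun k hk => ?_⟩
    by_cases hkS : k ∈ S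
    · simp only [ι, dif_pos hkS] at hk
      rw [← hu _ hk, Equiv.symm_apply_apply]
    · simp [ι, hkS] at hk
  · intro x y hxy
    have hmem : ∀ x, ι x ∈ SingCube.subface S b := fun x i hi => dif_neg hi
    have := h (hmem x) (hmem y) hxy
    funext j
    rw [← hι x j, ← hι y j, this]

section Greene

variable {n : ℕ} [hn : Fact (4 ≤ n)]

theorem greene_degree_le {m : ℕ} (σ : SingCube (greeneSphere n) m) : σ.degree ≤ 2 := by
  rw [SingCube.degree_le_iff]
  intro S b h
  obtain ⟨τ, hτ⟩ := exists_injective_of_injOn_subface σ S b h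
  exact greene_le_two_of_injective τ hτ

end Greene

/-! ### Squares in bipartite graphs without three-dimensional cubes -/

/-- The vertex of the square with given coordinates. -/
def vec2 (i j : Bool) : Fin 2 → Bool := ![i, j]

/-- The vertex of the interval with given coordinate. -/
def vec1 (i : Bool) : Fin 1 → Bool := ![i]

theorem vec2_eta (x : Fin 2 → Bool) : x = vec2 (x 0) (x 1) := by
  funext k; fin_cases k <;> rfl

theorem vec1_eta (x : Fin 1 → Bool) : x = vec1 (x 0) := by
  funext k; fin_cases k; rfl

theorem vec3_eta (x : Fin 3 → Bool) : x = vec3 (x 0) (x 1) (x 2) := by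
  funext k; fin_cases k <;> rfl

theorem vec2_adj (i j : Bool) : (cubeGraph 2).Adj (vec2 i j) (vec2 (!i) j) ∧
    (cubeGraph 2).Adj (vec2 i j) (vec2 i (!j)) := by
  refine ⟨⟨0, ?_, ?_⟩, ⟨1, ?_, ?_⟩⟩ <;> revert i j <;> decide

theorem vec1_adj (i : Bool) : (cubeGraph 1).Adj (vec1 i) (vec1 (!i)) := by
  refine ⟨0, ?_, ?_⟩ <;> revert i <;> decide

section Faces

variable {V : Type u} {G : SimpleGraph V}

theorem face_zero_vec3 (σ : SingCube G 3) (ε i j : Bool) :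
    σ.face 0 ε (vec2 i j) = σ (vec3 ε i j) := by
  rw [SingCube.face_apply]; congr 1; funext k; fin_cases k <;> rfl

theorem face_one_vec3 (σ : SingCube G 3) (ε i j : Bool) :
    σ.face 1 ε (vec2 i j) = σ (vec3 i ε j) := by
  rw [SingCube.face_apply]; congr 1; funext k; fin_cases k <;> rfl

theorem face_two_vec3 (σ : SingCube G 3) (ε i j : Bool) :
    σ.face 2 ε (vec2 i j) = σ (vec3 i j ε) := by
  rw [SingCube.face_apply]; congr 1; funext k; fin_cases k <;> rfl

theorem face_zero_vec2 (σ : SingCube G 2) (ε i : Bool) :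
    σ.face 0 ε (vec1 i) = σ (vec2 ε i) := by
  rw [SingCube.face_apply]; congr 1; funext k; fin_cases k <;> rfl

theorem face_one_vec2 (σ : SingCube G 2) (ε i : Bool) :
    σ.face 1 ε (vec1 i) = σ (vec2 i ε) := by
  rw [SingCube.face_apply]; congr 1; funext k; fin_cases k <;> rfl

theorem singCube_two_ext {σ τ : SingCube G 2} (h : ∀ i j, σ (vec2 i j) = τ (vec2 i j)) : σ = τ :=
  DFunLike.ext _ _ fun x => by rw [vec2_eta x]; exact h _ _

theorem singCube_one_ext {σ τ : SingCube G 1} (h : ∀ i, σ (vec1 i) = τ (vec1 i)) : σ = τ :=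
  DFunLike.ext _ _ fun x => by rw [vec1_eta x]; exact h _

theorem normBoundary_two (σ : SingCube G 2) : normBoundary G 1 (cubeClass G σ) =
    -(cubeClass G (σ.face 0 false) - cubeClass G (σ.face 0 true)) +
      (cubeClass G (σ.face 1 false) - cubeClass G (σ.face 1 true)) := by
  rw [normBoundary_cubeClass, Fin.sum_univ_two]
  simp

theorem normBoundary_three (σ : SingCube G 3) : normBoundary G 2 (cubeClass G σ) =
    -(cubeClass G (σ.face 0 false) - cubeClass G (σ.face 0 true)) +
      (cubeClass G (σ.face 1 false) - cubeClass G (σ.face 1 true)) -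
      (cubeClass G (σ.face 2 false) - cubeClass G (σ.face 2 true)) := by
  rw [normBoundary_cubeClass, Fin.sum_univ_three]
  simp
  abel

end Faces

section Square

variable {V : Type u} {G : SimpleGraph V}

/-- The conditions on a bipartite graph that make its squares behave like cells: two vertices have
at most two common neighbours, and there are no injective three-dimensional cubes. -/
structure SquareRigid (G : SimpleGraph V) where
  /-- A bipartition. -/
  coloring : G.Coloring Bool
  common_neighbors : ∀ {p q x y z : V}, p ≠ q → G.Adj p x → G.Adj q x → G.Adj p y → G.Adj q y →
    G.Adj p z → G.Adj q z → x ≠ y → x ≠ z → y ≠ z → False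
  not_injective_three : ∀ σ : SingCube G 3, ¬ Function.Injective σ

theorem SquareRigid.not_triangle (R : SquareRigid G) {x y z : V} (h1 : G.Adj x y)
    (h2 : G.Adj y z) (h3 : G.Adj x z) : False := by
  have h1 := R.coloring.valid h1
  have h2 := R.coloring.valid h2
  have h3 := R.coloring.valid h3
  revert h1 h2 h3
  cases R.coloring x <;> cases R.coloring y <;> cases R.coloring z <;> simp

/-- A square: a closed walk of length four through four distinct vertices. -/
structure IsSquare4 (G : SimpleGraph V) (q : Fin 4 → V) : Prop where
  adj01 : G.Adj (q 0) (q 1)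
  adj12 : G.Adj (q 1) (q 2)
  adj23 : G.Adj (q 2) (q 3)
  adj30 : G.Adj (q 3) (q 0)
  ne02 : q 0 ≠ q 2
  ne13 : q 1 ≠ q 3

theorem IsSquare4.injective {q : Fin 4 → V} (h : IsSquare4 G q) : Function.Injective q := by
  have h1 := h.adj01.ne
  have h2 := h.adj12.ne
  have h3 := h.adj23.ne
  have h4 := h.adj30.ne
  have h5 := h.ne02
  have h6 := h.ne13
  intro i j hij
  fin_cases i <;> fin_cases j <;>
    first
    | rfl
    | exact absurd hij ‹_›
    | exact absurd hij.symm ‹_›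

open Classical in
/-- The letter of a vertex with respect to a square. -/
noncomputable def letter (q : Fin 4 → V) (v : V) : Fin 5 :=
  if h : ∃ i, q i = v then h.choose.castSucc else 4

theorem letter_self {q : Fin 4 → V} (h : IsSquare4 G q) (i : Fin 4) :
    letter q (q i) = i.castSucc := by
  have hi : ∃ j, q j = q i := ⟨i, rfl⟩
  rw [letter, dif_pos hi, h.injective hi.choose_spec]

theorem letter_eq_four_iff {q : Fin 4 → V} {v : V} : letter q v = 4 ↔ ∀ i, q i ≠ v := by
  rw [letter]
  split_ifs with h
  · refine iff_of_false (fun h4 => ?_) (by simpa using h)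
    have := congrArg Fin.val h4
    have := h.choose.isLt
    simp at *
    omega
  · simpa using h

theorem letter_injOn {q : Fin 4 → V} (h : IsSquare4 G q) {v w : V} (hv : letter q v ≠ 4)
    (e : letter q v = letter q w) : v = w := by
  have hw := e ▸ hv
  simp only [ne_eq, letter_eq_four_iff, not_forall, not_not] at hv hw
  obtain ⟨i, rfl⟩ := hv
  obtain ⟨j, rfl⟩ := hw
  rw [letter_self h, letter_self h] at e
  rw [Fin.castSucc_injective 4 e]

theorem IsSquare4.not_adj (R : SquareRigid G) {q : Fin 4 → V} (h : IsSquare4 G q) :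
    ¬ G.Adj (q 0) (q 2) ∧ ¬ G.Adj (q 1) (q 3) :=
  ⟨fun h' => R.not_triangle h.adj01 h.adj12 h', fun h' => R.not_triangle h.adj12 h.adj23 h'⟩

end Square

/-! ### Letters of singular 3-cubes and the cocycle of a square -/

section Square

variable {V : Type u} {G : SimpleGraph V}

theorem letterAdj_of_adj (R : SquareRigid G) {q : Fin 4 → V} (h : IsSquare4 G q) {v w : V}
    (hvw : v = w ∨ G.Adj v w) : letterAdj (letter q v) (letter q w) := by
  by_cases hv : letter q v = 4
  · simp [letterAdj, hv]
  by_cases hw : letter q w = 4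
  · simp [letterAdj, hw]
  simp only [letter_eq_four_iff, not_forall, not_not] at hv hw
  obtain ⟨i, rfl⟩ := hv
  obtain ⟨j, rfl⟩ := hw
  rw [letter_self h, letter_self h]
  obtain ⟨n1, n2⟩ := h.not_adj R
  have n3 := h.ne02
  have n4 := h.ne13
  fin_cases i <;> fin_cases j <;>
    first
    | decide
    | exact (hvw.elim n3 n1).elim
    | exact (hvw.elim n4 n2).elim
    | exact (hvw.elim (fun e => n3 e.symm) (fun e => n1 e.symm)).elim
    | exact (hvw.elim (fun e => n4 e.symm) (fun e => n2 e.symm)).elim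

/-- A vertex outside of a square has at most one neighbour in it. -/
theorem eq_of_adj_square (R : SquareRigid G) {q : Fin 4 → V} (h : IsSquare4 G q) {x : V}
    (hx : ∀ i, q i ≠ x) {i j : Fin 4} (hi : G.Adj x (q i)) (hj : G.Adj x (q j)) : i = j := by
  have a1 := h.adj01
  have a2 := h.adj12
  have a3 := h.adj23
  have a4 := h.adj30
  -- Opposite vertices of the square already have the other two as common neighbours, so `x` would
  -- be a third one; two consecutive vertices would form a triangle with `x`.
  have k1 : ¬ (G.Adj x (q 0) ∧ G.Adj x (q 2)) := fun hc =>
    R.common_neighbors h.ne02 a1 a2.symm a4.symm a3 hc.1.symm hc.2.symm h.ne13 (hx 1) (hx 3)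
  have k2 : ¬ (G.Adj x (q 1) ∧ G.Adj x (q 3)) := fun hc =>
    R.common_neighbors h.ne13 a1.symm a4 a2 a3.symm hc.1.symm hc.2.symm h.ne02 (hx 0) (hx 2)
  have k3 : ∀ {v w}, G.Adj x v → G.Adj x w → G.Adj v w → False := fun h1 h2 h3 =>
    R.not_triangle h1 h3 h2
  fin_cases i <;> fin_cases j <;>
    first
    | rfl
    | exact (k1 ⟨hi, hj⟩).elim
    | exact (k1 ⟨hj, hi⟩).elim
    | exact (k2 ⟨hi, hj⟩).elim
    | exact (k2 ⟨hj, hi⟩).elim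
    | exact (k3 hi hj ‹_›).elim
    | exact (k3 hj hi ‹_›).elim

theorem letterStar_of_adj (R : SquareRigid G) {q : Fin 4 → V} (h : IsSquare4 G q) {x a b c : V}
    (ha : x = a ∨ G.Adj x a) (hb : x = b ∨ G.Adj x b) (hc : x = c ∨ G.Adj x c) :
    letterStar (letter q x) (letter q a) (letter q b) (letter q c) := by
  by_cases hx : letter q x = 4
  swap
  · simp [letterStar, hx]
  have key : ∀ {v w}, (x = v ∨ G.Adj x v) → (x = w ∨ G.Adj x w) →
      letter q v = 4 ∨ letter q w = 4 ∨ letter q v = letter q w := by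
    intro v w hv hw
    by_contra! hne
    obtain ⟨h1, h2, h3⟩ := hne
    have hv' := hv.resolve_left fun e => h1 (e ▸ hx)
    have hw' := hw.resolve_left fun e => h2 (e ▸ hx)
    simp only [ne_eq, letter_eq_four_iff, not_forall, not_not] at h1 h2
    obtain ⟨i, rfl⟩ := h1
    obtain ⟨j, rfl⟩ := h2
    exact h3 (by rw [eq_of_adj_square R h (letter_eq_four_iff.1 hx) hv' hw'])
  have h1 := key ha hb
  have h2 := key ha hc
  have h3 := key hb hc
  simp only [letterStar, Bool.or_eq_true, Bool.and_eq_true, beq_iff_eq, or_assoc]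
  exact Or.inr ⟨⟨h1, h2⟩, h3⟩

theorem letterCube_of_singCube (R : SquareRigid G) {q : Fin 4 → V} (h : IsSquare4 G q)
    (σ : SingCube G 3) : letterCube fun i j k => letter q (σ (vec3 i j k)) := by
  refine ⟨fun i j => ?_, fun i j => ?_, fun i j => ?_, fun i j k => ?_⟩
  · exact letterAdj_of_adj R h (σ.map_adj (vec3_adj false i j).1)
  · exact letterAdj_of_adj R h (σ.map_adj (vec3_adj i false j).2.1)
  · exact letterAdj_of_adj R h (σ.map_adj (vec3_adj i j false).2.2)
  · exact letterStar_of_adj R h (σ.map_adj (vec3_adj i j k).1) (σ.map_adj (vec3_adj i j k).2.1)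
      (σ.map_adj (vec3_adj i j k).2.2)

/-- A face around the square cannot be opposite to a face avoiding the square. -/
theorem not_opposite (R : SquareRigid G) {q : Fin 4 → V} (h : IsSquare4 G q) (σ : SingCube G 3)
    (i : Fin 3) (ε : Bool) (h4 : ∀ x, x i = ε → letter q (σ x) = 4)
    (hne : ∀ x, x i = (!ε) → letter q (σ x) ≠ 4)
    (hinj : ∀ x y, x i = (!ε) → y i = (!ε) → letter q (σ x) = letter q (σ y) → x = y) : False := by
  -- The cube would be injective. Each vertex of the avoiding face is adjacent to the square vertex
  -- across from it, and an outside vertex has only one neighbour in the square; so equal vertices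
  -- in the avoiding face lie across from equal, hence identical, corners.
  refine R.not_injective_three σ fun x y hxy => ?_
  by_cases hx : x i = ε
  · by_cases hy : y i = ε
    swap
    · exact (hne y (Bool.eq_not.2 hy) (hxy ▸ h4 x hx)).elim
    have key : ∀ z : Fin 3 → Bool, z i = ε →
        ∃ j, σ (Function.update z i (!ε)) = q j ∧ G.Adj (σ z) (q j) := by
      intro z hz
      have hz' := hne (Function.update z i (!ε)) (by simp)
      have hadj : (cubeGraph 3).Adj z (Function.update z i (!ε)) := by
        conv => arg 2; rw [← Function.update_eq_self i z]
        exact cubeGraph_adj_update _ _ _ _ (by simp [hz])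
      rw [Ne, letter_eq_four_iff, not_forall] at hz'
      obtain ⟨j, hj⟩ := hz'
      rw [not_not] at hj
      refine ⟨j, hj.symm, ?_⟩
      rw [hj]
      refine (σ.map_adj hadj).resolve_left fun e => ?_
      exact letter_eq_four_iff.1 (h4 z hz) j (hj.trans e.symm)
    obtain ⟨j, hj, hxj⟩ := key x hx
    obtain ⟨k, hk, hyk⟩ := key y hy
    rw [← hxy] at hyk
    have hjk := eq_of_adj_square R h (letter_eq_four_iff.1 (h4 x hx)) hxj hyk
    have e := hinj _ _ (by simp) (by simp) (congrArg (letter q) (hj.trans (hjk ▸ hk.symm)))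
    funext m
    by_cases hm : m = i
    · rw [hm, hx, hy]
    · have := congrFun e m
      simpa [hm] using this
  · by_cases hy : y i = ε
    · exact (hne x (Bool.eq_not.2 hx) (hxy ▸ h4 y hy)).elim
    · exact hinj x y (Bool.eq_not.2 hx) (Bool.eq_not.2 hy) (congrArg _ hxy)

/-- Here `f a b c` parametrizes the cube with `c` in direction `i`, so one statement serves all
three directions, and the four values of `a, b` are listed in cyclic order around the face. -/
theorem letterOpposite_eq_false (R : SquareRigid G) {q : Fin 4 → V} (h : IsSquare4 G q)
    (σ : SingCube G 3) (i : Fin 3) (ε : Bool) (f : Bool → Bool → Bool → (Fin 3 → Bool))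
    (hf : ∀ x, ∃ a b, x = f a b (x i)) :
    letterOpposite (letter q (σ (f false false ε))) (letter q (σ (f true false ε)))
      (letter q (σ (f true true ε))) (letter q (σ (f false true ε)))
      (letter q (σ (f false false !ε))) (letter q (σ (f true false !ε)))
      (letter q (σ (f true true !ε))) (letter q (σ (f false true !ε))) = false := by
  rw [Bool.eq_false_iff]
  intro hc
  simp only [letterOpposite, Bool.and_eq_true, beq_iff_eq, bne_iff_ne] at hc
  obtain ⟨⟨⟨⟨h1, h2⟩, h3⟩, h4⟩, h5⟩ := hc
  obtain ⟨n1, n2, n3, n4, d1, d2, d3, d4, d5, d6⟩ := letterSign_ne_zero _ _ _ _ h5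
  refine not_opposite R h σ i ε ?_ ?_ ?_
  · intro x hx
    obtain ⟨a, b, e⟩ := hf x
    rw [hx] at e
    rw [e]
    cases a <;> cases b <;> assumption
  · intro x hx
    obtain ⟨a, b, e⟩ := hf x
    rw [hx] at e
    rw [e]
    cases a <;> cases b <;> assumption
  · intro x y hx hy
    obtain ⟨a, b, e⟩ := hf x
    obtain ⟨a', b', e'⟩ := hf y
    rw [hx] at e
    rw [hy] at e'
    rw [e, e']
    intro hl
    cases a <;> cases b <;> cases a' <;> cases b' <;>
      first
      | rfl
      | exact absurd hl ‹_›
      | exact absurd hl.symm ‹_›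

/-- The orientation of a singular 2-cube with respect to a square. -/
noncomputable def squareSign (q : Fin 4 → V) (σ : SingCube G 2) : ℤ :=
  letterSign (letter q (σ (vec2 false false))) (letter q (σ (vec2 true false)))
    (letter q (σ (vec2 true true))) (letter q (σ (vec2 false true)))

/-- Once `not_opposite` removes the exceptional labellings, this is the finite check `letterCheck`.
The first part makes the orientation a cocycle; the second, that the number of faces around the
square is not one, gives monophobicity. -/
theorem squareSign_faces (R : SquareRigid G) {q : Fin 4 → V} (h : IsSquare4 G q)
    (σ : SingCube G 3) :
    (squareSign q (σ.face 0 false) - squareSign q (σ.face 0 true)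
      - (squareSign q (σ.face 1 false) - squareSign q (σ.face 1 true))
      + (squareSign q (σ.face 2 false) - squareSign q (σ.face 2 true)) = 0) ∧
    (squareSign q (σ.face 0 false)).natAbs + (squareSign q (σ.face 0 true)).natAbs +
      (squareSign q (σ.face 1 false)).natAbs + (squareSign q (σ.face 1 true)).natAbs +
      (squareSign q (σ.face 2 false)).natAbs + (squareSign q (σ.face 2 true)).natAbs ≠ 1 := by
  have hc := letterCheck_of_letterCube (letterCube_of_singCube R h σ)
  have f0 := fun ε => letterOpposite_eq_false R h σ 0 ε (fun a b c => vec3 c a b)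
    (fun x => ⟨_, _, vec3_eta x⟩)
  have f1 := fun ε => letterOpposite_eq_false R h σ 1 ε (fun a b c => vec3 a c b)
    (fun x => ⟨_, _, vec3_eta x⟩)
  have f2 := fun ε => letterOpposite_eq_false R h σ 2 ε (fun a b c => vec3 a b c)
    (fun x => ⟨_, _, vec3_eta x⟩)
  have f0f := f0 false
  have f0t := f0 true
  have f1f := f1 false
  have f1t := f1 true
  have f2f := f2 false
  have f2t := f2 true
  simp only [Bool.not_false, Bool.not_true] at f0f f0t f1f f1t f2f f2t
  simp only [letterCheck, f0f, f0t, f1f, f1t, f2f, f2t, Bool.false_or, Bool.and_eq_true,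
    beq_iff_eq, bne_iff_ne] at hc
  simp only [squareSign, face_zero_vec3, face_one_vec3, face_two_vec3]
  exact hc

theorem squareSign_degenerate {q : Fin 4 → V} (σ : SingCube G 2) (hσ : σ.IsDegenerate) :
    squareSign q σ = 0 := by
  obtain ⟨i, hi⟩ := hσ
  fin_cases i
  · have h1 : ∀ b, σ (vec2 true b) = σ (vec2 false b) := fun b => by
      have := (hi (vec2 false b)).symm
      convert this using 2 <;> funext k <;> fin_cases k <;> rfl
    rw [squareSign, h1, h1]
    exact (letterSign_degenerate _ _).1
  · have h1 : ∀ b, σ (vec2 b true) = σ (vec2 b false) := fun b => by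
      have := (hi (vec2 b false)).symm
      convert this using 2 <;> funext k <;> fin_cases k <;> rfl
    rw [squareSign, h1, h1]
    exact (letterSign_degenerate _ _).2

/-- The coefficient of a square in a chain. -/
noncomputable def squareCoeff (q : Fin 4 → V) : NormChains G 2 →ₗ[ℤ] ℤ :=
  chainLift (squareSign q) fun σ hσ => squareSign_degenerate σ hσ

theorem squareCoeff_boundary (R : SquareRigid G) {q : Fin 4 → V} (h : IsSquare4 G q)
    (w : NormChains G 3) : squareCoeff q (normBoundary G 2 w) = 0 := by
  have : w ∈ (⊤ : Submodule ℤ (NormChains G 3)) := trivial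
  rw [← cubeClass_span] at this
  induction this using Submodule.span_induction with
  | mem x hx =>
    obtain ⟨σ, rfl⟩ := hx
    rw [normBoundary_three]
    simp only [map_sub, map_add, map_neg, squareCoeff, chainLift_cubeClass]
    linear_combination -(squareSign_faces R h σ).1
  | zero => simp
  | add x y _ _ hx hy => rw [map_add, map_add, hx, hy, add_zero]
  | smul a x _ hx => rw [map_smul, map_smul, hx, smul_zero]

end Square

/-! ### Monophobicity -/

section Rigid

variable {V : Type u} {G : SimpleGraph V}

theorem exists_singCube_of_isCube {n : ℕ} {Q : G.Subgraph} (hQ : IsCube n Q) :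
    ∃ σ : SingCube G n, Function.Injective σ ∧ σ.image = Q := by
  obtain ⟨e⟩ := hQ
  have hadj : ∀ {x y}, (cubeGraph n).Adj x y → Q.Adj (e.symm x).1 (e.symm y).1 := fun h =>
    e.symm.map_adj_iff.2 h
  refine ⟨⟨fun x => (e.symm x).1, fun x y h => Or.inr (Q.adj_sub (hadj h))⟩, ?_, ?_⟩
  · intro x y h
    exact e.symm.injective (Subtype.ext h)
  · refine SimpleGraph.Subgraph.ext ?_ ?_
    · ext v
      constructor
      · rintro ⟨x, rfl⟩
        exact (e.symm x).2
      · intro hv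
        exact ⟨e ⟨v, hv⟩, congrArg Subtype.val (e.symm_apply_apply ⟨v, hv⟩)⟩
    · funext a b
      refine propext ⟨?_, fun h => ⟨Q.adj_sub h, ?_⟩⟩
      · rintro ⟨-, x, y, h, rfl, rfl⟩
        exact hadj h
      · refine ⟨e ⟨a, Q.edge_vert h⟩, e ⟨b, Q.edge_vert h.symm⟩, e.map_adj_iff.2 h, ?_, ?_⟩
        · exact congrArg Subtype.val (e.symm_apply_apply _)
        · exact congrArg Subtype.val (e.symm_apply_apply _)

theorem image_isInduced {n : ℕ} {σ : SingCube G n}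
    (h : ∀ x y, G.Adj (σ x) (σ y) → (cubeGraph n).Adj x y) : σ.image.IsInduced := by
  rintro _ ⟨x, rfl⟩ _ ⟨y, rfl⟩ hxy
  exact ⟨hxy, x, y, h x y hxy, rfl, rfl⟩

theorem subgraph_ext_of_isInduced {Q Q' : G.Subgraph} (h : Q.IsInduced) (h' : Q'.IsInduced)
    (e : Q.verts = Q'.verts) : Q = Q' := by
  refine SimpleGraph.Subgraph.ext e ?_
  funext a b
  refine propext ⟨fun hab => ?_, fun hab => ?_⟩
  · exact h' (e ▸ Q.edge_vert hab) (e ▸ Q.edge_vert hab.symm) (Q.adj_sub hab)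
  · exact h (e ▸ Q'.edge_vert hab) (e ▸ Q'.edge_vert hab.symm) (Q'.adj_sub hab)

theorem SquareRigid.cubeGraph_adj_of_adj (R : SquareRigid G) {σ : SingCube G 2}
    (hσ : Function.Injective σ) (x y : Fin 2 → Bool) (h : G.Adj (σ x) (σ y)) :
    (cubeGraph 2).Adj x y := by
  have adj : ∀ x y, (cubeGraph 2).Adj x y → G.Adj (σ x) (σ y) := fun x y hxy =>
    (σ.map_adj hxy).resolve_left fun e => hxy.ne (hσ e)
  rw [vec2_eta x, vec2_eta y] at h ⊢
  generalize x 0 = a at *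
  generalize x 1 = b at *
  by_cases ha : y 0 = a <;> by_cases hb : y 1 = b
  · rw [ha, hb] at h
    exact h.ne rfl |>.elim
  · rw [ha, Bool.eq_not.2 hb]
    exact (vec2_adj a b).2
  · rw [hb, Bool.eq_not.2 ha]
    exact (vec2_adj a b).1
  · rw [Bool.eq_not.2 ha, Bool.eq_not.2 hb] at h
    exact (R.not_triangle (adj _ _ (vec2_adj a b).1) (adj _ _ (vec2_adj (!a) b).2) h).elim

/-- The vertices of a singular 2-cube in cyclic order. -/
def squareOf (σ : SingCube G 2) : Fin 4 → V :=
  ![σ (vec2 false false), σ (vec2 true false), σ (vec2 true true), σ (vec2 false true)]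

theorem range_squareOf (σ : SingCube G 2) : Set.range (squareOf σ) = Set.range σ := by
  ext v
  constructor
  · rintro ⟨i, rfl⟩
    fin_cases i <;> exact ⟨_, rfl⟩
  · rintro ⟨x, rfl⟩
    rw [vec2_eta x]
    cases x 0 <;> cases x 1
    exacts [⟨0, rfl⟩, ⟨3, rfl⟩, ⟨1, rfl⟩, ⟨2, rfl⟩]

theorem vec2_ne {i j i' j' : Bool} (h : (i, j) ≠ (i', j')) : vec2 i j ≠ vec2 i' j' :=
  fun e => h (Prod.ext (congrFun e 0) (congrFun e 1))

theorem isSquare4_squareOf {σ : SingCube G 2} (hσ : Function.Injective σ) :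
    IsSquare4 G (squareOf σ) := by
  have adj : ∀ x y, (cubeGraph 2).Adj x y → G.Adj (σ x) (σ y) := fun x y hxy =>
    (σ.map_adj hxy).resolve_left fun e => hxy.ne (hσ e)
  exact ⟨adj _ _ (vec2_adj false false).1, adj _ _ (vec2_adj true false).2,
    adj _ _ (vec2_adj true true).1, adj _ _ (vec2_adj false true).2,
    hσ.ne (vec2_ne (by simp)), hσ.ne (vec2_ne (by simp))⟩

/-- A walk around four distinct corners in which no step joins opposite corners must go around the
square in one of the two directions. -/
theorem squareSign_ne_zero_iff (R : SquareRigid G) {q : Fin 4 → V} (h : IsSquare4 G q)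
    (σ : SingCube G 2) :
    squareSign q σ ≠ 0 ↔ Function.Injective σ ∧ Set.range σ = Set.range q := by
  constructor
  · intro hs
    have hs' := hs
    obtain ⟨n1, n2, n3, n4, d1, d2, d3, d4, d5, d6⟩ := letterSign_ne_zero _ _ _ _ hs
    constructor
    · intro x y e
      rw [vec2_eta x, vec2_eta y] at e ⊢
      have e' := congrArg (letter q) e
      generalize x 0 = a at *
      generalize x 1 = b at *
      generalize y 0 = c at *
      generalize y 1 = d at *
      cases a <;> cases b <;> cases c <;> cases d <;>
        first
        | rfl
        | exact absurd e' ‹_›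
        | exact absurd e'.symm ‹_›
    · refine Set.Subset.antisymm ?_ ?_
      · rintro _ ⟨x, rfl⟩
        have : letter q (σ x) ≠ 4 := by
          rw [vec2_eta x]
          cases x 0 <;> cases x 1 <;> assumption
        rw [Ne, letter_eq_four_iff, not_forall] at this
        obtain ⟨i, hi⟩ := this
        exact ⟨i, not_not.1 hi⟩
      · rintro _ ⟨i, rfl⟩
        have hi : letter q (q i) ≠ 4 := by
          rw [Ne, letter_eq_four_iff]
          exact fun hc => hc i rfl
        rcases exists_letter_eq _ _ _ _ _ hs' hi with e | e | e | e <;>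
          exact ⟨_, (letter_injOn h hi e.symm).symm⟩
  · rintro ⟨hσ, hr⟩
    have hl : ∀ x, letter q (σ x) ≠ 4 := fun x => by
      have : σ x ∈ Set.range q := hr ▸ ⟨x, rfl⟩
      obtain ⟨i, hi⟩ := this
      rw [Ne, letter_eq_four_iff]
      exact fun hc => hc i hi
    have hd : ∀ {x y}, x ≠ y → letter q (σ x) ≠ letter q (σ y) := fun hxy e =>
      hxy (hσ (letter_injOn h (hl _) e))
    have ha : ∀ {x y}, (cubeGraph 2).Adj x y →
        letterAdj (letter q (σ x)) (letter q (σ y)) := fun hxy =>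
      letterAdj_of_adj R h (σ.map_adj hxy)
    refine letterSign_ne_zero_of_injective _ _ _ _ ?_ (ha (vec2_adj _ _).1) (ha (vec2_adj _ _).2)
      (ha (vec2_adj true true).1) (ha (vec2_adj _ true).2)
    exact ⟨hl _, hl _, hl _, hl _, hd (vec2_ne (by simp)), hd (vec2_ne (by simp)),
      hd (vec2_ne (by simp)), hd (vec2_ne (by simp)), hd (vec2_ne (by simp)),
      hd (vec2_ne (by simp))⟩

theorem SquareRigid.isMonophobic_two (R : SquareRigid G) : IsMonophobic G 2 := by
  intro Q hQ
  obtain ⟨ρ, hρ, rfl⟩ := exists_singCube_of_isCube hQ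
  have hind := image_isInduced (R.cubeGraph_adj_of_adj hρ)
  refine ⟨hind, fun σ p hp => ?_⟩
  have hq := isSquare4_squareOf hρ
  have key : ∀ τ : SingCube G 2, squareSign (squareOf ρ) τ ≠ 0 ↔ τ.image = ρ.image := by
    intro τ
    rw [squareSign_ne_zero_iff R hq, range_squareOf]
    constructor
    · rintro ⟨h1, h2⟩
      exact subgraph_ext_of_isInduced (image_isInduced (R.cubeGraph_adj_of_adj h1)) hind h2
    · intro h
      have h2 : Set.range τ = Set.range ρ := congrArg SimpleGraph.Subgraph.verts h
      refine ⟨?_, h2⟩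
      -- A map from the four corners onto the four vertices of the square is injective; the section
      -- `g` is injective, hence bijective by finiteness.
      obtain ⟨g, hg⟩ : ∃ g : (Fin 2 → Bool) → (Fin 2 → Bool), ∀ x, τ (g x) = ρ x :=
        ⟨fun x => (show ρ x ∈ Set.range τ from h2 ▸ ⟨x, rfl⟩).choose,
          fun x => (show ρ x ∈ Set.range τ from h2 ▸ ⟨x, rfl⟩).choose_spec⟩
      have hgi : Function.Injective g := fun x y e => hρ (by rw [← hg, ← hg, e])
      have hgs := Finite.surjective_of_injective hgi
      intro x y e
      obtain ⟨x, rfl⟩ := hgs x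
      obtain ⟨y, rfl⟩ := hgs y
      rw [hg, hg] at e
      rw [hρ e]
  have hsum := (squareSign_faces R hq σ).2
  have hp' := (key _).2 hp
  by_contra! hne
  have hz : ∀ i ε, (i, ε) ≠ p → squareSign (squareOf ρ) (σ.face i ε) = 0 := by
    intro i ε h
    by_contra hc
    exact hne (i, ε) h ((key _).1 hc)
  obtain ⟨j, δ⟩ := p
  -- A face around the square contributes exactly one to the sum of absolute values, which cannot be
  -- its total by `squareSign_faces`.
  have habs : (squareSign (squareOf ρ) (σ.face j δ)).natAbs = 1 := by
    have : ∀ a b c d : Fin 5, letterSign a b c d ≠ 0 → (letterSign a b c d).natAbs = 1 := by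
      intro a b c d h
      rw [letterSign] at h ⊢
      split_ifs at h ⊢ <;> simp_all
    exact this _ _ _ _ hp'
  fin_cases j <;> cases δ <;> simp_all

theorem SquareRigid.isQuasimonophobic_two (R : SquareRigid G) : IsQuasimonophobic G 2 :=
  fun Q hQ => ⟨(R.isMonophobic_two Q hQ).1, fun σ _ p hp => (R.isMonophobic_two Q hQ).2 σ p hp⟩

/-- A noninjective singular 1-cube is constant, so its two faces coincide as maps. -/
theorem isQuasimonophobic_zero : IsQuasimonophobic G 0 := by
  intro Q hQ
  obtain ⟨ρ, -, rfl⟩ := exists_singCube_of_isCube hQ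
  refine ⟨image_isInduced fun x y h => (h.ne (by rw [Subsingleton.elim x y])).elim, ?_⟩
  rintro σ hσ ⟨i, ε⟩ hp
  refine ⟨(i, !ε), by simp, ?_⟩
  obtain rfl : i = 0 := Fin.fin_one_eq_zero i
  have h1 : σ (vec1 false) = σ (vec1 true) := by
    by_contra hne
    refine hσ fun x y e => ?_
    rw [vec1_eta x, vec1_eta y] at e ⊢
    generalize x 0 = a at *
    generalize y 0 = b at *
    cases a <;> cases b <;> first | rfl | exact (hne e).elim | exact (hne e.symm).elim
  have h2 : ∀ ε x, σ.face 0 ε x = σ (vec1 ε) := fun ε x => by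
    rw [SingCube.face_apply]
    congr 1
    funext k
    fin_cases k
    rfl
  have h3 : σ.face 0 (!ε) = σ.face 0 ε := DFunLike.ext _ _ fun x => by
    rw [h2, h2]
    cases ε
    · exact h1.symm
    · exact h1
  unfold FaceSupported at hp ⊢
  rw [h3, hp]

theorem image_eq_of_swap {σ τ : SingCube G 1} (h0 : σ (vec1 false) = τ (vec1 true))
    (h1 : σ (vec1 true) = τ (vec1 false)) : σ.image = τ.image := by
  have hx : ∀ x, σ x = τ (vec1 (!x 0)) := fun x => by
    conv_lhs => rw [vec1_eta x]
    cases x 0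
    exacts [h0, h1]
  have hx' : ∀ x, τ x = σ (vec1 (!x 0)) := fun x => by
    rw [hx]
    conv_lhs => rw [vec1_eta x]
    simp [vec1]
  have hadj : ∀ x y, (cubeGraph 1).Adj x y →
      (cubeGraph 1).Adj (vec1 (!x 0)) (vec1 (!y 0)) := by
    intro x y h
    have : y = vec1 (!x 0) := by
      rw [vec1_eta y]
      congr 1
      rw [Bool.eq_not]
      intro e
      exact h.ne (by rw [vec1_eta x, vec1_eta y, e])
    rw [this]
    exact vec1_adj _
  refine SimpleGraph.Subgraph.ext ?_ ?_
  · ext v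
    constructor
    · rintro ⟨x, rfl⟩
      exact ⟨_, (hx x).symm⟩
    · rintro ⟨x, rfl⟩
      exact ⟨_, (hx' x).symm⟩
  · funext a b
    refine propext ⟨?_, ?_⟩
    · rintro ⟨h, x, y, hxy, rfl, rfl⟩
      exact ⟨h, _, _, hadj x y hxy, (hx x).symm, (hx y).symm⟩
    · rintro ⟨h, x, y, hxy, rfl, rfl⟩
      exact ⟨h, _, _, hadj x y hxy, (hx' x).symm, (hx' y).symm⟩

theorem image_eq_of_pair {σ τ : SingCube G 1}
    (h : (σ (vec1 false) = τ (vec1 false) ∧ σ (vec1 true) = τ (vec1 true)) ∨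
      (σ (vec1 false) = τ (vec1 true) ∧ σ (vec1 true) = τ (vec1 false))) :
    σ.image = τ.image := by
  rcases h with ⟨h0, h1⟩ | ⟨h0, h1⟩
  · rw [singCube_one_ext (σ := σ) (τ := τ) fun i => by cases i <;> assumption]
  · exact image_eq_of_swap h0 h1

/-- In a closed walk of length four in a triangle-free graph, repeating a vertex, every edge is
traversed twice. -/
theorem SquareRigid.walk_repeats (R : SquareRigid G) {a b c d : V} (hab : G.Adj a b)
    (hbc : b = c ∨ G.Adj b c) (hcd : c = d ∨ G.Adj c d) (hda : d = a ∨ G.Adj d a)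
    (hrep : a = c ∨ b = d ∨ b = c ∨ c = d ∨ d = a) : a = c ∨ b = d ∨ (b = c ∧ d = a) := by
  rcases hrep with h | h | h | h | h
  · exact Or.inl h
  · exact Or.inr (Or.inl h)
  · subst h
    rcases hcd with h' | h'
    · exact Or.inr (Or.inl h')
    · rcases hda with h'' | h''
      · exact Or.inr (Or.inr ⟨rfl, h''⟩)
      · exact (R.not_triangle hab h' h''.symm).elim
  · subst h
    rcases hda with h' | h'
    · exact Or.inl h'.symm
    · rcases hbc with h'' | h''
      · exact Or.inr (Or.inl h'')
      · exact (R.not_triangle hab h'' h'.symm).elim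
  · subst h
    rcases hcd with h' | h'
    · exact Or.inl h'.symm
    · rcases hbc with h'' | h''
      · exact Or.inr (Or.inr ⟨h'', rfl⟩)
      · exact (R.not_triangle hab h'' h'.symm).elim

/-- A noninjective singular square whose side `ab` is a genuine edge runs as `a, b, c, d` with `a =
c`, `b = d`, or `b = c` and `d = a`. The edge then occurs again as the side `bc`, `da` or `cd`
respectively. -/
theorem SquareRigid.isQuasimonophobic_one (R : SquareRigid G) : IsQuasimonophobic G 1 := by
  intro Q hQ
  obtain ⟨ρ, hρ, rfl⟩ := exists_singCube_of_isCube hQ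
  refine ⟨image_isInduced fun x y h => ?_, ?_⟩
  · have hne : x 0 ≠ y 0 := fun e => h.ne (by rw [vec1_eta x, vec1_eta y, e])
    rw [vec1_eta x, vec1_eta y, Bool.eq_not.2 hne.symm]
    exact vec1_adj _
  intro σ hσ
  have hrep : ∀ i j, σ (vec2 i j) = σ (vec2 (!i) (!j)) ∨ σ (vec2 (!i) j) = σ (vec2 i (!j)) ∨
      σ (vec2 (!i) j) = σ (vec2 (!i) (!j)) ∨ σ (vec2 (!i) (!j)) = σ (vec2 i (!j)) ∨
      σ (vec2 i (!j)) = σ (vec2 i j) ∨ σ (vec2 i j) = σ (vec2 (!i) j) := by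
    intro i j
    by_contra! hne
    obtain ⟨h1, h2, h3, h4, h5, h6⟩ := hne
    refine hσ fun x y e => ?_
    rw [vec2_eta x, vec2_eta y] at e ⊢
    generalize x 0 = a at *
    generalize x 1 = b at *
    generalize y 0 = c at *
    generalize y 1 = d at *
    cases i <;> cases j <;> cases a <;> cases b <;> cases c <;> cases d <;>
      first
      | rfl
      | exact absurd e ‹_›
      | exact absurd e.symm ‹_›
  have hadj : ∀ τ : SingCube G 1, τ.image = ρ.image → G.Adj (τ (vec1 false)) (τ (vec1 true)) := by
    intro τ h
    refine (τ.map_adj (vec1_adj false)).resolve_left fun e => ?_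
    have h2 : Set.range τ = Set.range ρ := congrArg SimpleGraph.Subgraph.verts h
    have hc : ∀ x, ρ x = τ (vec1 false) := fun x => by
      obtain ⟨y, hy⟩ : ρ x ∈ Set.range τ := h2 ▸ ⟨x, rfl⟩
      rw [← hy, vec1_eta y]
      cases y 0
      · rfl
      · exact e.symm
    have := hρ ((hc (vec1 false)).trans (hc (vec1 true)).symm)
    exact (vec1_adj false).ne this
  rintro ⟨i, ε⟩ hp
  unfold FaceSupported at hp
  simp only at hp
  have h := hadj _ hp
  fin_cases i
  · simp only [Fin.zero_eta, face_zero_vec2] at h hp ⊢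
    have a1 := σ.map_adj (vec2_adj ε true).1
    have a2 := σ.map_adj (vec2_adj (!ε) true).2
    have a3 := σ.map_adj (vec2_adj (!ε) false).1
    have r := hrep ε false
    simp only [Bool.not_not, Bool.not_true, Bool.not_false] at a1 a2 a3 r
    rcases R.walk_repeats h a1 a2 a3 (by have := h.ne; clear hrep hadj hp; grind) with e | e | ⟨e1, e2⟩
    · refine ⟨(1, true), by simp, hp ▸ image_eq_of_pair ?_⟩
      simp only [face_zero_vec2, face_one_vec2]
      cases ε <;> simp [e]
    · refine ⟨(1, false), by simp, hp ▸ image_eq_of_pair ?_⟩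
      simp only [face_zero_vec2, face_one_vec2]
      cases ε <;> simp [e]
    · refine ⟨(0, !ε), by simp, hp ▸ image_eq_of_pair (Or.inl ?_)⟩
      simp only [face_zero_vec2]
      exact ⟨e2, e1.symm⟩
  · simp only [Fin.mk_one, face_one_vec2] at h hp ⊢
    have a1 := σ.map_adj (vec2_adj true ε).2
    have a2 := σ.map_adj (vec2_adj true (!ε)).1
    have a3 := σ.map_adj (vec2_adj false (!ε)).2
    have r := hrep false ε
    simp only [Bool.not_not, Bool.not_true, Bool.not_false] at a1 a2 a3 r
    rcases R.walk_repeats h a1 a2 a3 (by have := h.ne; clear hrep hadj hp; grind) with e | e | ⟨e1, e2⟩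
    · refine ⟨(0, true), by simp, hp ▸ image_eq_of_pair ?_⟩
      simp only [face_zero_vec2, face_one_vec2]
      cases ε <;> simp [e]
    · refine ⟨(0, false), by simp, hp ▸ image_eq_of_pair ?_⟩
      simp only [face_zero_vec2, face_one_vec2]
      cases ε <;> simp [e]
    · refine ⟨(1, !ε), by simp, hp ▸ image_eq_of_pair (Or.inl ?_)⟩
      simp only [face_one_vec2]
      exact ⟨e2, e1.symm⟩

/-- The singular 2-cube given by its vertices in cyclic order. -/
def quadCube (a b c d : V) (hab : a = b ∨ G.Adj a b)
    (hbc : b = c ∨ G.Adj b c) (hcd : c = d ∨ G.Adj c d) (hda : d = a ∨ G.Adj d a) :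
    SingCube G 2 where
  toFun x := if x 0 then (if x 1 then c else b) else (if x 1 then d else a)
  map_adj' x y h := by
    obtain ⟨i, hi, hu⟩ := h
    have h' : ∀ {v w : V}, (v = w ∨ G.Adj v w) → (w = v ∨ G.Adj w v) := fun h =>
      h.imp Eq.symm SimpleGraph.Adj.symm
    have hab' := h' hab
    have hbc' := h' hbc
    have hcd' := h' hcd
    have hda' := h' hda
    have h0 : x 0 ≠ y 0 → 0 = i := hu 0
    have h1 : x 1 ≠ y 1 → 1 = i := hu 1
    clear hu hi
    generalize x 0 = a0 at *
    generalize x 1 = a1 at *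
    generalize y 0 = b0 at *
    generalize y 1 = b1 at *
    cases a0 <;> cases a1 <;> cases b0 <;> cases b1 <;>
      first
      | exact Or.inl rfl
      | assumption
      | exact absurd ((h0 (by simp)).trans (h1 (by simp)).symm) (by simp)

theorem quadCube_injective {a b c d : V}
    (hab : G.Adj a b) (hbc : G.Adj b c) (hcd : G.Adj c d) (hda : G.Adj d a) (hac : a ≠ c)
    (hbd : b ≠ d) : Function.Injective (quadCube (G := G) a b c d (Or.inr hab) (Or.inr hbc)
      (Or.inr hcd) (Or.inr hda)) := by
  have h1 := hab.ne
  have h2 := hbc.ne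
  have h3 := hcd.ne
  have h4 := hda.ne
  intro x y e
  change (if x 0 then (if x 1 then c else b) else (if x 1 then d else a)) =
    (if y 0 then (if y 1 then c else b) else (if y 1 then d else a)) at e
  rw [vec2_eta x, vec2_eta y]
  generalize x 0 = a0 at *
  generalize x 1 = a1 at *
  generalize y 0 = b0 at *
  generalize y 1 = b1 at *
  cases a0 <;> cases a1 <;> cases b0 <;> cases b1 <;>
    first
    | rfl
    | exact absurd e ‹_›
    | exact absurd e.symm ‹_›

end Rigid

/-! ### Quasimonophobicity and standard squares of the Greene sphere graph -/

section Greene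

open scoped Fin.CommRing

variable {n : ℕ} [hn : Fact (4 ≤ n)]

/-- The Greene sphere graph is bipartite, without three common neighbours of two vertices, and
without three-dimensional cubes. -/
def greeneRigid (n : ℕ) [Fact (4 ≤ n)] : SquareRigid (greeneSphere n) where
  coloring := greeneColoring n
  common_neighbors := greene_common_neighbors
  not_injective_three := greene_not_injective_three

theorem greene_cliqueFree : (greeneSphere n).CliqueFree 3 :=
  (SimpleGraph.Coloring.colorable (greeneColoring n)).cliqueFree (by simp)

theorem greene_isQuasimonophobic (m : ℕ) : IsQuasimonophobic (greeneSphere n) m := by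
  match m with
  | 0 => exact isQuasimonophobic_zero
  | 1 => exact (greeneRigid n).isQuasimonophobic_one
  | 2 => exact (greeneRigid n).isQuasimonophobic_two
  | m + 3 =>
    intro Q hQ
    obtain ⟨ρ, hρ, -⟩ := exists_singCube_of_isCube hQ
    have := greene_le_two_of_injective ρ hρ
    omega

theorem greene_adj_hub_succ (c : Fin (2 * n)) :
    (greeneSphere n).Adj (Sum.inr (!par c)) (Sum.inl (c + 1)) :=
  (greene_adj_inr_inl _ _).2 (par_add_one c)

theorem greene_adj_succ (c : Fin (2 * n)) :
    (greeneSphere n).Adj (Sum.inl (c + 1)) (Sum.inl c) :=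
  (greene_adj_inl _ _).2 (Or.inr (add_sub_cancel_right c 1).symm)

theorem greene_adj_pred (c : Fin (2 * n)) :
    (greeneSphere n).Adj (Sum.inl c) (Sum.inl (c - 1)) :=
  (greene_adj_inl _ _).2 (Or.inr rfl)

theorem greene_adj_pred_hub (c : Fin (2 * n)) :
    (greeneSphere n).Adj (Sum.inl (c - 1)) (Sum.inr (!par c)) :=
  (greene_adj_inl_inr _ _).2 (par_sub_one c)

/-- The standard square around the vertex `c` of the cycle, starting at the hub. -/
def stdSquare (c : Fin (2 * n)) : SingCube (greeneSphere n) 2 :=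
  quadCube (Sum.inr (!par c)) (Sum.inl (c + 1)) (Sum.inl c) (Sum.inl (c - 1))
    (Or.inr (greene_adj_hub_succ c)) (Or.inr (greene_adj_succ c)) (Or.inr (greene_adj_pred c))
    (Or.inr (greene_adj_pred_hub c))

theorem inl_add_one_ne (c : Fin (2 * n)) :
    (Sum.inl (c + 1) : Fin (2 * n) ⊕ Bool) ≠ Sum.inl (c - 1) := fun h =>
  (fin_ne n).2.1 (by linear_combination Sum.inl_injective h)

theorem stdSquare_injective (c : Fin (2 * n)) : Function.Injective (stdSquare c) :=
  quadCube_injective (greene_adj_hub_succ c) (greene_adj_succ c) (greene_adj_pred c)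
    (greene_adj_pred_hub c) Sum.inr_ne_inl (inl_add_one_ne c)

theorem greene_hasCubicalDimension : HasCubicalDimension (greeneSphere n) 2 :=
  ⟨⟨stdSquare 0, stdSquare_injective 0⟩, fun _ ⟨σ, hσ⟩ => greene_le_two_of_injective σ hσ⟩

end Greene

/-! ### Rotations and reflections of squares -/

section Rotation

variable {V : Type u} {G : SimpleGraph V}

theorem map_adj_of_coords {m : ℕ} (f : (Fin m → Bool) → V)
    (h : ∀ x i, f (Function.update x i false) = f (Function.update x i true) ∨
      G.Adj (f (Function.update x i false)) (f (Function.update x i true)))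
    ⦃x y : Fin m → Bool⦄ (hxy : (cubeGraph m).Adj x y) : f x = f y ∨ G.Adj (f x) (f y) := by
  obtain ⟨i, rfl⟩ := exists_update_of_cubeGraph_adj hxy
  have hi := h x i
  cases hx : x i
  · rw [← hx, Function.update_eq_self] at hi
    exact hi
  · have e : Function.update x i true = x := by rw [← hx, Function.update_eq_self]
    rw [e] at hi
    exact hi.imp Eq.symm SimpleGraph.Adj.symm

/-- The singular 3-cube given by its vertices. -/
def cubeOfFun (f : Bool → Bool → Bool → V)
    (h0 : ∀ j k, f false j k = f true j k ∨ G.Adj (f false j k) (f true j k))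
    (h1 : ∀ i k, f i false k = f i true k ∨ G.Adj (f i false k) (f i true k))
    (h2 : ∀ i j, f i j false = f i j true ∨ G.Adj (f i j false) (f i j true)) :
    SingCube G 3 where
  toFun x := f (x 0) (x 1) (x 2)
  map_adj' := map_adj_of_coords _ fun x i => by
    fin_cases i
    · exact h0 _ _
    · exact h1 _ _
    · exact h2 _ _

theorem flip_zero_vec2 (σ : SingCube G 2) (i j : Bool) :
    σ.flip 0 (vec2 i j) = σ (vec2 (!i) j) := by
  change σ _ = σ _
  congr 1
  funext k
  fin_cases k <;> rfl

theorem flip_one_vec2 (σ : SingCube G 2) (i j : Bool) :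
    σ.flip 1 (vec2 i j) = σ (vec2 i (!j)) := by
  change σ _ = σ _
  congr 1
  funext k
  fin_cases k <;> rfl

/-- The rotation of a singular 2-cube. -/
def SingCube.rot (σ : SingCube G 2) : SingCube G 2 := (σ.flip 1).perm (Equiv.swap 0 1)

theorem rot_vec2 (σ : SingCube G 2) (i j : Bool) : σ.rot (vec2 i j) = σ (vec2 j (!i)) := by
  rw [← flip_one_vec2]
  change σ.flip 1 _ = σ.flip 1 _
  congr 1
  funext k
  fin_cases k <;> rfl

theorem rot_injective {σ : SingCube G 2} (h : Function.Injective σ) :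
    Function.Injective σ.rot :=
  ((InjCube.flip ⟨σ, h⟩ 1).perm (Equiv.swap 0 1)).2

theorem flip_injective {m : ℕ} {σ : SingCube G m} (h : Function.Injective σ) (i : Fin m) :
    Function.Injective (σ.flip i) :=
  (InjCube.flip ⟨σ, h⟩ i).2

theorem cubeClass_mem_degreeLT_two {σ : SingCube G 2} (h : ¬ Function.Injective σ) :
    cubeClass G σ ∈ degreeLT G 2 2 := by
  refine Submodule.subset_span ⟨σ, Nat.lt_succ_iff.2 ((σ.degree_le_iff 1).2 fun S b hS => ?_), rfl⟩
  by_contra hc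
  have hS' : S = Finset.univ := by
    rw [← Finset.card_eq_iff_eq_univ]
    have := S.card_le_univ
    simp only [Fintype.card_fin] at *
    omega
  subst hS'
  exact h fun x y e => hS (fun i hi => (hi (Finset.mem_univ i)).elim)
    (fun i hi => (hi (Finset.mem_univ i)).elim) e

theorem not_injective_of_vec2 {σ : SingCube G 2} {i j i' j' : Bool} (hne : (i, j) ≠ (i', j'))
    (h : σ (vec2 i j) = σ (vec2 i' j')) : ¬ Function.Injective σ :=
  fun hi => vec2_ne hne (hi h)

variable (G) in
/-- The chains of dimension two that are sums of boundaries and of chains of degree at most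
one. -/
noncomputable def lowChains : Submodule ℤ (NormChains G 2) :=
  degreeLT G 2 2 ⊔ LinearMap.range (normBoundary G 2)

theorem isDegenerate_of_vec2_zero {σ : SingCube G 2}
    (h : ∀ j, σ (vec2 false j) = σ (vec2 true j)) : σ.IsDegenerate := by
  refine ⟨0, fun x => ?_⟩
  rw [vec2_eta (Function.update x 0 false), vec2_eta (Function.update x 0 true)]
  exact h _

theorem isDegenerate_of_vec2_one {σ : SingCube G 2}
    (h : ∀ i, σ (vec2 i false) = σ (vec2 i true)) : σ.IsDegenerate := by
  refine ⟨1, fun x => ?_⟩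
  rw [vec2_eta (Function.update x 1 false), vec2_eta (Function.update x 1 true)]
  exact h _

/-- The 3-cube `τ` slides `σ` onto its side `x = 0`. Its faces include `σ`, the flipped square and
two degenerate squares, and the remaining two faces only run along single sides of `σ`, so they are
not injective. -/
theorem flip_add_mem_lowChains (σ : SingCube G 2) :
    cubeClass G (σ.flip 0) + cubeClass G σ ∈ lowChains G := by
  have a0 : ∀ j, σ (vec2 false j) = σ (vec2 true j) ∨
    G.Adj (σ (vec2 false j)) (σ (vec2 true j)) := fun j => σ.map_adj (vec2_adj false j).1
  have a0' : ∀ j, σ (vec2 true j) = σ (vec2 false j) ∨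
    G.Adj (σ (vec2 true j)) (σ (vec2 false j)) := fun j => σ.map_adj (vec2_adj true j).1
  have a1 : ∀ i, σ (vec2 i false) = σ (vec2 i true) ∨
    G.Adj (σ (vec2 i false)) (σ (vec2 i true)) := fun i => σ.map_adj (vec2_adj i false).2
  let τ : SingCube G 3 := cubeOfFun (fun t x y => σ (vec2 (x && !t) y))
    (fun x y => by cases x <;> simp [a0'])
    (fun t y => by cases t <;> simp [a0])
    (fun t x => a1 _)
  have hτ : ∀ t x y, τ (vec3 t x y) = σ (vec2 (x && !t) y) := fun _ _ _ => rfl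
  have e1 : τ.face 0 false = σ := singCube_two_ext fun i j => by
    rw [face_zero_vec3, hτ]
    simp
  have e2 : cubeClass G (τ.face 0 true) = 0 :=
    cubeClass_eq_zero <| isDegenerate_of_vec2_zero fun j => by simp [face_zero_vec3, hτ]
  have e3 : cubeClass G (τ.face 1 false) = 0 :=
    cubeClass_eq_zero <| isDegenerate_of_vec2_zero fun j => by simp [face_one_vec3, hτ]
  have e4 : τ.face 1 true = σ.flip 0 := singCube_two_ext fun i j => by
    rw [face_one_vec3, hτ, flip_zero_vec2]
    simp
  have e5 : ∀ ε, cubeClass G (τ.face 2 ε) ∈ degreeLT G 2 2 := fun ε =>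
    cubeClass_mem_degreeLT_two <| not_injective_of_vec2 (i := false) (j := false) (i' := true)
      (j' := false) (by simp) (by simp [face_two_vec3, hτ])
  have hb := normBoundary_three τ
  rw [e1, e2, e3, e4] at hb
  have : cubeClass G (σ.flip 0) + cubeClass G σ =
      -(cubeClass G (τ.face 2 false) - cubeClass G (τ.face 2 true)) +
        normBoundary G 2 (-cubeClass G τ) := by
    rw [map_neg, hb]
    abel
  rw [this]
  exact Submodule.add_mem_sup (neg_mem (sub_mem (e5 _) (e5 _))) ⟨_, rfl⟩

/-- The same sliding towards the side `y = 0`. The face `y = 1` of `τ` carries the coordinates in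
the order `t, x` with `t` reversed, which is the rotated square. -/
theorem rot_sub_mem_lowChains (σ : SingCube G 2) :
    cubeClass G σ.rot - cubeClass G σ ∈ lowChains G := by
  have a0 : ∀ j, σ (vec2 false j) = σ (vec2 true j) ∨
    G.Adj (σ (vec2 false j)) (σ (vec2 true j)) := fun j => σ.map_adj (vec2_adj false j).1
  have a1' : ∀ i, σ (vec2 i true) = σ (vec2 i false) ∨
    G.Adj (σ (vec2 i true)) (σ (vec2 i false)) := fun i => σ.map_adj (vec2_adj i true).2
  have a1 : ∀ i, σ (vec2 i false) = σ (vec2 i true) ∨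
    G.Adj (σ (vec2 i false)) (σ (vec2 i true)) := fun i => σ.map_adj (vec2_adj i false).2
  let τ : SingCube G 3 := cubeOfFun (fun t x y => σ (vec2 x (y && !t)))
    (fun x y => by cases y <;> simp [a1'])
    (fun t y => a0 _)
    (fun t x => by cases t <;> simp [a1])
  have hτ : ∀ t x y, τ (vec3 t x y) = σ (vec2 x (y && !t)) := fun _ _ _ => rfl
  have e1 : τ.face 0 false = σ := singCube_two_ext fun i j => by
    rw [face_zero_vec3, hτ]
    simp
  have e2 : cubeClass G (τ.face 0 true) = 0 :=
    cubeClass_eq_zero <| isDegenerate_of_vec2_one fun j => by simp [face_zero_vec3, hτ]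
  have e3 : cubeClass G (τ.face 2 false) = 0 :=
    cubeClass_eq_zero <| isDegenerate_of_vec2_zero fun j => by simp [face_two_vec3, hτ]
  have e4 : τ.face 2 true = σ.rot := singCube_two_ext fun i j => by
    rw [face_two_vec3, hτ, rot_vec2]
    simp
  have e5 : ∀ ε, cubeClass G (τ.face 1 ε) ∈ degreeLT G 2 2 := fun ε =>
    cubeClass_mem_degreeLT_two <| not_injective_of_vec2 (i := false) (j := false) (i' := true)
      (j' := false) (by simp) (by simp [face_one_vec3, hτ])
  have hb := normBoundary_three τ
  rw [e1, e2, e3, e4] at hb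
  have : cubeClass G σ.rot - cubeClass G σ =
      -(cubeClass G (τ.face 1 false) - cubeClass G (τ.face 1 true)) +
        normBoundary G 2 (cubeClass G τ) := by
    rw [hb]
    abel
  rw [this]
  exact Submodule.add_mem_sup (neg_mem (sub_mem (e5 _) (e5 _))) ⟨_, rfl⟩

theorem squareCoeff_lowChains (R : SquareRigid G) {q : Fin 4 → V} (h : IsSquare4 G q)
    {z : NormChains G 2} (hz : z ∈ lowChains G) : squareCoeff q z = 0 := by
  have : lowChains G ≤ LinearMap.ker (squareCoeff q) := by
    refine sup_le (Submodule.span_le.2 ?_) ?_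
    · rintro _ ⟨σ, hσ, rfl⟩
      change squareCoeff q (cubeClass G σ) = 0
      rw [squareCoeff, chainLift_cubeClass]
      by_contra hne
      have hi := ((squareSign_ne_zero_iff R h σ).1 hne).1
      have := (σ.degree_le_iff 1).1 (Nat.lt_succ_iff.1 hσ) Finset.univ (fun _ => false)
        hi.injOn
      simp at this
    · rintro _ ⟨w, rfl⟩
      exact squareCoeff_boundary R h w
  exact this hz

open Classical in
/-- The class of an edge or vertex as a singular 1-cube. -/
noncomputable def edgeClass (G : SimpleGraph V) (a b : V) : NormChains G 1 :=
  if h : ∃ σ : SingCube G 1, σ (vec1 false) = a ∧ σ (vec1 true) = b then cubeClass G h.choose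
  else 0

theorem edgeClass_eq (σ : SingCube G 1) :
    edgeClass G (σ (vec1 false)) (σ (vec1 true)) = cubeClass G σ := by
  have h : ∃ τ : SingCube G 1, τ (vec1 false) = σ (vec1 false) ∧ τ (vec1 true) = σ (vec1 true) :=
    ⟨σ, rfl, rfl⟩
  rw [edgeClass, dif_pos h]
  congr 1
  exact singCube_one_ext fun i => by
    cases i
    exacts [h.choose_spec.1, h.choose_spec.2]

theorem edgeClass_self (a : V) : edgeClass G a a = 0 := by
  have := edgeClass_eq (GraphMap.const (cubeGraph 1) G a)
  rw [cubeClass_eq_zero (isDegenerate_of_const fun _ _ => rfl)] at this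
  exact this

theorem normBoundary_edgeClass (σ : SingCube G 2) : normBoundary G 1 (cubeClass G σ) =
    edgeClass G (σ (vec2 false false)) (σ (vec2 true false)) +
      edgeClass G (σ (vec2 true false)) (σ (vec2 true true)) -
      edgeClass G (σ (vec2 false true)) (σ (vec2 true true)) -
      edgeClass G (σ (vec2 false false)) (σ (vec2 false true)) := by
  rw [normBoundary_two]
  simp only [← edgeClass_eq, face_zero_vec2, face_one_vec2]
  abel

theorem quadCube_vec2 {a b c d : V} (hab) (hbc) (hcd) (hda) :
    quadCube (G := G) a b c d hab hbc hcd hda (vec2 false false) = a ∧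
    quadCube (G := G) a b c d hab hbc hcd hda (vec2 true false) = b ∧
    quadCube (G := G) a b c d hab hbc hcd hda (vec2 true true) = c ∧
    quadCube (G := G) a b c d hab hbc hcd hda (vec2 false true) = d :=
  ⟨rfl, rfl, rfl, rfl⟩

open Classical in
/-- The number of times a singular 1-cube runs through a given edge. -/
noncomputable def edgeSign (p q a b : V) : ℤ :=
  if a = p ∧ b = q then 1 else if a = q ∧ b = p then -1 else 0

theorem edgeSign_comm {p q : V} (h : p ≠ q) (a b : V) :
    edgeSign p q b a = -edgeSign p q a b := by
  unfold edgeSign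
  split_ifs <;> grind

theorem edgeSign_self {p q : V} (h : p ≠ q) (a : V) : edgeSign p q a a = 0 := by
  have := edgeSign_comm h a a
  omega

/-- The cochain counting how often an edge is traversed. -/
noncomputable def edgeCoeff (G : SimpleGraph V) (p q : V) (h : p ≠ q) : NormChains G 1 →ₗ[ℤ] ℤ :=
  chainLift (fun σ => edgeSign p q (σ (vec1 false)) (σ (vec1 true))) fun σ hσ => by
    obtain ⟨i, hi⟩ := hσ
    obtain rfl : i = 0 := Fin.fin_one_eq_zero i
    have : σ (vec1 false) = σ (vec1 true) := by
      convert hi (vec1 false) using 2 <;> funext k <;> fin_cases k <;> rfl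
    rw [this, edgeSign_self h]

theorem edgeCoeff_boundary {p q : V} (h : p ≠ q) (σ : SingCube G 2) :
    edgeCoeff G p q h (normBoundary G 1 (cubeClass G σ)) =
      edgeSign p q (σ (vec2 false false)) (σ (vec2 true false)) +
      edgeSign p q (σ (vec2 true false)) (σ (vec2 true true)) +
      edgeSign p q (σ (vec2 true true)) (σ (vec2 false true)) +
      edgeSign p q (σ (vec2 false true)) (σ (vec2 false false)) := by
  rw [normBoundary_two]
  simp only [map_add, map_neg, map_sub, edgeCoeff, chainLift_cubeClass, face_zero_vec2,
    face_one_vec2]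
  rw [edgeSign_comm h (σ (vec2 false true)) (σ (vec2 true true)),
    edgeSign_comm h (σ (vec2 false false)) (σ (vec2 false true))]
  ring

/-- In a triangle-free graph a noninjective closed walk of length four runs through each edge
equally often in both directions, so the signed counts cancel. -/
theorem SquareRigid.edgeCoeff_boundary_of_not_injective (R : SquareRigid G) {p q : V} (h : p ≠ q)
    {σ : SingCube G 2} (hσ : ¬ Function.Injective σ) :
    edgeCoeff G p q h (normBoundary G 1 (cubeClass G σ)) = 0 := by
  rw [edgeCoeff_boundary]
  have hab := σ.map_adj (vec2_adj false false).1
  have hbc := σ.map_adj (vec2_adj true false).2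
  have hcd := σ.map_adj (vec2_adj true true).1
  have hda := σ.map_adj (vec2_adj false true).2
  simp only [Bool.not_true, Bool.not_false] at hab hbc hcd hda
  have hrep : ¬ (σ (vec2 false false) ≠ σ (vec2 true true) ∧
      σ (vec2 true false) ≠ σ (vec2 false true) ∧
      G.Adj (σ (vec2 false false)) (σ (vec2 true false)) ∧
      G.Adj (σ (vec2 true false)) (σ (vec2 true true)) ∧
      G.Adj (σ (vec2 true true)) (σ (vec2 false true)) ∧
      G.Adj (σ (vec2 false true)) (σ (vec2 false false))) := by
    rintro ⟨h1, h2, h3, h4, h5, h6⟩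
    apply hσ
    convert quadCube_injective h3 h4 h5 h6 h1 h2 using 1
    refine congrArg _ (singCube_two_ext fun i j => ?_)
    cases i <;> cases j <;> rfl
  generalize σ (vec2 false false) = a at *
  generalize σ (vec2 true false) = b at *
  generalize σ (vec2 true true) = c at *
  generalize σ (vec2 false true) = d at *
  have c1 := fun x y : V => edgeSign_comm h x y
  have c2 := fun x : V => edgeSign_self h x
  have fin : a = c ∨ b = d ∨ (b = c ∧ d = a) ∨ (a = b ∧ c = d) := by
    have t1 : ∀ {x y z}, G.Adj x y → G.Adj y z → G.Adj z x → False := fun h1 h2 h3 =>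
      R.not_triangle h1 h2 h3.symm
    by_contra! hne
    obtain ⟨n1, n2, n3, n4⟩ := hne
    rcases hab with rfl | hab
    · have hcd' := hcd.resolve_left (n4 rfl)
      exact t1 (hbc.resolve_left n1) hcd' (hda.resolve_left n2.symm)
    · rcases hbc with rfl | hbc
      · exact t1 hab (hcd.resolve_left n2) (hda.resolve_left (n3 rfl))
      · rcases hcd with rfl | hcd
        · exact t1 hab hbc (hda.resolve_left n1.symm)
        · rcases hda with rfl | hda
          · exact t1 hab.symm.symm hbc hcd
          · exact hrep ⟨n1, n2, hab, hbc, hcd, hda⟩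
  rcases fin with rfl | rfl | ⟨rfl, rfl⟩ | ⟨rfl, rfl⟩
  · rw [c1 a b, c1 a d]
    ring
  · rw [c1 b a, c1 b c]
    ring
  · rw [c1 d b, c2, c2]
    ring
  · rw [c1 a c, c2, c2]
    ring

theorem SquareRigid.edgeCoeff_lowChains (R : SquareRigid G) {p q : V} (h : p ≠ q)
    {z : NormChains G 2} (hz : z ∈ lowChains G) :
    edgeCoeff G p q h (normBoundary G 1 z) = 0 := by
  have : lowChains G ≤ LinearMap.ker (edgeCoeff G p q h ∘ₗ normBoundary G 1) := by
    refine sup_le (Submodule.span_le.2 ?_) ?_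
    · rintro _ ⟨σ, hσ, rfl⟩
      refine R.edgeCoeff_boundary_of_not_injective h fun hi => ?_
      have := (σ.degree_le_iff 1).1 (Nat.lt_succ_iff.1 hσ) Finset.univ (fun _ => false)
        hi.injOn
      simp at this
    · rintro _ ⟨w, rfl⟩
      have := LinearMap.congr_fun (normBoundary_comp G 1) w
      simp only [LinearMap.comp_apply, LinearMap.zero_apply] at this
      simp [this]
  exact this hz

end Rotation

/-! ### The second homology group of the Greene sphere graph -/

section Greene

open scoped Fin.CommRing

variable {n : ℕ} [hn : Fact (4 ≤ n)]

/-- Every square of the Greene sphere graph is a standard square, up to rotations and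
reflections. -/
theorem stdSquare_induction {P : SingCube (greeneSphere n) 2 → Prop}
    (hstd : ∀ c, P (stdSquare c)) (hrot : ∀ σ : SingCube (greeneSphere n) 2, Function.Injective σ → P σ.rot → P σ)
    (hflip : ∀ σ : SingCube (greeneSphere n) 2, Function.Injective σ → P (σ.flip 0) → P σ)
    (σ : SingCube (greeneSphere n) 2) (hσ : Function.Injective σ) : P σ := by
  have adj : ∀ {σ : SingCube (greeneSphere n) 2}, Function.Injective σ → ∀ {x y},
      (cubeGraph 2).Adj x y → (greeneSphere n).Adj (σ x) (σ y) := fun hσ _ _ hxy =>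
    (GraphMap.map_adj _ hxy).resolve_left fun e => hxy.ne (hσ e)
  have hub : ∀ σ : SingCube (greeneSphere n) 2, Function.Injective σ → ∀ w,
      σ (vec2 false false) = Sum.inr w → P σ := by
    intro σ hσ w hw
    have h1 := adj hσ (vec2_adj false false).1
    have h2 := adj hσ (vec2_adj false false).2
    have h3 := adj hσ (vec2_adj true true).1
    have h4 := adj hσ (vec2_adj true true).2
    have hne : σ (vec2 true false) ≠ σ (vec2 false true) := hσ.ne (vec2_ne (by simp))
    simp only [Bool.not_true, Bool.not_false, hw, greene_adj_inr_iff] at h1 h2 h3 h4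
    obtain ⟨i, hi, hi'⟩ := h1
    obtain ⟨j, hj, hj'⟩ := h2
    cases hc : σ (vec2 true true) with
    | inr w' =>
      rw [hc, hi, greene_adj_inr_inl] at h4
      have : σ (vec2 true true) ≠ σ (vec2 false false) := hσ.ne (vec2_ne (by simp))
      rw [hc, hw] at this
      exact (this (by rw [← h4, ← hi'])).elim
    | inl c =>
      rw [hc, hj, greene_adj_inl] at h3
      rw [hc, hi, greene_adj_inl] at h4
      rw [hi, hj] at hne
      have hcw : w = !par c := by
        rcases h4 with rfl | rfl
        · rw [← hi', par_add_one]
        · rw [← hi', par_sub_one]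
      rcases h4 with rfl | rfl <;> rcases h3 with rfl | rfl
      · exact (hne rfl).elim
      · have : σ = stdSquare c := singCube_two_ext fun i j => by
          cases i <;> cases j
          exacts [hw.trans (congrArg _ hcw), hj, hi, hc]
        rw [this]
        exact hstd c
      · have : σ.rot.flip 0 = stdSquare c := singCube_two_ext fun i j => by
          rw [flip_zero_vec2, rot_vec2]
          cases i <;> cases j
          exacts [hw.trans (congrArg _ hcw), hi, hj, hc]
        exact hrot _ hσ (hflip _ (rot_injective hσ) (this ▸ hstd c))
      · exact (hne rfl).elim
  -- The rotation brings the next corner to the position `(false, false)`, so a hub at any corner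
  -- can be moved there.
  have hub1 : ∀ σ : SingCube (greeneSphere n) 2, Function.Injective σ → ∀ w,
      σ (vec2 false true) = Sum.inr w → P σ := fun σ hσ w hw =>
    hrot σ hσ (hub _ (rot_injective hσ) w (by rw [rot_vec2]; exact hw))
  have hub2 : ∀ σ : SingCube (greeneSphere n) 2, Function.Injective σ → ∀ w,
      σ (vec2 true true) = Sum.inr w → P σ := fun σ hσ w hw =>
    hrot σ hσ (hub1 _ (rot_injective hσ) w (by rw [rot_vec2]; exact hw))
  have hub3 : ∀ σ : SingCube (greeneSphere n) 2, Function.Injective σ → ∀ w,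
      σ (vec2 true false) = Sum.inr w → P σ := fun σ hσ w hw =>
    hrot σ hσ (hub2 _ (rot_injective hσ) w (by rw [rot_vec2]; exact hw))
  -- Every square contains a hub: if a corner and both its neighbours lie on the cycle, they are
  -- consecutive there, and the opposite corner is a hub by `greene_opposite_center`.
  cases ha : σ (vec2 false false) with
  | inr w => exact hub σ hσ w ha
  | inl i =>
    cases hb : σ (vec2 true false) with
    | inr w => exact hub3 σ hσ w hb
    | inl j =>
      cases hd : σ (vec2 false true) with
      | inr w => exact hub1 σ hσ w hd
      | inl k =>
        have h1 := adj hσ (vec2_adj false false).1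
        have h2 := adj hσ (vec2_adj false false).2
        have h3 := adj hσ (vec2_adj true false).2
        have h4 := adj hσ (vec2_adj false true).1
        have hne : σ (vec2 true false) ≠ σ (vec2 false true) := hσ.ne (vec2_ne (by simp))
        have hne' : σ (vec2 true true) ≠ σ (vec2 false false) := hσ.ne (vec2_ne (by simp))
        simp only [Bool.not_false, ha, hb, hd] at h1 h2 h3 h4 hne hne'
        rw [greene_adj_inl] at h1 h2
        rcases h1 with rfl | rfl <;> rcases h2 with rfl | rfl
        · exact (hne rfl).elim
        · exact hub2 σ hσ _ (greene_opposite_center h3 h4 hne')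
        · exact hub2 σ hσ _ (greene_opposite_center h4 h3 hne')
        · exact (hne rfl).elim

theorem isSquare4_stdSquare (c : Fin (2 * n)) :
    IsSquare4 (greeneSphere n) (squareOf (stdSquare c)) :=
  isSquare4_squareOf (stdSquare_injective c)

theorem mem_range_stdSquare {c : Fin (2 * n)} {v : Fin (2 * n) ⊕ Bool} :
    v ∈ Set.range (stdSquare c) ↔
      v = Sum.inr (!par c) ∨ v = Sum.inl (c + 1) ∨ v = Sum.inl c ∨ v = Sum.inl (c - 1) := by
  constructor
  · rintro ⟨x, rfl⟩
    rw [vec2_eta x]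
    cases x 0 <;> cases x 1 <;> simp [stdSquare, quadCube_vec2]
  · rintro (rfl | rfl | rfl | rfl)
    exacts [⟨vec2 false false, rfl⟩, ⟨vec2 true false, rfl⟩, ⟨vec2 true true, rfl⟩,
      ⟨vec2 false true, rfl⟩]

theorem range_stdSquare_injective {c c' : Fin (2 * n)}
    (h : Set.range (stdSquare c) = Set.range (stdSquare c')) : c = c' := by
  have h1 : Sum.inl c ∈ Set.range (stdSquare c') := h ▸ mem_range_stdSquare.2 (by simp)
  have h2 : Sum.inr (!par c) ∈ Set.range (stdSquare c') := h ▸ mem_range_stdSquare.2 (by simp)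
  rw [mem_range_stdSquare] at h1 h2
  simp only [Sum.inr.injEq, Sum.inl.injEq, reduceCtorEq, false_or, or_false,
    Bool.not_inj_iff] at h1 h2
  rcases h1 with rfl | rfl | rfl
  · simp [par_add_one] at h2
  · rfl
  · simp [par_sub_one] at h2

/-- The coefficient of a standard square. -/
noncomputable def stdCoeff (c : Fin (2 * n)) : NormChains (greeneSphere n) 2 →ₗ[ℤ] ℤ :=
  squareCoeff (squareOf (stdSquare c))

theorem stdCoeff_stdSquare (c c' : Fin (2 * n)) :
    stdCoeff c (cubeClass _ (stdSquare c')) = if c = c' then 1 else 0 := by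
  rw [stdCoeff, squareCoeff, chainLift_cubeClass]
  split_ifs with h
  · subst h
    have := letter_self (isSquare4_stdSquare c)
    change letterSign (letter _ (squareOf (stdSquare c) 0)) (letter _ (squareOf (stdSquare c) 1))
      (letter _ (squareOf (stdSquare c) 2)) (letter _ (squareOf (stdSquare c) 3)) = 1
    rw [this, this, this, this]
    decide
  · by_contra hne
    have := ((squareSign_ne_zero_iff (greeneRigid n) (isSquare4_stdSquare c) _).1 hne).2
    rw [range_squareOf] at this
    exact h (range_stdSquare_injective this.symm)

theorem stdCoeff_lowChains (c : Fin (2 * n)) {z : NormChains (greeneSphere n) 2}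
    (hz : z ∈ lowChains (greeneSphere n)) : stdCoeff c z = 0 :=
  squareCoeff_lowChains (greeneRigid n) (isSquare4_stdSquare c) hz

/-- Up to boundaries and chains of degree at most one, a chain is a combination of standard
squares. -/
theorem sub_sum_mem_lowChains (z : NormChains (greeneSphere n) 2) :
    z - ∑ c, stdCoeff c z • cubeClass _ (stdSquare c) ∈ lowChains (greeneSphere n) := by
  -- `E` fixes low chains, since their coefficients vanish, and kills standard squares. Rotating a
  -- square, or flipping it with a sign, changes it by a low chain, so the claim passes to all
  -- squares.
  let E : NormChains (greeneSphere n) 2 →ₗ[ℤ] NormChains (greeneSphere n) 2 :=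
    LinearMap.id - ∑ c, (stdCoeff c).smulRight (cubeClass _ (stdSquare c))
  have hE : ∀ z, E z = z - ∑ c, stdCoeff c z • cubeClass _ (stdSquare c) := fun z => by
    simp [E]
  have hlow : ∀ z ∈ lowChains (greeneSphere n), E z ∈ lowChains (greeneSphere n) := by
    intro z hz
    rw [hE, Finset.sum_eq_zero fun c _ => by rw [stdCoeff_lowChains c hz, zero_smul], sub_zero]
    exact hz
  suffices h : (⊤ : Submodule ℤ (NormChains (greeneSphere n) 2)) ≤
      (lowChains (greeneSphere n)).comap E by
    have := h (x := z) trivial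
    rwa [Submodule.mem_comap, hE] at this
  rw [← cubeClass_span, Submodule.span_le]
  rintro _ ⟨σ, rfl⟩
  change E (cubeClass _ σ) ∈ lowChains (greeneSphere n)
  by_cases hσ : Function.Injective σ
  · refine stdSquare_induction (P := fun σ => E (cubeClass _ σ) ∈ lowChains (greeneSphere n))
      ?_ ?_ ?_ σ hσ
    · intro c
      rw [hE, Finset.sum_eq_single c]
      · rw [stdCoeff_stdSquare, if_pos rfl, one_smul, sub_self]
        exact zero_mem _
      · intro c' _ hc
        rw [stdCoeff_stdSquare, if_neg hc, zero_smul]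
      · simp
    · intro σ _ h
      have := sub_mem h (hlow _ (rot_sub_mem_lowChains σ))
      rwa [← map_sub, sub_sub_cancel] at this
    · intro σ _ h
      have := sub_mem (hlow _ (flip_add_mem_lowChains σ)) h
      rwa [← map_sub, add_sub_cancel_left] at this
  · exact hlow _ (Submodule.mem_sup_left (cubeClass_mem_degreeLT_two hσ))

theorem inl_ne_succ (c : Fin (2 * n)) :
    (Sum.inl c : Fin (2 * n) ⊕ Bool) ≠ Sum.inl (c + 1) := fun h =>
  (fin_ne n).1 (by linear_combination -Sum.inl_injective h)

/-- The edge from `c` to `c + 1` lies on the standard squares around `c` and `c + 1` only, and both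
run through it backwards. -/
theorem edgeCoeff_stdSquare (c c' : Fin (2 * n)) :
    edgeCoeff (greeneSphere n) (Sum.inl c) (Sum.inl (c + 1)) (inl_ne_succ c)
      (normBoundary _ 1 (cubeClass _ (stdSquare c'))) =
      -(if c = c' then 1 else 0) - (if c + 1 = c' then 1 else 0) := by
  obtain ⟨h1, h2, h3, h4, -⟩ := fin_ne n
  rw [edgeCoeff_boundary]
  simp only [stdSquare, quadCube_vec2, edgeSign, Sum.inl.injEq, reduceCtorEq, false_and, and_false,
    if_false, zero_add, add_zero]
  have k1 : ¬ (c' + 1 = c ∧ c' = c + 1) := fun h =>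
    h2 (by linear_combination h.1 - h.2)
  have k2 : ¬ (c' = c ∧ c' - 1 = c + 1) := fun h =>
    h2 (by linear_combination h.1 - h.2)
  have k3 : (c' + 1 = c + 1 ∧ c' = c) ↔ c = c' :=
    ⟨fun h => h.2.symm, fun h => ⟨by rw [h], h.symm⟩⟩
  have k4 : (c' = c + 1 ∧ c' - 1 = c) ↔ c + 1 = c' :=
    ⟨fun h => h.1.symm, fun h => ⟨h.symm, by rw [← h, add_sub_cancel_right]⟩⟩
  rw [if_neg k1, if_neg k2]
  simp only [k3, k4]
  split_ifs <;> simp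

/-- The boundary of a cycle does not contain the edge from `c` to `c + 1`, which receives the same
contribution from the squares around `c` and `c + 1` and none from low chains. -/
theorem stdCoeff_succ {z : NormChains (greeneSphere n) 2} (hz : normBoundary _ 1 z = 0)
    (c : Fin (2 * n)) : stdCoeff (c + 1) z = -stdCoeff c z := by
  have h := (greeneRigid n).edgeCoeff_lowChains (inl_ne_succ c) (sub_sum_mem_lowChains z)
  rw [map_sub, hz, map_sum, zero_sub, map_neg, map_sum] at h
  simp only [map_smul, edgeCoeff_stdSquare, smul_eq_mul, mul_sub, mul_neg, mul_ite, mul_one,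
    mul_zero, Finset.sum_sub_distrib, Finset.sum_neg_distrib, Finset.sum_ite_eq,
    Finset.mem_univ, if_true] at h
  linarith

/-- A cycle not containing the square around `0` is a boundary. -/
theorem exists_boundary_of_stdCoeff_eq_zero {z : NormChains (greeneSphere n) 2}
    (hz : normBoundary _ 1 z = 0) (h0 : stdCoeff 0 z = 0) : ∃ w, normBoundary _ 2 w = z := by
  have hk : ∀ k : ℕ, stdCoeff (k : Fin (2 * n)) z = 0 := by
    intro k
    induction k with
    | zero => simpa using h0
    | succ k ih => rw [Nat.cast_succ, stdCoeff_succ hz, ih, neg_zero]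
  have hc : ∀ c : Fin (2 * n), stdCoeff c z = 0 := fun c => by
    have := hk c.val
    rwa [Fin.cast_val_eq_self] at this
  -- All coefficients vanish, so `z` is a chain `y` of degree at most one plus a boundary. Then `y`
  -- is a cycle, and it bounds because the graph is bipartite.
  have h := sub_sum_mem_lowChains z
  rw [Finset.sum_eq_zero fun c _ => by rw [hc, zero_smul], sub_zero, lowChains,
    Submodule.mem_sup] at h
  obtain ⟨y, hy, _, ⟨w, rfl⟩, rfl⟩ := h
  have hb : normBoundary _ 1 y = 0 := by
    have := LinearMap.congr_fun (normBoundary_comp (greeneSphere n) 1) w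
    simp only [LinearMap.comp_apply, LinearMap.zero_apply] at this
    rwa [map_add, this, add_zero] at hz
  obtain ⟨w', -, hw'⟩ := exists_boundary_of_degree_le_one (greeneColoring n) y hy hb
  exact ⟨w' + w, by rw [map_add, hw']⟩

/-- A thin square along an edge of the cycle. -/
def thinSquare (c : Fin (2 * n)) : SingCube (greeneSphere n) 2 :=
  quadCube (Sum.inl (c + 1)) (Sum.inl c) (Sum.inl (c + 1)) (Sum.inl (c + 1))
    (Or.inr (greene_adj_succ c)) (Or.inr (greene_adj_succ c).symm) (Or.inl rfl) (Or.inl rfl)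

theorem normBoundary_thinSquare (c : Fin (2 * n)) :
    normBoundary _ 1 (cubeClass _ (thinSquare c)) =
      edgeClass (greeneSphere n) (Sum.inl (c + 1)) (Sum.inl c) +
        edgeClass (greeneSphere n) (Sum.inl c) (Sum.inl (c + 1)) := by
  rw [normBoundary_edgeClass]
  simp only [thinSquare, quadCube_vec2, edgeClass_self, sub_zero]

/-- The fundamental cycle of the Greene sphere graph. -/
noncomputable def fundamentalCycle (n : ℕ) [Fact (4 ≤ n)] : NormChains (greeneSphere n) 2 :=
  -- The signs alternate because neighbouring squares run through their common edge in the same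
  -- direction. A reversed edge is not the negative of the edge in the chain group; the thin squares
  -- make this correction.
  ∑ c : Fin (2 * n), (if par c then -1 else 1 : ℤ) •
    (cubeClass _ (stdSquare c) - cubeClass _ (thinSquare c))

theorem normBoundary_fundamentalCycle : normBoundary _ 1 (fundamentalCycle n) = 0 := by
  -- The spokes cancel under the shift by two, which preserves the parity, and the cycle edges
  -- (`h2`) under the shift by one, which changes the sign.
  have h1 : ∑ c : Fin (2 * n), (if par c then -1 else 1 : ℤ) •
      edgeClass (greeneSphere n) (Sum.inr (!par c)) (Sum.inl (c - 1)) =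
      ∑ c : Fin (2 * n), (if par c then -1 else 1 : ℤ) •
      edgeClass (greeneSphere n) (Sum.inr (!par c)) (Sum.inl (c + 1)) := by
    rw [← Equiv.sum_comp (Equiv.addRight (1 + 1 : Fin (2 * n)))]
    refine Finset.sum_congr rfl fun c _ => ?_
    simp only [Equiv.coe_addRight, ← add_assoc, par_add_one, Bool.not_not, add_sub_cancel_right]
  have h2 : ∑ c : Fin (2 * n), (if par c then -1 else 1 : ℤ) •
      edgeClass (greeneSphere n) (Sum.inl (c - 1)) (Sum.inl c) =
      -∑ c : Fin (2 * n), (if par c then -1 else 1 : ℤ) •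
      edgeClass (greeneSphere n) (Sum.inl c) (Sum.inl (c + 1)) := by
    rw [← Equiv.sum_comp (Equiv.addRight (1 : Fin (2 * n))), ← Finset.sum_neg_distrib]
    refine Finset.sum_congr rfl fun c _ => ?_
    simp only [Equiv.coe_addRight, par_add_one, add_sub_cancel_right]
    cases par c <;> simp
  rw [fundamentalCycle, map_sum]
  simp only [map_smul, map_sub, normBoundary_thinSquare]
  simp only [normBoundary_edgeClass, stdSquare, quadCube_vec2]
  simp only [smul_sub, smul_add, Finset.sum_sub_distrib, Finset.sum_add_distrib]
  rw [h1, h2]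
  abel

theorem stdCoeff_fundamentalCycle : stdCoeff 0 (fundamentalCycle n) = 1 := by
  have hp : par (0 : Fin (2 * n)) = false := by simp [par]
  have hthin : ∀ c : Fin (2 * n), stdCoeff 0 (cubeClass _ (thinSquare c)) = 0 := fun c =>
    stdCoeff_lowChains 0 <| Submodule.mem_sup_left <| cubeClass_mem_degreeLT_two <|
      not_injective_of_vec2 (i := true) (j := true) (i' := false) (j' := true) (by simp)
        (by simp [thinSquare, quadCube_vec2])
  rw [fundamentalCycle, map_sum, Finset.sum_eq_single 0]
  · rw [map_smul, map_sub, stdCoeff_stdSquare, hthin, hp]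
    simp
  · intro c _ hc
    rw [map_smul, map_sub, stdCoeff_stdSquare, hthin, if_neg hc.symm]
    simp
  · simp

theorem greene_cubicalHomology_two :
    Nonempty (cubicalHomology (greeneSphere n) 2 ≃ₗ[ℤ] ℤ) :=
  cubicalHomology_equiv_int (stdCoeff 0)
    (fun w => squareCoeff_boundary (greeneRigid n) (isSquare4_stdSquare 0) w)
    ⟨fundamentalCycle n, normBoundary_fundamentalCycle, stdCoeff_fundamentalCycle⟩
    fun _ hz h0 => exists_boundary_of_stdCoeff_eq_zero hz h0

end Greene

/-! ### Contractibility of cubes and the three-dimensional cube -/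

theorem cubeGraph_eq_or_adj_update {n : ℕ} (x : Fin n → Bool) (i : Fin n) (ε δ : Bool) :
    Function.update x i ε = Function.update x i δ ∨
      (cubeGraph n).Adj (Function.update x i ε) (Function.update x i δ) := by
  by_cases h : ε = δ
  · exact Or.inl (by rw [h])
  · exact Or.inr (cubeGraph_adj_update _ _ _ _ h)

/-- The graph map of the cube that sets the first `k` coordinates to zero. -/
def cubeCollapse (n k : ℕ) : GraphMap (cubeGraph n) (cubeGraph n) where
  toFun x i := if i.val < k then false else x i
  map_adj' := map_adj_of_coords _ fun x i => by
    have key : ∀ ε, (fun j : Fin n => if j.val < k then false else Function.update x i ε j) =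
        Function.update (fun j : Fin n => if j.val < k then false else x j) i
          (if i.val < k then false else ε) := fun ε => by
      funext j
      by_cases hj : j = i
      · subst hj
        simp
      · simp [hj]
    rw [key, key]
    exact cubeGraph_eq_or_adj_update _ _ _ _

theorem cubeCollapse_apply (n k : ℕ) (x : Fin n → Bool) (i : Fin n) :
    cubeCollapse n k x i = if i.val < k then false else x i := rfl

theorem isContractible_cubeGraph (n : ℕ) : IsContractible (cubeGraph n) := by
  refine ⟨fun _ => false, n, cubeCollapse n, ?_, ?_, fun k hk x => ?_⟩
  · refine DFunLike.ext _ _ fun x => funext fun i => ?_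
    simp only [cubeCollapse_apply, Nat.not_lt_zero, if_false]
    rfl
  · refine DFunLike.ext _ _ fun x => funext fun i => ?_
    simp only [cubeCollapse_apply, i.isLt, if_true]
    rfl
  · have e : cubeCollapse n (k + 1) x = Function.update (cubeCollapse n k x) ⟨k, hk⟩ false := by
      funext i
      by_cases hi : i = ⟨k, hk⟩
      · subst hi
        simp [cubeCollapse_apply]
      · have : i.val ≠ k := fun h => hi (Fin.ext h)
        simp only [Function.update_of_ne hi, cubeCollapse_apply]
        congr 1
        simp only [eq_iff_iff]
        omega
    rw [e]
    conv =>
      congr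
      · lhs
        rw [← Function.update_eq_self ⟨k, hk⟩ (cubeCollapse n k x)]
      · arg 2
        rw [← Function.update_eq_self ⟨k, hk⟩ (cubeCollapse n k x)]
    exact cubeGraph_eq_or_adj_update _ _ _ _

theorem IsContractible.of_iso {V : Type u} {W : Type v} {G : SimpleGraph V} {H : SimpleGraph W}
    (h : IsContractible H) (e : G ≃g H) : IsContractible G := by
  obtain ⟨v, m, f, h0, hm, hs⟩ := h
  let g : GraphMap G H := ⟨e, fun _ _ hxy => Or.inr (e.map_adj_iff.2 hxy)⟩
  let g' : GraphMap H G := ⟨e.symm, fun _ _ hxy => Or.inr (e.symm.map_adj_iff.2 hxy)⟩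
  have hg : ∀ k x, g'.comp ((f k).comp g) x = e.symm (f k (e x)) := fun _ _ => rfl
  refine ⟨e.symm v, m, fun k => g'.comp ((f k).comp g), ?_, ?_, fun k hk x => ?_⟩
  · refine DFunLike.ext _ _ fun x => ?_
    rw [hg, h0]
    exact e.symm_apply_apply x
  · refine DFunLike.ext _ _ fun x => ?_
    rw [hg, hm]
    rfl
  · rw [hg, hg]
    exact (hs k hk (e x)).imp (congrArg _) fun h => e.symm.map_adj_iff.2 h

instance decidableGreeneAdj (n : ℕ) : DecidableRel (greeneSphere n).Adj
  | Sum.inl a, Sum.inl b => inferInstanceAs (Decidable ((SimpleGraph.cycleGraph (2 * n)).Adj a b))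
  | Sum.inl a, Sum.inr w => inferInstanceAs (Decidable (if w then Odd a.val else Even a.val))
  | Sum.inr w, Sum.inl a => inferInstanceAs (Decidable (if w then Odd a.val else Even a.val))
  | Sum.inr _, Sum.inr _ => inferInstanceAs (Decidable False)

instance decidableCubeAdj (n : ℕ) : DecidableRel (cubeGraph n).Adj := fun x y =>
  inferInstanceAs (Decidable (∃ i, x i ≠ y i ∧ ∀ j, x j ≠ y j → j = i))

/-- The bijection between the vertices of the smallest Greene sphere graph and those of the
cube. -/
def greeneThreeMap : Fin (2 * 3) ⊕ Bool → (Fin 3 → Bool) :=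
  -- The hubs go to the opposite corners `000` and `111`, and the hexagon runs through the other six
  -- corners.
  Sum.elim ![![true, false, false], ![true, true, false], ![false, true, false],
    ![false, true, true], ![false, false, true], ![true, false, true]] fun w _ => w

set_option maxRecDepth 100000 in
theorem greeneThreeMap_bijective : Function.Bijective greeneThreeMap := by
  rw [Fintype.bijective_iff_injective_and_card]
  exact ⟨by decide, by simp⟩

set_option maxRecDepth 100000 in
theorem greeneThreeMap_adj : ∀ x y, (cubeGraph 3).Adj (greeneThreeMap x) (greeneThreeMap y) ↔
    (greeneSphere 3).Adj x y := by
  decide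

/-- The smallest Greene sphere graph is the three-dimensional cube. -/
noncomputable def greeneThreeIso : greeneSphere 3 ≃g cubeGraph 3 where
  toEquiv := Equiv.ofBijective greeneThreeMap greeneThreeMap_bijective
  map_rel_iff' := greeneThreeMap_adj _ _

/-! ### The third homology group -/

section Greene

variable {n : ℕ} [hn : Fact (4 ≤ n)]

theorem greene_gradedHomology_isZero (m : ℕ) : Limits.IsZero (gradedHomology (greeneSphere n) 3 m) :=
  gradedHomology_isZero (fun _ σ => Nat.lt_succ_of_le (greene_degree_le σ)) m

theorem greene_isIso_filtInclusion (m : ℕ) :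
    IsIso (HomologicalComplex.homologyMap (filtInclusion (greeneSphere n) 2) m) := by
  have := isIso_filtInclusion (G := greeneSphere n) (k := 2) fun _ σ => greene_degree_le σ
  infer_instance

theorem greene_exists_iso :
    ∃ e : cubicalHomology (greeneSphere n) 3 ≅ gradedHomology (greeneSphere n) 2 3,
      HomologicalComplex.homologyMap (filtInclusion (greeneSphere n) 2) 3 ≫ e.hom =
        HomologicalComplex.homologyMap (gradedProjection (greeneSphere n) 2) 3 := by
  have h1 := greene_isIso_filtInclusion (n := n) 3
  have h2 := isIso_homologyMap_gradedProjection (greeneColoring n) 0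
  exact ⟨(asIso (HomologicalComplex.homologyMap (filtInclusion (greeneSphere n) 2) 3)).symm ≪≫
    @asIso _ _ _ _ _ h2, by simp⟩

end Greene

/-! ### Multi-affine functions on the cubical complex -/

section Average

variable {V : Type u} {G : SimpleGraph V} {E : Type v} [AddCommGroup E] [Module ℝ E]

/-- The weight of an endpoint of the unit interval at a point. -/
def bitWeight (b : Bool) (t : unitInterval) : ℝ := if b then t else 1 - t

theorem bitWeight_not_symm (b : Bool) (t : unitInterval) :
    bitWeight (!b) (unitInterval.symm t) = bitWeight b t := by
  cases b <;> simp [bitWeight]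

/-- The multi-affine interpolation of a function on the vertices. -/
def cubeAverage (f : V → E) (p : CubePoints G) : E :=
  ∑ x : Fin p.1 → Bool, (∏ i, bitWeight (x i) (p.2.2 i)) • f (p.2.1.1 x)

/-- At an endpoint of a coordinate the weights of the opposite face vanish; permutations and
reflections of the coordinates only reindex the sum. -/
theorem cubeAverage_glue (f : V → E) {p q : CubePoints G} (h : Glue p q) :
    cubeAverage f p = cubeAverage f q := by
  cases h with
  | @face m σ i ε t =>
    simp only [cubeAverage]
    symm
    rw [← Equiv.sum_comp (Fin.insertNthEquiv (fun _ => Bool) i), Fintype.sum_prod_type,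
      Fintype.sum_bool]
    simp only [Fin.insertNthEquiv_apply, Fin.prod_univ_succAbove _ i, Fin.insertNth_apply_same,
      Fin.insertNth_apply_succAbove]
    cases ε <;> simp [bitWeight, endpoint, InjCube.face, SingCube.face_apply] <;> rfl
  | perm σ π t =>
    simp only [cubeAverage]
    rw [← Equiv.sum_comp (Equiv.arrowCongr π (Equiv.refl Bool))]
    refine Finset.sum_congr rfl fun x _ => ?_
    congr 1
    · rw [← Equiv.prod_comp π]
      simp
    · change f (σ.1 _) = f (σ.1 x)
      congr 2
      funext k
      simp
  | flip σ i t =>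
    simp only [cubeAverage]
    let e : (Fin _ → Bool) ≃ (Fin _ → Bool) :=
      { toFun := fun x => Function.update x i (!x i)
        invFun := fun x => Function.update x i (!x i)
        left_inv := fun x => by simp
        right_inv := fun x => by simp }
    rw [← Equiv.sum_comp e fun x =>
      (∏ j, bitWeight (x j) (Function.update t i (unitInterval.symm (t i)) j)) • f (σ.1 x)]
    refine Finset.sum_congr rfl fun x _ => ?_
    congr 1
    refine Finset.prod_congr rfl fun j _ => ?_
    by_cases hj : j = i
    · subst hj
      simp [e, bitWeight_not_symm]
    · simp [e, hj]

/-- The multi-affine interpolation of a function on the vertices, on the cubical complex. -/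
def cwAverage (f : V → E) : CWBox G → E :=
  Quot.lift (cubeAverage f) fun _ _ => cubeAverage_glue f

theorem continuous_cwAverage [TopologicalSpace E] [ContinuousAdd E] [ContinuousSMul ℝ E]
    (f : V → E) : Continuous (cwAverage (G := G) f) := by
  refine continuous_quot_lift _ ?_
  have hb : ∀ b, Continuous (bitWeight b) := fun b => by
    cases b
    · change Continuous fun t : unitInterval => (1 - t : ℝ)
      fun_prop
    · exact continuous_subtype_val
  refine continuous_sigma fun m => continuous_sigma fun σ => ?_
  have hw : ∀ x : Fin m → Bool,
      Continuous fun t : Fin m → unitInterval => ∏ i, bitWeight (x i) (t i) := fun x =>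
    continuous_finsetProd _ fun i _ => (hb _).comp (continuous_apply i)
  change Continuous fun t : Fin m → unitInterval =>
    ∑ x : Fin m → Bool, (∏ i, bitWeight (x i) (t i)) • f (σ.1 x)
  exact continuous_finsetSum _ fun x _ => (hw x).smul continuous_const

theorem cwAverage_two (f : V → E) (σ : InjCube G 2) (t : Fin 2 → unitInterval) :
    cwAverage f (Quot.mk _ ⟨2, σ, t⟩) =
      ((1 - t 0 : ℝ) * (1 - t 1)) • f (σ.1 (vec2 false false)) +
      ((t 0 : ℝ) * (1 - t 1)) • f (σ.1 (vec2 true false)) +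
      ((t 0 : ℝ) * t 1) • f (σ.1 (vec2 true true)) +
      ((1 - t 0 : ℝ) * t 1) • f (σ.1 (vec2 false true)) := by
  change cubeAverage f ⟨2, σ, t⟩ = _
  let e : Bool × Bool ≃ (Fin 2 → Bool) :=
    { toFun := fun p => vec2 p.1 p.2
      invFun := fun x => (x 0, x 1)
      left_inv := fun _ => rfl
      right_inv := fun x => (vec2_eta x).symm }
  have he : ∀ p, e p = vec2 p.1 p.2 := fun _ => rfl
  have hv : ∀ i j, vec2 i j 0 = i ∧ vec2 i j 1 = j := fun _ _ => ⟨rfl, rfl⟩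
  simp only [cubeAverage]
  rw [← Equiv.sum_comp e, Fintype.sum_prod_type]
  simp only [Fintype.sum_bool, Fin.prod_univ_two, he, (hv _ _).1, (hv _ _).2,
    bitWeight, if_true, Bool.false_eq_true, if_false]
  abel

end Average

/-! ### Points of the cubical complex of the Greene sphere graph -/

section Greene

open scoped Fin.CommRing

variable {n : ℕ} [hn : Fact (4 ≤ n)]

/-- A point of a solid cube, as a point of the cubical complex. -/
def cwMk {V : Type u} {G : SimpleGraph V} {m : ℕ} (σ : InjCube G m) (t : Fin m → unitInterval) :
    CWBox G := Quot.mk _ ⟨m, σ, t⟩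

section General

variable {V : Type u} {G : SimpleGraph V} {m : ℕ}

theorem cwMk_face (σ : InjCube G (m + 1)) (i : Fin (m + 1)) (ε : Bool)
    (t : Fin m → unitInterval) :
    cwMk (σ.face i ε) t = cwMk σ (i.insertNth (endpoint ε) t) :=
  Quot.sound (Glue.face σ i ε t)

theorem cwMk_perm (σ : InjCube G m) (π : Equiv.Perm (Fin m)) (t : Fin m → unitInterval) :
    cwMk (σ.perm π) t = cwMk σ (t ∘ π) :=
  Quot.sound (Glue.perm σ π t)

theorem cwMk_flip (σ : InjCube G m) (i : Fin m) (t : Fin m → unitInterval) :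
    cwMk (σ.flip i) t = cwMk σ (Function.update t i (unitInterval.symm (t i))) :=
  Quot.sound (Glue.flip σ i t)

theorem exists_cwMk_perm (σ : InjCube G m) (π : Equiv.Perm (Fin m)) (t : Fin m → unitInterval) :
    ∃ s, cwMk σ t = cwMk (σ.perm π) s :=
  ⟨t ∘ π.symm, by
    rw [cwMk_perm, Function.comp_assoc, Equiv.symm_comp_self, Function.comp_id]⟩

theorem exists_cwMk_flip (σ : InjCube G m) (i : Fin m) (t : Fin m → unitInterval) :
    ∃ s, cwMk σ t = cwMk (σ.flip i) s :=
  ⟨Function.update t i (unitInterval.symm (t i)), by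
    rw [cwMk_flip, Function.update_self, unitInterval.symm_symm, Function.update_idem,
      Function.update_eq_self]⟩

end General

/-- The standard squares as injective cubes. -/
def stdCube (c : Fin (2 * n)) : InjCube (greeneSphere n) 2 := ⟨stdSquare c, stdSquare_injective c⟩

/-- The points of the solid squares of the standard squares. -/
def stdPoint (p : Fin (2 * n) × (Fin 2 → unitInterval)) : CWBox (greeneSphere n) :=
  cwMk (stdCube p.1) p.2

theorem continuous_stdPoint : Continuous (stdPoint (n := n)) := by
  rw [continuous_prod_of_discrete_left]
  intro c
  exact continuous_quot_mk.comp <|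
    (continuous_sigmaMk (i := 2)
      (σ := fun m => Σ _ : InjCube (greeneSphere n) m, (Fin m → unitInterval))).comp
    (continuous_sigmaMk (i := stdCube c)
      (σ := fun _ : InjCube (greeneSphere n) 2 => Fin 2 → unitInterval))

theorem exists_stdPoint_two (σ : InjCube (greeneSphere n) 2) (t : Fin 2 → unitInterval) :
    ∃ p, cwMk σ t = stdPoint p := by
  refine stdSquare_induction (P := fun σ => ∀ h t, ∃ p, cwMk ⟨σ, h⟩ t = stdPoint p) ?_ ?_ ?_
    σ.1 σ.2 σ.2 t
  · exact fun c h t => ⟨(c, t), rfl⟩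
  · intro σ h hP h' t
    obtain ⟨s, hs⟩ := exists_cwMk_flip ⟨σ, h'⟩ 1 t
    obtain ⟨s', hs'⟩ := exists_cwMk_perm (InjCube.flip ⟨σ, h'⟩ 1) (Equiv.swap 0 1) s
    rw [hs, hs']
    exact hP (rot_injective h) s'
  · intro σ h hP h' t
    obtain ⟨s, hs⟩ := exists_cwMk_flip ⟨σ, h'⟩ 0 t
    rw [hs]
    exact hP (flip_injective h 0) s

theorem injCube_one_ext {V : Type u} {G : SimpleGraph V} {σ τ : InjCube G 1}
    (h0 : σ.1 (vec1 false) = τ.1 (vec1 false)) (h1 : σ.1 (vec1 true) = τ.1 (vec1 true)) : σ = τ :=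
  Subtype.ext <| singCube_one_ext fun i => by cases i <;> assumption

theorem injCube_zero_ext {V : Type u} {G : SimpleGraph V} {σ τ : InjCube G 0} (x y)
    (h : σ.1 x = τ.1 y) : σ = τ :=
  Subtype.ext <| DFunLike.ext _ _ fun z => by
    rw [Subsingleton.elim z x, h, Subsingleton.elim y x]

theorem stdCube_vec2 (c : Fin (2 * n)) :
    (stdCube c).1 (vec2 false false) = Sum.inr (!par c) ∧
    (stdCube c).1 (vec2 true false) = Sum.inl (c + 1) ∧
    (stdCube c).1 (vec2 true true) = Sum.inl c ∧
    (stdCube c).1 (vec2 false true) = Sum.inl (c - 1) :=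
  ⟨rfl, rfl, rfl, rfl⟩

theorem injFace_vec1_zero {V : Type u} {G : SimpleGraph V} (σ : InjCube G 2) (ε i : Bool) :
    (σ.face 0 ε).1 (vec1 i) = σ.1 (vec2 ε i) := face_zero_vec2 σ.1 ε i

theorem injFace_vec1_one {V : Type u} {G : SimpleGraph V} (σ : InjCube G 2) (ε i : Bool) :
    (σ.face 1 ε).1 (vec1 i) = σ.1 (vec2 i ε) := face_one_vec2 σ.1 ε i

theorem injFlip_vec1 {V : Type u} {G : SimpleGraph V} (σ : InjCube G 1) (i : Bool) :
    (σ.flip 0).1 (vec1 i) = σ.1 (vec1 (!i)) := by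
  change σ.1 _ = σ.1 _
  congr 1
  funext k
  fin_cases k
  rfl

theorem exists_stdPoint_one (σ : InjCube (greeneSphere n) 1) (t : Fin 1 → unitInterval) :
    ∃ p, cwMk σ t = stdPoint p := by
  have hadj : (greeneSphere n).Adj (σ.1 (vec1 false)) (σ.1 (vec1 true)) :=
    (σ.1.map_adj (vec1_adj false)).resolve_left fun e => (vec1_adj false).ne (σ.2 e)
  have hface : ∀ (c : Fin (2 * n)) i ε t, ∃ p, cwMk ((stdCube c).face i ε) t = stdPoint p :=
    fun c i ε t => ⟨(c, i.insertNth (endpoint ε) t), cwMk_face _ _ _ _⟩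
  have hflip : ∀ (c : Fin (2 * n)) i ε, σ.flip 0 = (stdCube c).face i ε →
      ∃ p, cwMk σ t = stdPoint p := fun c i ε h => by
    obtain ⟨s, hs⟩ := exists_cwMk_flip σ 0 t
    rw [hs, h]
    exact hface _ _ _ _
  cases ha : σ.1 (vec1 false) with
  | inr w =>
    rw [ha, greene_adj_inr_iff] at hadj
    obtain ⟨i, hi, rfl⟩ := hadj
    have : σ = (stdCube (i - 1)).face 1 false := injCube_one_ext
      (by rw [ha, injFace_vec1_one, (stdCube_vec2 _).1, par_sub_one, Bool.not_not])
      (by rw [hi, injFace_vec1_one, (stdCube_vec2 _).2.1, sub_add_cancel])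
    rw [this]
    exact hface _ _ _ _
  | inl i =>
    rw [ha, greene_adj_inl_iff] at hadj
    rcases hadj with hb | hb | hb
    · exact hflip i 0 true <| injCube_one_ext
        (by rw [injFlip_vec1, injFace_vec1_zero, (stdCube_vec2 _).2.1]; exact hb)
        (by rw [injFlip_vec1, injFace_vec1_zero, (stdCube_vec2 _).2.2.1]; exact ha)
    · have : σ = (stdCube (i - 1)).face 0 true := injCube_one_ext
        (by rw [ha, injFace_vec1_zero, (stdCube_vec2 _).2.1, sub_add_cancel])
        (by rw [hb, injFace_vec1_zero, (stdCube_vec2 _).2.2.1])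
      rw [this]
      exact hface _ _ _ _
    · exact hflip (i - 1) 1 false <| injCube_one_ext
        (by rw [injFlip_vec1, injFace_vec1_one, (stdCube_vec2 _).1, par_sub_one, Bool.not_not]
            exact hb)
        (by rw [injFlip_vec1, injFace_vec1_one, (stdCube_vec2 _).2.1, sub_add_cancel]; exact ha)

theorem exists_stdPoint_zero (σ : InjCube (greeneSphere n) 0) (t : Fin 0 → unitInterval) :
    ∃ p, cwMk σ t = stdPoint p := by
  have key : ∀ (c : Fin (2 * n)) i ε j δ, σ = ((stdCube c).face i ε).face j δ →
      ∃ p, cwMk σ t = stdPoint p := fun c i ε j δ h => by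
    rw [h, cwMk_face]
    exact exists_stdPoint_one _ _
  have hv : ∀ (τ : InjCube (greeneSphere n) 1) ε x, (τ.face 0 ε).1 x = τ.1 (vec1 ε) := by
    intro τ ε x
    change τ.1 _ = τ.1 _
    congr 1
    funext k
    fin_cases k
    rfl
  let x : Fin 0 → Bool := Fin.elim0
  cases ha : σ.1 x with
  | inl c =>
    exact key c 0 true 0 true <| injCube_zero_ext x x
      (by rw [ha, hv, injFace_vec1_zero, (stdCube_vec2 c).2.2.1])
  | inr w =>
    have : ∃ c : Fin (2 * n), (!par c) = w := by
      cases w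
      · exact ⟨1, by rw [← zero_add (1 : Fin (2 * n)), par_add_one]; simp [par]⟩
      · exact ⟨0, by simp [par]⟩
    obtain ⟨c, rfl⟩ := this
    exact key c 0 false 0 false <| injCube_zero_ext x x
      (by rw [ha, hv, injFace_vec1_zero, (stdCube_vec2 c).1])

/-- There are no cells of dimension above two, and every cell of smaller dimension lies on a
standard square. So the complex is the image of finitely many solid squares, which gives
compactness. -/
theorem stdPoint_surjective : Function.Surjective (stdPoint (n := n)) := by
  rintro ⟨m, σ, t⟩
  have hm := greene_le_two_of_injective σ.1 σ.2
  interval_cases m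
  · exact (exists_stdPoint_zero σ t).imp fun _ h => h.symm
  · exact (exists_stdPoint_one σ t).imp fun _ h => h.symm
  · exact (exists_stdPoint_two σ t).imp fun _ h => h.symm

theorem compactSpace_greene : CompactSpace (CWBox (greeneSphere n)) :=
  ⟨by
    rw [← stdPoint_surjective.range_eq]
    exact isCompact_range continuous_stdPoint⟩

/-- The point of a standard square with given real coordinates. -/
noncomputable def stdPt (c : Fin (2 * n)) (x y : ℝ) : CWBox (greeneSphere n) :=
  stdPoint (c, ![Set.projIcc 0 1 zero_le_one x, Set.projIcc 0 1 zero_le_one y])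

theorem exists_stdPt (p : CWBox (greeneSphere n)) :
    ∃ c x y, 0 ≤ x ∧ x ≤ 1 ∧ 0 ≤ y ∧ y ≤ 1 ∧ p = stdPt c x y := by
  obtain ⟨⟨c, t⟩, rfl⟩ := stdPoint_surjective p
  refine ⟨c, t 0, t 1, (t 0).2.1, (t 0).2.2, (t 1).2.1, (t 1).2.2, ?_⟩
  rw [stdPt, Set.projIcc_val, Set.projIcc_val]
  congr 2
  funext k
  fin_cases k <;> rfl

theorem stdPt_eq_face_zero (c : Fin (2 * n)) (ε : Bool) (y : ℝ) :
    stdPt c (if ε then 1 else 0) y =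
      cwMk ((stdCube c).face 0 ε) fun _ => Set.projIcc 0 1 zero_le_one y := by
  rw [cwMk_face, stdPt, stdPoint]
  congr 1
  funext k
  cases ε <;> fin_cases k <;> simp [endpoint]

theorem stdPt_eq_face_one (c : Fin (2 * n)) (ε : Bool) (x : ℝ) :
    stdPt c x (if ε then 1 else 0) =
      cwMk ((stdCube c).face 1 ε) fun _ => Set.projIcc 0 1 zero_le_one x := by
  rw [cwMk_face, stdPt, stdPoint]
  congr 1
  funext k
  cases ε <;> fin_cases k <;> simp [endpoint] <;> rfl

/-- The coordinates `(0,0)`, `(1,0)`, `(1,1)`, `(0,1)` in the square around `c` are the hub, `c +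
1`, `c` and `c - 1`. Both sides here are the spoke from the hub to `k`. -/
theorem stdPt_zero_left (k : Fin (2 * n)) (a : ℝ) : stdPt (k + 1) 0 a = stdPt (k - 1) a 0 := by
  have h0 := stdPt_eq_face_zero (k + 1) false a
  have h1 := stdPt_eq_face_one (k - 1) false a
  simp only [Bool.false_eq_true, if_false] at h0 h1
  rw [h0, h1]
  congr 1
  refine injCube_one_ext ?_ ?_
  · rw [injFace_vec1_zero, injFace_vec1_one, (stdCube_vec2 _).1, (stdCube_vec2 _).1, par_add_one,
      par_sub_one]
  · rw [injFace_vec1_zero, injFace_vec1_one, (stdCube_vec2 _).2.2.2, (stdCube_vec2 _).2.1,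
      add_sub_cancel_right, sub_add_cancel]

/-- Both are the cycle edge between `k` and `k + 1`, traversed in opposite directions by the two
squares. -/
theorem stdPt_one_left (k : Fin (2 * n)) (a : ℝ) :
    stdPt k 1 a = stdPt (k + 1) (1 - a) 1 := by
  have h0 := stdPt_eq_face_zero k true a
  have h1 := stdPt_eq_face_one (k + 1) true (1 - a)
  simp only [if_true] at h0 h1
  rw [h0, h1]
  have : (stdCube (k + 1)).face 1 true = ((stdCube k).face 0 true).flip 0 := by
    refine injCube_one_ext ?_ ?_
    · rw [injFlip_vec1, injFace_vec1_zero, injFace_vec1_one, (stdCube_vec2 _).2.2.2,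
        Bool.not_false, (stdCube_vec2 _).2.2.1, add_sub_cancel_right]
    · rw [injFlip_vec1, injFace_vec1_zero, injFace_vec1_one, (stdCube_vec2 _).2.2.1,
        Bool.not_true, (stdCube_vec2 _).2.1]
  rw [this, cwMk_flip]
  congr 1
  funext k
  obtain rfl := Fin.fin_one_eq_zero k
  rw [Function.update_self]
  refine Subtype.ext ?_
  rw [unitInterval.coe_symm_eq, Set.coe_projIcc, Set.coe_projIcc]
  simp only [max_def, min_def]
  split_ifs <;> linarith

theorem stdPt_zero_zero {k k' : Fin (2 * n)} (h : par k = par k') :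
    stdPt k 0 0 = stdPt k' 0 0 := by
  have key : ∀ c : Fin (2 * n), stdPt c 0 0 =
      cwMk (((stdCube c).face 0 false).face 0 false) fun _ => 0 := fun c => by
    have := stdPt_eq_face_zero c false 0
    simp only [Bool.false_eq_true, if_false] at this
    rw [this]
    refine Eq.trans ?_ (cwMk_face ((stdCube c).face 0 false) 0 false _).symm
    congr 1
    funext i
    fin_cases i
    simp [endpoint]
  rw [key, key]
  congr 1
  refine injCube_zero_ext (fun _ => false) (fun _ => false) ?_
  have hv : ∀ (τ : InjCube (greeneSphere n) 1) ε x, (τ.face 0 ε).1 x = τ.1 (vec1 ε) := by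
    intro τ ε x
    change τ.1 _ = τ.1 _
    congr 1
    funext k
    fin_cases k
    rfl
  rw [hv, hv, injFace_vec1_zero, injFace_vec1_zero, (stdCube_vec2 _).1, (stdCube_vec2 _).1, h]

/-- The points of the cubical complex as points of the triangles spanned by a hub and an edge of
the cycle, in barycentric coordinates. -/
noncomputable def triPt (w : Bool) (k : Fin (2 * n)) (a b : ℝ) : CWBox (greeneSphere n) :=
  -- The diagonal from the hub to the middle vertex cuts each standard square into two triangles.
  -- The triangle on the hub `w` and the edge from `k` to `k + 1` lies in the square around
  -- whichever of the two vertices is not adjacent to `w`.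
  if w = !par k then stdPt k (a + b) a else stdPt (k + 1) b (a + b)

theorem triPt_zero (w : Bool) (k k' : Fin (2 * n)) : triPt w k 0 0 = triPt w k' 0 0 := by
  have key : ∀ k, ∃ c : Fin (2 * n), par c = (!w) ∧ triPt w k 0 0 = stdPt c 0 0 := by
    intro k
    unfold triPt
    split_ifs with h
    · exact ⟨k, by rw [h, Bool.not_not], by rw [add_zero]⟩
    · exact ⟨k + 1, by rw [par_add_one, Bool.eq_not.2 h, Bool.not_not],
        by rw [add_zero]⟩
  obtain ⟨c, hc, e⟩ := key k
  obtain ⟨c', hc', e'⟩ := key k'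
  rw [e, e', stdPt_zero_zero (hc.trans hc'.symm)]

theorem triPt_succ (w : Bool) (k : Fin (2 * n)) (a : ℝ) :
    triPt w k 0 a = triPt w (k + 1) a 0 := by
  unfold triPt
  rw [par_add_one, Bool.not_not, zero_add, add_zero]
  by_cases h : w = par k
  · rw [if_neg (by rw [h]; simp), if_pos h]
  · rw [if_pos (Bool.eq_not.2 h), if_neg h, stdPt_zero_left, add_sub_cancel_right]

theorem triPt_of_add_eq_one (w w' : Bool) (k : Fin (2 * n)) {a b : ℝ} (h : a + b = 1) :
    triPt w k a b = triPt w' k a b := by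
  have key : stdPt k (a + b) a = stdPt (k + 1) b (a + b) := by
    rw [h, stdPt_one_left]
    congr 1
    linarith
  unfold triPt
  split_ifs
  exacts [rfl, key, key.symm, rfl]

/-- A side with `a = 0` is moved to the next triangle, so each triangle keeps only one of its
spokes. This normal form matches the half-open sectors of the plane, on which uniqueness holds. -/
theorem exists_triPt (p : CWBox (greeneSphere n)) : ∃ w k a b, 0 ≤ a ∧ 0 ≤ b ∧ a + b ≤ 1 ∧
    (0 < a ∨ a = 0 ∧ b = 0) ∧ p = triPt w k a b := by
  suffices h : ∃ w k a b, 0 ≤ a ∧ 0 ≤ b ∧ a + b ≤ 1 ∧ p = triPt w k a b by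
    obtain ⟨w, k, a, b, ha, hb, hab, rfl⟩ := h
    rcases ha.lt_or_eq with h | rfl
    · exact ⟨w, k, a, b, ha, hb, hab, Or.inl h, rfl⟩
    · rcases hb.lt_or_eq with h | rfl
      · exact ⟨w, k + 1, b, 0, hb, le_rfl, by linarith, Or.inl h, triPt_succ _ _ _⟩
      · exact ⟨w, k, 0, 0, le_rfl, le_rfl, hab, Or.inr ⟨rfl, rfl⟩, rfl⟩
  obtain ⟨c, x, y, hx, hx', hy, hy', rfl⟩ := exists_stdPt p
  rcases le_total y x with h | h
  · exact ⟨!par c, c, y, x - y, hy, by linarith, by linarith, by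
      rw [triPt, if_pos rfl, add_sub_cancel]⟩
  · refine ⟨!par c, c - 1, y - x, x, by linarith, hx, by linarith, ?_⟩
    rw [triPt, par_sub_one, Bool.not_not, if_neg (by simp), sub_add_cancel, sub_add_cancel]

end Greene

/-! ### The cubical complex of the Greene sphere graph is a sphere -/

section Greene

open scoped Fin.CommRing Real

variable {n : ℕ} [hn : Fact (4 ≤ n)]

/-- The vertices of a regular polygon in the complex plane. -/
noncomputable def polygonVertex (k : Fin (2 * n)) : ℂ :=
  Complex.exp ((k.val * (π / n) : ℝ) * Complex.I)

theorem sector_angle (n : ℕ) [hn : Fact (4 ≤ n)] : 0 < π / n ∧ π / n < π ∧ n * (π / n) = π := by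
  have h4 : (4 : ℝ) ≤ n := by exact_mod_cast hn.out
  have h0 : (0 : ℝ) < n := by linarith
  refine ⟨by positivity, ?_, by field_simp⟩
  rw [div_lt_iff₀ h0]
  nlinarith [Real.pi_pos]

theorem polygonVertex_succ (k : Fin (2 * n)) :
    polygonVertex (k + 1) = polygonVertex k * Complex.exp ((π / n : ℝ) * Complex.I) := by
  have h4 := hn.out
  have hk := k.isLt
  have h1 : ((1 : Fin (2 * n)) : ℕ) = 1 := by
    rw [Fin.val_one', Nat.mod_eq_of_lt (by omega)]
  rw [polygonVertex, polygonVertex, ← Complex.exp_add, Fin.val_add, h1]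
  by_cases h : k.val + 1 < 2 * n
  · rw [Nat.mod_eq_of_lt h]
    congr 1
    push_cast
    ring
  · have e : k.val + 1 = 2 * n := by omega
    have e' : (k.val : ℝ) = 2 * n - 1 := by
      have : ((k.val + 1 : ℕ) : ℝ) = (2 * n : ℕ) := by rw [e]
      push_cast at this
      linarith
    rw [e, Nat.mod_self, e', ← add_mul, ← Complex.ofReal_add]
    have : (2 * n - 1) * (π / n) + π / n = 2 * π := by
      have := (sector_angle n).2.2
      linear_combination 2 * this
    rw [this]
    simp [Complex.exp_two_pi_mul_I]

theorem sector_polar {φ a b : ℝ} (hφ : 0 < φ) (hφ' : φ < π) (ha : 0 < a) (hb : 0 ≤ b) :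
    ∃ r δ : ℝ, 0 < r ∧ 0 ≤ δ ∧ δ < φ ∧
      (a + b * Complex.exp (φ * Complex.I) : ℂ) = r * Complex.exp (δ * Complex.I) := by
  set z : ℂ := a + b * Complex.exp (φ * Complex.I) with hz
  have hs := Real.sin_pos_of_pos_of_lt_pi hφ hφ'
  have hre : z.re = a + b * Real.cos φ := by
    simp [hz, Complex.exp_ofReal_mul_I_re, Complex.exp_ofReal_mul_I_im]
  have him : z.im = b * Real.sin φ := by
    simp [hz, Complex.exp_ofReal_mul_I_re, Complex.exp_ofReal_mul_I_im]
  have hpol := Complex.norm_mul_exp_arg_mul_I z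
  have hre' : ‖z‖ * Real.cos z.arg = z.re := Complex.norm_mul_cos_arg z
  have him' : ‖z‖ * Real.sin z.arg = z.im := Complex.norm_mul_sin_arg z
  -- Rotating `z` by `-φ` gives a vector of imaginary part `-a sin φ < 0`, so its argument cannot
  -- reach `φ`.
  have hneg : ‖z‖ * Real.sin (z.arg - φ) < 0 := by
    rw [Real.sin_sub]
    have : ‖z‖ * (Real.sin z.arg * Real.cos φ - Real.cos z.arg * Real.sin φ) =
        -(a * Real.sin φ) := by
      linear_combination Real.cos φ * (him'.trans him) - Real.sin φ * (hre'.trans hre)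
    rw [this]
    have := mul_pos ha hs
    linarith
  have hr : 0 < ‖z‖ := by
    refine (norm_nonneg z).lt_of_ne fun h => ?_
    rw [← h, zero_mul] at hneg
    exact lt_irrefl _ hneg
  refine ⟨‖z‖, z.arg, hr, Complex.arg_nonneg_iff.2 (him ▸ mul_nonneg hb hs.le), ?_, hpol.symm⟩
  by_contra hc
  have := Real.sin_nonneg_of_nonneg_of_le_pi (x := z.arg - φ) (by linarith)
    (by have := Complex.arg_le_pi z; linarith)
  exact absurd (mul_nonneg hr.le this) (not_le.2 hneg)

theorem polar_unique {r r' θ θ' : ℝ} (hr : 0 < r) (hr' : 0 < r') (h0 : 0 ≤ θ) (h1 : θ < 2 * π)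
    (h0' : 0 ≤ θ') (h1' : θ' < 2 * π)
    (h : (r * Complex.exp (θ * Complex.I) : ℂ) = r' * Complex.exp (θ' * Complex.I)) : θ = θ' := by
  have hn := congrArg norm h
  simp only [norm_mul, Complex.norm_exp_ofReal_mul_I, mul_one, Complex.norm_real,
    Real.norm_eq_abs, abs_of_pos hr, abs_of_pos hr'] at hn
  subst hn
  have h2 := mul_left_cancel₀ (Complex.ofReal_ne_zero.2 hr.ne') h
  obtain ⟨m, hm⟩ := Complex.exp_eq_exp_iff_exists_int.1 h2
  have h3 : θ = θ' + m * (2 * π) := by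
    have := congrArg Complex.im hm
    simpa using this
  have hπ := Real.pi_pos
  have hm0 : m = 0 := by
    have k1 : (m : ℝ) < 1 := by
      by_contra hc
      nlinarith
    have k2 : (-1 : ℝ) < m := by
      by_contra hc
      nlinarith
    have k1' : m < 1 := by exact_mod_cast k1
    have k2' : -1 < m := by exact_mod_cast k2
    omega
  rw [h3, hm0]
  simp

theorem add_smul_polygonVertex (k : Fin (2 * n)) (a b : ℝ) :
    (a * polygonVertex k + b * polygonVertex (k + 1) : ℂ) =
      polygonVertex k * (a + b * Complex.exp ((π / n : ℝ) * Complex.I)) := by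
  rw [polygonVertex_succ]
  ring

theorem sector_angle_lt (k : Fin (2 * n)) {δ : ℝ} (h0 : 0 ≤ δ) (h1 : δ < π / n) :
    0 ≤ k.val * (π / n) + δ ∧ k.val * (π / n) + δ < 2 * π := by
  obtain ⟨p1, -, p3⟩ := sector_angle n
  have hk : (k.val : ℝ) + 1 ≤ 2 * n := by exact_mod_cast k.isLt
  constructor
  · positivity
  · nlinarith

/-- The half-open sectors between consecutive polygon vertices partition the punctured plane: the
argument determines `k`, and linear independence of the two vertices determines the coefficients. -/
theorem sector_unique {k k' : Fin (2 * n)} {a b a' b' : ℝ} (ha : 0 < a) (hb : 0 ≤ b)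
    (ha' : 0 < a') (hb' : 0 ≤ b')
    (h : (a * polygonVertex k + b * polygonVertex (k + 1) : ℂ) =
      a' * polygonVertex k' + b' * polygonVertex (k' + 1)) : k = k' ∧ a = a' ∧ b = b' := by
  obtain ⟨p1, p2, p3⟩ := sector_angle n
  have h' := h
  rw [add_smul_polygonVertex, add_smul_polygonVertex] at h
  obtain ⟨r, δ, hr, hδ0, hδ1, e⟩ := sector_polar p1 p2 ha hb
  obtain ⟨r', δ', hr', hδ0', hδ1', e'⟩ := sector_polar p1 p2 ha' hb'
  have hmul : ∀ (k : Fin (2 * n)) (r δ : ℝ),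
      polygonVertex k * (r * Complex.exp (δ * Complex.I)) =
        r * Complex.exp ((k.val * (π / n) + δ : ℝ) * Complex.I) := by
    intro k r δ
    rw [polygonVertex, Complex.ofReal_add, add_mul, Complex.exp_add]
    ring
  rw [e, e', hmul, hmul] at h
  obtain ⟨l1, l2⟩ := sector_angle_lt k hδ0 hδ1
  obtain ⟨l1', l2'⟩ := sector_angle_lt k' hδ0' hδ1'
  have hθ := polar_unique hr hr' l1 l2 l1' l2' h
  have hk : k = k' := by
    have k1 : (k.val : ℝ) < k'.val + 1 := by
      by_contra hc
      nlinarith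
    have k2 : (k'.val : ℝ) < k.val + 1 := by
      by_contra hc
      nlinarith
    have k1' : k.val < k'.val + 1 := by exact_mod_cast k1
    have k2' : k'.val < k.val + 1 := by exact_mod_cast k2
    exact Fin.ext (by omega)
  subst hk
  rw [add_smul_polygonVertex, add_smul_polygonVertex] at h'
  have h2 := mul_left_cancel₀ (Complex.exp_ne_zero _) h'
  have hs := Real.sin_pos_of_pos_of_lt_pi p1 p2
  have him := congrArg Complex.im h2
  have hre := congrArg Complex.re h2
  simp only [Complex.add_im, Complex.add_re, Complex.re_ofReal_mul, Complex.im_ofReal_mul,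
    Complex.ofReal_im, Complex.ofReal_re, Complex.exp_ofReal_mul_I_re,
    Complex.exp_ofReal_mul_I_im, zero_add] at him hre
  have hbb := mul_right_cancel₀ hs.ne' him
  subst hbb
  exact ⟨rfl, by linarith, rfl⟩

theorem sector_ne_zero {k : Fin (2 * n)} {a b : ℝ} (ha : 0 < a) (hb : 0 ≤ b) :
    (a * polygonVertex k + b * polygonVertex (k + 1) : ℂ) ≠ 0 := by
  obtain ⟨p1, p2, -⟩ := sector_angle n
  obtain ⟨r, δ, hr, -, -, e⟩ := sector_polar p1 p2 ha hb
  rw [add_smul_polygonVertex, e]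
  exact mul_ne_zero (Complex.exp_ne_zero _)
    (mul_ne_zero (Complex.ofReal_ne_zero.2 hr.ne') (Complex.exp_ne_zero _))

theorem exists_sector (z : ℂ) : ∃ (k : Fin (2 * n)) (a b : ℝ), 0 ≤ a ∧ 0 ≤ b ∧
    z = a * polygonVertex k + b * polygonVertex (k + 1) := by
  obtain ⟨p1, p2, p3⟩ := sector_angle n
  have hπ := Real.pi_pos
  obtain ⟨θ, h0, h1, hz⟩ : ∃ θ : ℝ, 0 ≤ θ ∧ θ < 2 * π ∧
      z = ‖z‖ * Complex.exp (θ * Complex.I) := by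
    have hz := (Complex.norm_mul_exp_arg_mul_I z).symm
    by_cases h : 0 ≤ z.arg
    · exact ⟨z.arg, h, by have := Complex.arg_le_pi z; linarith, hz⟩
    · refine ⟨z.arg + 2 * π, by have := Complex.neg_pi_lt_arg z; linarith, by linarith, ?_⟩
      rw [Complex.ofReal_add, add_mul, Complex.exp_add]
      push_cast
      rw [Complex.exp_two_pi_mul_I, mul_one]
      exact hz
  have hd : 0 ≤ θ / (π / n) := by positivity
  have hk : ⌊θ / (π / n)⌋₊ < 2 * n := by
    rw [Nat.floor_lt hd, div_lt_iff₀ p1]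
    push_cast
    linarith
  have hfl := Nat.floor_le hd
  have hfl' := Nat.lt_floor_add_one (θ / (π / n))
  rw [le_div_iff₀ p1] at hfl
  rw [div_lt_iff₀ p1] at hfl'
  set δ := θ - ⌊θ / (π / n)⌋₊ * (π / n) with hδ
  have hδ0 : 0 ≤ δ := by linarith
  have hδ1 : δ < π / n := by linarith
  have hs := Real.sin_pos_of_pos_of_lt_pi p1 p2
  -- The sector index is the integer part of the argument in units of `π / n`, and the coefficients
  -- come from the law of sines.
  refine ⟨⟨_, hk⟩, ‖z‖ * Real.sin (π / n - δ) / Real.sin (π / n),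
    ‖z‖ * Real.sin δ / Real.sin (π / n), ?_, ?_, ?_⟩
  · have := Real.sin_nonneg_of_nonneg_of_le_pi (x := π / n - δ) (by linarith) (by linarith)
    positivity
  · have := Real.sin_nonneg_of_nonneg_of_le_pi hδ0 (by linarith)
    positivity
  · rw [add_smul_polygonVertex, polygonVertex]
    have hθ : θ = ⌊θ / (π / n)⌋₊ * (π / n) + δ := by rw [hδ]; ring
    conv_lhs => rw [hz, hθ, Complex.ofReal_add, add_mul, Complex.exp_add, mul_left_comm]
    congr 1
    refine Complex.ext ?_ ?_
    · simp only [Complex.add_re, Complex.re_ofReal_mul, Complex.ofReal_re,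
        Complex.exp_ofReal_mul_I_re]
      rw [Real.sin_sub]
      field_simp
      ring
    · simp only [Complex.add_im, Complex.im_ofReal_mul, Complex.ofReal_im,
        Complex.exp_ofReal_mul_I_im]
      field_simp
      ring

/-- The positions of the vertices of a bipyramid. -/
noncomputable def vertexPos : Fin (2 * n) ⊕ Bool → EuclideanSpace ℝ (Fin 3) :=
  Sum.elim (fun k => !₂[(polygonVertex k).re, (polygonVertex k).im, 0])
    fun w => !₂[0, 0, if w then 1 else -1]

/-- The correction folding the square around a vertex of the cycle along its diagonal. -/
noncomputable def foldVector (c : Fin (2 * n)) : EuclideanSpace ℝ (Fin 3) :=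
  vertexPos (Sum.inl c) + vertexPos (n := n) (Sum.inr (!par c)) - vertexPos (Sum.inl (c + 1)) -
    vertexPos (Sum.inl (c - 1))

/-- The realization of the cubical complex as the surface of a bipyramid. -/
noncomputable def bipyramid (p : CWBox (greeneSphere n)) : EuclideanSpace ℝ (Fin 3) :=
  -- In the square around `c` the weights of `c ± 1` are `x (1 - y)` and `(1 - x) y`, with minimum
  -- `min x y - x y`. Adding this multiple of `foldVector c` makes the bilinear map affine on both
  -- sides of the diagonal. Since all functions are defined on the whole complex, no compatibility
  -- along the sides has to be checked.
  cwAverage vertexPos p + ∑ c : Fin (2 * n),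
    min (cwAverage (Pi.single (Sum.inl (c + 1)) (1 : ℝ)) p)
      (cwAverage (Pi.single (Sum.inl (c - 1)) (1 : ℝ)) p) • foldVector c

theorem continuous_bipyramid : Continuous (bipyramid (n := n)) :=
  (continuous_cwAverage _).add <| continuous_finsetSum _ fun c _ =>
    ((continuous_cwAverage (Pi.single (Sum.inl (c + 1)) (1 : ℝ))).min
      (continuous_cwAverage (Pi.single (Sum.inl (c - 1)) (1 : ℝ)))).smul
      (continuous_const (y := foldVector c))

theorem cwAverage_stdPt {E : Type*} [AddCommGroup E] [Module ℝ E] (f : Fin (2 * n) ⊕ Bool → E)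
    (c : Fin (2 * n)) {x y : ℝ} (hx : 0 ≤ x) (hx' : x ≤ 1) (hy : 0 ≤ y) (hy' : y ≤ 1) :
    cwAverage f (stdPt c x y) = ((1 - x) * (1 - y)) • f (Sum.inr (!par c)) +
      (x * (1 - y)) • f (Sum.inl (c + 1)) + (x * y) • f (Sum.inl c) +
      ((1 - x) * y) • f (Sum.inl (c - 1)) := by
  rw [stdPt, stdPoint, cwMk, cwAverage_two]
  simp only [stdCube_vec2, Matrix.cons_val_zero, Matrix.cons_val_one,
    Set.projIcc_of_mem _ (show x ∈ Set.Icc (0 : ℝ) 1 from ⟨hx, hx'⟩),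
    Set.projIcc_of_mem _ (show y ∈ Set.Icc (0 : ℝ) 1 from ⟨hy, hy'⟩)]

theorem bipyramid_stdPt (c : Fin (2 * n)) {x y : ℝ} (hx : 0 ≤ x) (hx' : x ≤ 1) (hy : 0 ≤ y)
    (hy' : y ≤ 1) :
    bipyramid (stdPt c x y) = (1 - x - y + min x y) • vertexPos (n := n) (Sum.inr (!par c)) +
      min x y • vertexPos (Sum.inl c) + (x - min x y) • vertexPos (Sum.inl (c + 1)) +
      (y - min x y) • vertexPos (Sum.inl (c - 1)) := by
  obtain ⟨f1, f2, f3, f4, -⟩ := fin_ne n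
  have hx1 : 0 ≤ 1 - x := by linarith
  have hy1 : 0 ≤ 1 - y := by linarith
  have havg : ∀ k : Fin (2 * n), cwAverage (Pi.single (Sum.inl k) (1 : ℝ)) (stdPt c x y) =
      (if c + 1 = k then x * (1 - y) else 0) + (if c = k then x * y else 0) +
        (if c - 1 = k then (1 - x) * y else 0) := by
    intro k
    rw [cwAverage_stdPt _ c hx hx' hy hy']
    simp only [Pi.single_apply, Sum.inl.injEq, reduceCtorEq, if_false, smul_eq_mul, mul_zero,
      zero_add, mul_ite, mul_one]
  rw [bipyramid, cwAverage_stdPt _ c hx hx' hy hy', Finset.sum_eq_single c]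
  · rw [havg, havg, if_pos rfl, if_pos rfl, if_neg fun h => f1 (by linear_combination -h),
      if_neg fun h => f2 (by linear_combination -h), if_neg fun h => f2 (by linear_combination h),
      if_neg fun h => f1 (by linear_combination h)]
    have hmin : min (x * (1 - y) + 0 + 0) (0 + 0 + (1 - x) * y) = min x y - x * y := by
      rw [← min_sub_sub_right]
      congr 1 <;> ring
    rw [hmin, foldVector]
    module
  · intro c' _ hc'
    -- The cycle vertices of the square around `c` are `c - 1`, `c` and `c + 1`; both `c' + 1` and
    -- `c' - 1` are among them only if `c' = c`.
    have hz : cwAverage (Pi.single (Sum.inl (c' + 1)) (1 : ℝ)) (stdPt c x y) = 0 ∨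
        cwAverage (Pi.single (Sum.inl (c' - 1)) (1 : ℝ)) (stdPt c x y) = 0 := by
      rw [havg, havg]
      by_cases h1 : c = c' + 1
      · right
        rw [if_neg fun h => f3 (by linear_combination h - h1),
          if_neg fun h => f2 (by linear_combination h - h1),
          if_neg fun h => f1 (by linear_combination h - h1)]
        simp
      by_cases h2 : c - 1 = c' + 1
      · right
        rw [if_neg fun h => f4 (by linear_combination h - h2),
          if_neg fun h => f3 (by linear_combination h - h2),
          if_neg fun h => f2 (by linear_combination h - h2)]
        simp
      · left
        rw [if_neg h1, if_neg h2, if_neg fun h => hc' (by linear_combination -h)]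
        simp
    have hnn : ∀ k : Fin (2 * n),
        0 ≤ cwAverage (Pi.single (Sum.inl k) (1 : ℝ)) (stdPt c x y) := by
      intro k
      rw [havg]
      split_ifs <;> positivity
    rcases hz with h | h
    · rw [h, min_eq_left (hnn _), zero_smul]
    · rw [h, min_eq_right (hnn _), zero_smul]
  · simp

theorem bipyramid_triPt (w : Bool) (k : Fin (2 * n)) {a b : ℝ} (ha : 0 ≤ a) (hb : 0 ≤ b)
    (hab : a + b ≤ 1) : bipyramid (triPt w k a b) = (1 - a - b) • vertexPos (n := n) (Sum.inr w) +
      a • vertexPos (Sum.inl k) + b • vertexPos (Sum.inl (k + 1)) := by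
  unfold triPt
  split_ifs with h
  · rw [bipyramid_stdPt k (by linarith) hab ha (by linarith), min_eq_right (by linarith), ← h]
    module
  · rw [bipyramid_stdPt (k + 1) hb (by linarith) (by linarith) hab, min_eq_left (by linarith),
      par_add_one, add_sub_cancel_right k 1, ← Bool.eq_not.2 h]
    module

/-- The horizontal part of a vector. -/
def horizontal (v : EuclideanSpace ℝ (Fin 3)) : ℂ := ⟨v 0, v 1⟩

theorem horizontal_triPt (w : Bool) (k : Fin (2 * n)) {a b : ℝ} (ha : 0 ≤ a) (hb : 0 ≤ b)
    (hab : a + b ≤ 1) : horizontal (bipyramid (triPt w k a b)) =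
      a * polygonVertex k + b * polygonVertex (k + 1) := by
  rw [bipyramid_triPt w k ha hb hab]
  refine Complex.ext ?_ ?_ <;> simp [horizontal, vertexPos]

theorem bipyramid_triPt_two (w : Bool) (k : Fin (2 * n)) {a b : ℝ} (ha : 0 ≤ a) (hb : 0 ≤ b)
    (hab : a + b ≤ 1) : bipyramid (triPt w k a b) 2 = (1 - a - b) * if w then 1 else -1 := by
  rw [bipyramid_triPt w k ha hb hab]
  simp [vertexPos]

theorem horizontal_smul (c : ℝ) (v : EuclideanSpace ℝ (Fin 3)) :
    horizontal (c • v) = c * horizontal v := by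
  refine Complex.ext ?_ ?_ <;> simp [horizontal]

/-- Each ray from the origin meets the bipyramid once: the horizontal part determines the sector and
two coordinates up to scale, and the height determines the third coordinate and, off the equator,
the hub. -/
theorem eq_of_bipyramid_eq_smul {p q : CWBox (greeneSphere n)} {c : ℝ} (hc : 0 < c)
    (h : bipyramid p = c • bipyramid q) : p = q := by
  obtain ⟨w, k, a, b, ha, hb, hab, hp, rfl⟩ := exists_triPt p
  obtain ⟨w', k', a', b', ha', hb', hab', hq, rfl⟩ := exists_triPt q
  have h1 := congrArg horizontal h
  have h2 : bipyramid (triPt w k a b) 2 = c * bipyramid (triPt w' k' a' b') 2 := by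
    rw [h]
    rfl
  rw [horizontal_smul, horizontal_triPt w k ha hb hab, horizontal_triPt w' k' ha' hb' hab',
    mul_add, ← mul_assoc, ← mul_assoc, ← Complex.ofReal_mul, ← Complex.ofReal_mul] at h1
  rw [bipyramid_triPt_two w k ha hb hab, bipyramid_triPt_two w' k' ha' hb' hab'] at h2
  rcases hp with hp | ⟨rfl, rfl⟩ <;> rcases hq with hq | ⟨rfl, rfl⟩
  · obtain ⟨rfl, e1, e2⟩ := sector_unique hp hb (mul_pos hc hq) (mul_nonneg hc.le hb') h1
    have h3 : 1 - a - b = c * (1 - a' - b') := by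
      have h4 := congrArg abs h2
      have hw : ∀ w : Bool, |(if w then 1 else -1 : ℝ)| = 1 := fun w => by cases w <;> simp
      rwa [abs_mul, abs_mul, abs_mul, hw, hw, mul_one, mul_one, abs_of_nonneg (by linarith),
        abs_of_pos hc, abs_of_nonneg (by linarith)] at h4
    -- Barycentric coordinates sum to one on both sides.
    have hc1 : c = 1 := by nlinarith
    subst hc1
    rw [one_mul] at e1 e2 h2
    subst e1 e2
    by_cases hab1 : a + b = 1
    · exact triPt_of_add_eq_one w w' k hab1
    · have hne : 1 - a - b ≠ 0 := fun h => hab1 (by linarith)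
      have hw := mul_left_cancel₀ hne h2
      have : w = w' := by
        cases w <;> cases w' <;> first | rfl | (norm_num at hw)
      rw [this]
  · exact (sector_ne_zero hp hb (h1.trans (by simp))).elim
  · exact (sector_ne_zero (mul_pos hc hq) (mul_nonneg hc.le hb')
      (h1.symm.trans (by simp))).elim
  · have : w = w' := by
      cases w <;> cases w' <;> first | rfl | (norm_num at h2; linarith)
    rw [this]
    exact triPt_zero _ _ _

theorem bipyramid_ne_zero (p : CWBox (greeneSphere n)) : bipyramid p ≠ 0 := by
  obtain ⟨w, k, a, b, ha, hb, hab, hp, rfl⟩ := exists_triPt p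
  intro h
  rcases hp with hp | ⟨rfl, rfl⟩
  · refine sector_ne_zero (k := k) hp hb ?_
    rw [← horizontal_triPt w k ha hb hab, h]
    exact Complex.ext rfl rfl
  · have := bipyramid_triPt_two w k ha hb hab
    rw [h] at this
    cases w <;> norm_num at this

theorem exists_bipyramid_eq_smul {v : EuclideanSpace ℝ (Fin 3)} (hv : v ≠ 0) :
    ∃ (p : CWBox (greeneSphere n)) (c : ℝ), 0 < c ∧ bipyramid p = c • v := by
  obtain ⟨k, a, b, ha, hb, h⟩ := exists_sector (n := n) (horizontal v)
  have hN : 0 < a + b + |v 2| := by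
    have := abs_nonneg (v 2)
    by_contra hc
    have h2 : v 2 = 0 := abs_eq_zero.1 (by linarith)
    have h3 : a = 0 := by linarith
    have h4 : b = 0 := by linarith
    have h5 : horizontal v = 0 := by rw [h, h3, h4]; simp
    refine hv ?_
    ext i
    fin_cases i
    · exact congrArg Complex.re h5
    · exact congrArg Complex.im h5
    · exact h2
  -- This is the gauge of the bipyramid at `v`: dividing by it makes the coefficients of the two
  -- polygon vertices and of the hub sum to one.
  set N := a + b + |v 2| with hNdef
  have hw : |v 2| * (if decide (0 ≤ v 2) then 1 else -1) = v 2 := by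
    by_cases h0 : 0 ≤ v 2
    · simp [h0, abs_of_nonneg h0]
    · simp [h0, abs_of_neg (not_le.1 h0)]
  have ha' : 0 ≤ N⁻¹ * a := by positivity
  have hb' : 0 ≤ N⁻¹ * b := by positivity
  have hsum : 1 - N⁻¹ * a - N⁻¹ * b = N⁻¹ * |v 2| := by
    have : N⁻¹ * N = 1 := inv_mul_cancel₀ hN.ne'
    rw [hNdef] at this ⊢
    linear_combination -this
  have hab' : N⁻¹ * a + N⁻¹ * b ≤ 1 := by
    have : 0 ≤ N⁻¹ * |v 2| := by positivity
    linarith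
  refine ⟨triPt (decide (0 ≤ v 2)) k (N⁻¹ * a) (N⁻¹ * b), N⁻¹, by positivity, ?_⟩
  have h1 := horizontal_triPt (decide (0 ≤ v 2)) k ha' hb' hab'
  have h2 := bipyramid_triPt_two (decide (0 ≤ v 2)) k ha' hb' hab'
  rw [hsum, mul_assoc, hw] at h2
  have h3 : horizontal (bipyramid (triPt (decide (0 ≤ v 2)) k (N⁻¹ * a) (N⁻¹ * b))) =
      horizontal (N⁻¹ • v) := by
    rw [h1, horizontal_smul, h]
    push_cast
    ring
  ext i
  fin_cases i
  · exact congrArg Complex.re h3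
  · exact congrArg Complex.im h3
  · exact h2

/-- The homeomorphism type of the cubical complex of the Greene sphere graph. -/
theorem greene_homeomorph_sphere :
    Nonempty (CWBox (greeneSphere n) ≃ₜ Metric.sphere (0 : EuclideanSpace ℝ (Fin 3)) 1) := by
  have hnorm : ∀ p : CWBox (greeneSphere n), 0 < ‖bipyramid p‖ := fun p =>
    norm_pos_iff.2 (bipyramid_ne_zero p)
  -- Radial projection of the bipyramid onto the unit sphere.
  let Φ : CWBox (greeneSphere n) → Metric.sphere (0 : EuclideanSpace ℝ (Fin 3)) 1 := fun p =>
    ⟨‖bipyramid p‖⁻¹ • bipyramid p, by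
      rw [mem_sphere_zero_iff_norm, norm_smul, norm_inv, norm_norm,
        inv_mul_cancel₀ (hnorm p).ne']⟩
  have hΦ : Continuous Φ := Continuous.subtype_mk
    ((continuous_bipyramid.norm.inv₀ fun p => (hnorm p).ne').smul continuous_bipyramid) _
  have hinj : Function.Injective Φ := by
    intro p q h
    have h1 : ‖bipyramid p‖⁻¹ • bipyramid p = ‖bipyramid q‖⁻¹ • bipyramid q :=
      congrArg Subtype.val h
    refine eq_of_bipyramid_eq_smul (c := ‖bipyramid p‖ * ‖bipyramid q‖⁻¹)
      (mul_pos (hnorm p) (inv_pos.2 (hnorm q))) ?_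
    rw [mul_smul, ← h1, smul_smul, mul_inv_cancel₀ (hnorm p).ne', one_smul]
  have hsurj : Function.Surjective Φ := by
    rintro ⟨v, hv⟩
    rw [mem_sphere_zero_iff_norm] at hv
    obtain ⟨p, c, hc, h⟩ := exists_bipyramid_eq_smul (n := n) (v := v)
      (norm_ne_zero_iff.1 (by rw [hv]; exact one_ne_zero))
    refine ⟨p, Subtype.ext ?_⟩
    change ‖bipyramid p‖⁻¹ • bipyramid p = v
    rw [h, norm_smul, hv, mul_one, Real.norm_of_nonneg hc.le, smul_smul, inv_mul_cancel₀ hc.ne',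
      one_smul]
  have := compactSpace_greene (n := n)
  exact ⟨hΦ.homeoOfEquivCompactToT2 (f := Equiv.ofBijective Φ ⟨hinj, hsurj⟩)⟩

end Greene

end DiscreteCubical

theorem mainTheorem6 :
    (∀ n : ℕ, 4 ≤ n →
      Nonempty (CWBox (greeneSphere n) ≃ₜ Metric.sphere (0 : EuclideanSpace ℝ (Fin 3)) 1) ∧
      (greeneSphere n).CliqueFree 3 ∧
      HasCubicalDimension (greeneSphere n) 2 ∧
      IsMonophobic (greeneSphere n) 2 ∧
      (∀ m : ℕ, IsQuasimonophobic (greeneSphere n) m) ∧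
      Nonempty (cubicalHomology (greeneSphere n) 2 ≃ₗ[ℤ] ℤ) ∧
      Limits.IsZero (gradedHomology (greeneSphere n) 3 3) ∧
      Limits.IsZero (gradedHomology (greeneSphere n) 3 4) ∧
      IsIso (HomologicalComplex.homologyMap (filtInclusion (greeneSphere n) 2) 3) ∧
      ∃ e : cubicalHomology (greeneSphere n) 3 ≅ gradedHomology (greeneSphere n) 2 3,
        HomologicalComplex.homologyMap (filtInclusion (greeneSphere n) 2) 3 ≫ e.hom =
          HomologicalComplex.homologyMap (gradedProjection (greeneSphere n) 2) 3) ∧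
    Nonempty (greeneSphere 3 ≃g cubeGraph 3) ∧ IsContractible (greeneSphere 3) := by
  refine ⟨fun n h => ?_, ⟨greeneThreeIso⟩, (isContractible_cubeGraph 3).of_iso greeneThreeIso⟩
  have : Fact (4 ≤ n) := ⟨h⟩
  exact ⟨greene_homeomorph_sphere, greene_cliqueFree, greene_hasCubicalDimension,
    (greeneRigid n).isMonophobic_two, greene_isQuasimonophobic, greene_cubicalHomology_two,
    greene_gradedHomology_isZero 3, greene_gradedHomology_isZero 4, greene_isIso_filtInclusion 3,
    greene_exists_iso⟩
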